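/- **Theorem (soundness of the query encoding).** Let $Q$ be a well-formed SQL query over a schema $\mathcal S$, let $\Gamma$ be a symbolic database, and suppose $\mathcal S\vdash Q:\mathcal A$, $\Gamma\vdash Q\hookrightarrow R$ and $\mathcal S,\Gamma\vdash Q\leadsto\Phi$. Then every interpretation $\mathcal I$ with $\mathcal I\models\Phi$ satisfies $[\![Q]\!]_{\mathcal I(\Gamma)}=\mathcal I(R)$, where relations are compared as bags. Moreover, if $Q=\mathrm{OrderBy}(Q',\vec E,b)$, the two sides are also equal as lists up to the order among tuples with equal sort keys (their lists of $\vec E$-values are the same list); and if $Q$ contains no left, right or full outer join (outside of predicates), the two sides are literally equal as lists. The notions are as follows. *Queries.* Values are integers, Booleans and $\mathrm{Null}$. Queries are $Q_r::=Q\mid\mathrm{OrderBy}(Q,\vec E,b)$ and $Q::=R\mid\Pi_L(Q)\mid\sigma_\phi(Q)\mid\rho_R(Q)\mid Q\oplus Q\mid\mathrm{Distinct}(Q)\mid Q\times Q\mid Q\bowtie_\phi Q\mid$ left, right and full outer join on $\phi\mid\mathrm{GroupBy}(Q,\vec E,L,\phi)\mid\mathrm{With}(\vec Q,\vec R,Q)$,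 with $\oplus$ the set and bag versions of union, intersection and difference. Attribute lists $L$ consist of terms $A::=\mathrm{Cast}(\phi)\mid E\mid G(E)\mid A\diamond A$, possibly renamed, with $G\in\{\mathrm{Count},\mathrm{Min},\mathrm{Max},\mathrm{Sum},\mathrm{Avg}\}$; expressions are $E::=a\mid v\mid E\diamond E\mid\mathrm{ITE}(\phi,E,E)\mid\mathrm{Case}(\vec\phi,\vec E,E)$; predicates are $\phi::=\top\mid\bot\mid\mathrm{Null}\mid A\odot A\mid\mathrm{IsNull}(E)\mid\vec E\in\vec v\mid\vec E\in Q\mid\phi\wedge\phi\mid\phi\vee\phi\mid\neg\phi$. The name of an unnamed term and the name of an attribute after $\rho_R$ are given by arbitrary fixed functions. A schema maps relation names to lists of attribute names, and $\mathcal S\vdash Q:\mathcal A$ computes the attributes of $Q$ (products and joins concatenate, set and bag operations require equal attribute lists, $\Pi_L$ and $\mathrm{GroupBy}$ have the names of $L$). $Q$ is *well-formed* if every attribute used belongs to the subquery on which it is evaluated, membership tests have matching widths, grouping expressions contain no aggregates, and outside of aggregates the list $L$ and the $\mathrm{HAVING}$ condition of a $\mathrm{GroupBy}$ use attributes only inside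 expressions of its grouping list (and an aggregating $\Pi_L$ uses none outside of aggregates). *Concrete semantics.* A database maps relation names to lists of tuples; $[\![Q]\!]_{\mathcal D}$ is the usual SQL list semantics. Comparisons and arithmetic with a $\mathrm{Null}$ operand give $\mathrm{Null}$; $\wedge,\vee,\neg$ and both forms of $\in$ are three-valued; a tuple or group is selected iff the predicate is $\top$; division is Euclidean and division by $0$ gives $\mathrm{Null}$. Expressions are evaluated on lists of tuples, an attribute being read off the first tuple. Aggregates ignore $\mathrm{Null}$s and are $\mathrm{Null}$ if all arguments are; an aggregating projection returns one tuple. $\mathrm{Distinct}$ keeps first occurrences; bag difference deletes one occurrence per tuple of the right operand, and the bag intersection is $Q_1-(Q_1-Q_2)$; set operations remove duplicates. $\mathrm{GroupBy}$ forms one group per value of $\vec E$ (with $\mathrm{Null}$s grouped together), filters the groups by $\phi$ and evaluates $L$ on each. $\mathrm{With}$ evaluates $\vec Q$ in $\mathcal D$ and then $Q$ in $\mathcal D[\vec R\mapsto[\![\vec Q]\!]_{\mathcal D}]$. $\mathrm{OrderBy}$ is selection sort by $\vec E$, lexicographically, with $\mathrm{Null}$ least, ascending iff $b=\top$. *Symbolic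 databases.* A symbolic database $\Gamma$ maps relation names to lists of symbolic tuples. An interpretation $\mathcal I$ assigns a value $t.a$ to every symbolic tuple $t$ and attribute $a$, a truth value $\mathrm{Del}(t)$ ("deleted") to every $t$, and, for every occurrence of a subquery, truth values to predicates $g(t,j)$ ("$t$ is in group $j$") and $\mathrm{Paired}(i,j)$. For a list $R$ of symbolic tuples with attributes $\mathcal A$, $\mathcal I(R)$ is the list of the rows $(t.a)_{a\in\mathcal A}$, $t\in R$, $\neg\mathrm{Del}(t)$; and $\mathcal I(\Gamma)$ maps each relation name to $\mathcal I(\Gamma(R))$. *Symbolic result.* $\Gamma\vdash Q\hookrightarrow R$ is defined by recursion on $Q$: a base relation gives $\Gamma(R)$; $\mathrm{With}$ gives the result of its body in $\Gamma[\vec R\mapsto\vec T]$, $\Gamma\vdash Q_i\hookrightarrow T_i$; every other operator gives a list of fresh symbolic tuples. With $n,m$ the numbers of tuples of the operands, its length is $n$ for filter, renaming, non-aggregating projection, $\mathrm{Distinct}$, $\mathrm{GroupBy}$, $\mathrm{OrderBy}$, intersections and differences; $1$ for an aggregating projection; $n+m$ for unions; $nm$ for product and inner join; and $nm+n$, $nm+m$,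 $nm+m+n$ for left, right and full outer joins. *Encoding.* $\mathcal S,\Gamma\vdash Q\leadsto\Phi$ is defined by recursion on $Q$; $\Phi$ is the conjunction of the encodings of all subqueries (including those in membership tests) and the formula below. Expressions and predicates are translated to terms by the clauses of the concrete semantics with if-then-else, ranging over the tuples that are present (not deleted, or in the group at hand). Write $t_i$ (and $s_j$) for the tuples of the operand(s), $t'_i$ for those of the result; $t=t'$ means that the attributes agree position by position and $\mathrm{Del}(t)\leftrightarrow\mathrm{Del}(t')$, and $t\in T$ is the disjunction of $t=t'$ over $t'\in T$. - base relation: $\top$; renaming: $t'_i=t_i$; projection: the attributes of $t'_i$ are the values of $L$ on $t_i$, and $\mathrm{Del}(t'_i)\leftrightarrow\mathrm{Del}(t_i)$; aggregating projection: the attributes of $t'_1$ are the values of $L$ on all tuples, and $\neg\mathrm{Del}(t'_1)$. - filter: $t'_i=t_i$ if $\neg\mathrm{Del}(t_i)$ and $\phi(t_i)=\top$, otherwise $\mathrm{Del}(t'_i)$. - product: if $\neg\mathrm{Del}(t_i)\wedge\neg\mathrm{Del}(s_j)$, then $\neg\mathrm{Del}(t'_{ij})$ and the attributes of $t'_{ij}$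 are those of $t_i$ and $s_j$; otherwise $\mathrm{Del}(t'_{ij})$. Inner join: filter of the product. - left join: the inner join's formula, and for each $i$ the additional tuple $u_i$ has the attributes of $t_i$ and $\mathrm{Null}$s, and $(\neg\mathrm{Del}(t_i)\wedge\bigwedge_j\mathrm{Del}(t'_{ij}))\leftrightarrow\neg\mathrm{Del}(u_i)$. Right join: symmetrically. Full join: both. - $\mathrm{Distinct}$: $\mathrm{Del}(t'_i)$ if $t_i\in\{t_k:k<i\}$, otherwise $t'_i=t_i$. Bag union: $t'=t$ along the concatenation. Set union: $\mathrm{Distinct}$ of the bag union. Set intersection (difference): on the tuples $t_i$ of $\mathrm{Distinct}(Q_1)$, $t'_i=t_i$ if $t_i\in\vec s$ ($t_i\notin\vec s$), otherwise $\mathrm{Del}(t'_i)$. - bag difference: $\mathrm{Paired}(i,j)\leftrightarrow t_i=s_j\wedge\bigwedge_{k<i}\neg\mathrm{Paired}(k,j)\wedge\bigwedge_{k<j}\neg\mathrm{Paired}(i,k)$; $t'_i=t_i$ if $\neg\mathrm{Del}(t_i)\wedge\bigwedge_j\neg\mathrm{Paired}(i,j)$, otherwise $\mathrm{Del}(t'_i)$.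 Bag intersection: the encoding of $Q_1-(Q_1-Q_2)$. - $\mathrm{GroupBy}$: $\sum_{j\le i}\mathrm{If}(g(t_i,j),1,0)=\mathrm{If}(\mathrm{Del}(t_i),0,1)$; $g(t_i,j)\leftrightarrow\neg\mathrm{Del}(t_i)\wedge g(t_j,j)\wedge\vec E(t_i)=\vec E(t_j)$ for $j<i$; with $g^{-1}(i)$ the list of the $t_k$, $k\ge i$, such that $g(t_k,i)$: if $g(t_i,i)$ and $\phi(g^{-1}(i))=\top$, then $\neg\mathrm{Del}(t'_i)$ and the attributes of $t'_i$ are the values of $L$ on $g^{-1}(i)$; otherwise $\mathrm{Del}(t'_i)$. - $\mathrm{With}$: the encodings of the $Q_i$ and that of the body in the extended schema and symbolic database. - $\mathrm{OrderBy}$: fresh $t''_i$ list the non-deleted $t_k$ in order, followed by deleted tuples; $t'_i=t''_{\mathrm{find}(i)}$, where $\mathrm{find}(i)$ is the position of the $i$-th tuple taken by selection sort, and $\mathrm{Del}(t'_i)$ if no tuple is left. In words: running $Q$ on the concrete database read off the model yields the symbolic output relation evaluated under the model. -/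

import Mathlib

namespace Sql

/-! # Values and three-valued logic -/

abbrev RelName := String
abbrev AttrName := String

/-- Integers, Booleans and `Null`. Truth values of predicates are `bool true`, `bool false`
and `null`. -/
inductive Value where
  | null
  | int (z : ℤ)
  | bool (b : Bool)
  deriving DecidableEq

/-- Arithmetic operators `+ - × / %`. -/
inductive ArithOp where
  | add | sub | mul | div | mod
  deriving DecidableEq

/-- Comparison operators `≤ < = ≠ > ≥`. -/
inductive CmpOp where
  | le | lt | eq | ne | gt | ge
  deriving DecidableEq

/-- Aggregate functions. -/
inductive Agg where
  | count | min | max | sum | avg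
  deriving DecidableEq

/-- The strict order of values; `Null` plays the role of `-∞`. (Well-typed queries never compare
an integer with a Boolean; such pairs are ordered so that the order is total.) -/
def Value.lt : Value → Value → Bool
  | .null, .null => false
  | .null, _ => true
  | .int a, .int b => decide (a < b)
  | .int _, .bool _ => true
  | .bool a, .bool b => !a && b
  | _, _ => false

/-- Comparison of two values. -/
def CmpOp.holds : CmpOp → Value → Value → Bool
  | .le, v, w => !(w.lt v)
  | .lt, v, w => v.lt w
  | .eq, v, w => decide (v = w)
  | .ne, v, w => decide (v ≠ w)
  | .gt, v, w => w.lt v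
  | .ge, v, w => !(v.lt w)

/-- Integer arithmetic with `Null` propagation; `/` and `%` are Euclidean (as in SMT-LIB), and
division by zero gives `Null` (as in SQL), as do operands that are not integers. -/
def ArithOp.apply : ArithOp → Value → Value → Value
  | .add, .int a, .int b => .int (a + b)
  | .sub, .int a, .int b => .int (a - b)
  | .mul, .int a, .int b => .int (a * b)
  | .div, .int a, .int b => if b = 0 then .null else .int (a / b)
  | .mod, .int a, .int b => if b = 0 then .null else .int (a % b)
  | _, _, _ => .null

/-- Minimum, where `null` stands for the neutral element `+∞`. -/
def Value.min (v w : Value) : Value :=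
  if v = .null then w else if w = .null then v else if w.lt v then w else v

/-- Maximum, where `null` stands for the neutral element `-∞`. -/
def Value.max (v w : Value) : Value :=
  if v = .null then w else if w = .null then v else if v.lt w then w else v

/-- Three-valued comparison: `Null` as soon as one of the operands is `Null`. -/
def cmp3 (op : CmpOp) (v w : Value) : Value :=
  if v = .null ∨ w = .null then .null else .bool (op.holds v w)

def and3 (v w : Value) : Value :=
  if (v = .null ∧ w = .null) ∨ (v = .null ∧ w = .bool true) ∨ (v = .bool true ∧ w = .null)
  then .null else .bool (decide (v = .bool true ∧ w = .bool true))

def or3 (v w : Value) : Value :=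
  if (v = .null ∧ w = .null) ∨ (v = .null ∧ w = .bool false) ∨ (v = .bool false ∧ w = .null)
  then .null else .bool (decide (v = .bool true ∨ w = .bool true))

def not3 (v : Value) : Value :=
  if v = .null then .null else .bool (decide (v ≠ .bool true))

/-! # Syntax of queries -/

inductive CollOp where
  | union | inter | diff          -- set union, intersection, difference
  | unionAll | interAll | diffAll -- bag union, intersection, difference
  deriving DecidableEq

mutual
/-- Expressions `E`. -/
inductive Expr where
  | attr (a : AttrName)
  | val (v : Value)
  | arith (op : ArithOp) (E₁ E₂ : Expr)
  | ite (φ : Pred) (E₁ E₂ : Expr)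
  | case (bs : Branches) (E : Expr)
/-- The two vectors `φ⃗`, `E⃗` of equal length in `Case(φ⃗, E⃗, E')`. -/
inductive Branches where
  | nil
  | cons (φ : Pred) (E : Expr) (bs : Branches)
/-- Vectors `E⃗` of expressions. -/
inductive ExprList where
  | nil
  | cons (E : Expr) (Es : ExprList)
/-- Attribute terms `A`, which may contain aggregates. -/
inductive Attr where
  | cast (φ : Pred)
  | expr (E : Expr)
  | agg (G : Agg) (E : Expr)
  | arith (op : ArithOp) (A₁ A₂ : Attr)
/-- Attribute lists `L ::= id(A) | ρ_a(A) | L, L`. -/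
inductive AttrList where
  | id (A : Attr)
  | rename (a : AttrName) (A : Attr)
  | append (L₁ L₂ : AttrList)
/-- Predicates `φ`. -/
inductive Pred where
  | const (b : Bool)
  | null
  | cmp (op : CmpOp) (A₁ A₂ : Attr)
  | isNull (E : Expr)
  | inVals (Es : ExprList) (vs : List (List Value))
  | inQuery (Es : ExprList) (Q : Query)
  | and (φ₁ φ₂ : Pred)
  | or (φ₁ φ₂ : Pred)
  | not (φ : Pred)
/-- Subqueries, that is, queries without `OrderBy`. -/
inductive Query where
  | rel (R : RelName)
  | proj (L : AttrList) (Q : Query)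
  | filter (φ : Pred) (Q : Query)
  | rename (R : RelName) (Q : Query)
  | coll (op : CollOp) (Q₁ Q₂ : Query)
  | distinct (Q : Query)
  | prod (Q₁ Q₂ : Query)
  | innerJoin (φ : Pred) (Q₁ Q₂ : Query)
  | leftJoin (φ : Pred) (Q₁ Q₂ : Query)
  | rightJoin (φ : Pred) (Q₁ Q₂ : Query)
  | fullJoin (φ : Pred) (Q₁ Q₂ : Query)
  | groupBy (Q : Query) (Es : ExprList) (L : AttrList) (φ : Pred)
  | withQ (bs : Bindings) (Q : Query)
/-- The two vectors `Q⃗`, `R⃗` of equal length in `With(Q⃗, R⃗, Q)`. -/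
inductive Bindings where
  | nil
  | cons (R : RelName) (Q : Query) (bs : Bindings)
end

/-- Queries; `OrderBy` occurs only at the top level. -/
inductive TopQuery where
  | plain (Q : Query)
  | orderBy (Q : Query) (Es : ExprList) (asc : Bool)

/-- A naming convention: the name `ToString(A)` of an attribute term, and the name
`rename(R, a)` of the attribute `a` after its relation has been renamed to `R`. Nothing is
required of either function. -/
structure Naming where
  toStr : Attr → AttrName
  rename : RelName → AttrName → AttrName

/-- The attribute names produced by an attribute list. -/
def AttrList.names (N : Naming) : AttrList → List AttrName
  | .id A => [N.toStr A]
  | .rename a _ => [a]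
  | .append L₁ L₂ => L₁.names N ++ L₂.names N

/-! ## Attributes, aggregates and subqueries occurring in an expression -/

mutual
/-- The attribute names that are evaluated on the current tuples (those inside a membership
subquery are not included: subqueries are uncorrelated). -/
def Expr.attrs : Expr → List AttrName
  | .attr a => [a]
  | .val _ => []
  | .arith _ E₁ E₂ => E₁.attrs ++ E₂.attrs
  | .ite φ E₁ E₂ => φ.attrs ++ E₁.attrs ++ E₂.attrs
  | .case bs E => bs.attrs ++ E.attrs
def Branches.attrs : Branches → List AttrName
  | .nil => []
  | .cons φ E bs => φ.attrs ++ E.attrs ++ bs.attrs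
def ExprList.attrs : ExprList → List AttrName
  | .nil => []
  | .cons E Es => E.attrs ++ Es.attrs
def Attr.attrs : Attr → List AttrName
  | .cast φ => φ.attrs
  | .expr E => E.attrs
  | .agg _ E => E.attrs
  | .arith _ A₁ A₂ => A₁.attrs ++ A₂.attrs
def Pred.attrs : Pred → List AttrName
  | .const _ => []
  | .null => []
  | .cmp _ A₁ A₂ => A₁.attrs ++ A₂.attrs
  | .isNull E => E.attrs
  | .inVals Es _ => Es.attrs
  | .inQuery Es _ => Es.attrs
  | .and φ₁ φ₂ => φ₁.attrs ++ φ₂.attrs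
  | .or φ₁ φ₂ => φ₁.attrs ++ φ₂.attrs
  | .not φ => φ.attrs
end

def AttrList.attrs : AttrList → List AttrName
  | .id A => A.attrs
  | .rename _ A => A.attrs
  | .append L₁ L₂ => L₁.attrs ++ L₂.attrs

mutual
/-- Does an aggregate function occur (outside of membership subqueries)? -/
def Expr.hasAgg : Expr → Bool
  | .attr _ => false
  | .val _ => false
  | .arith _ E₁ E₂ => E₁.hasAgg || E₂.hasAgg
  | .ite φ E₁ E₂ => φ.hasAgg || E₁.hasAgg || E₂.hasAgg
  | .case bs E => bs.hasAgg || E.hasAgg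
def Branches.hasAgg : Branches → Bool
  | .nil => false
  | .cons φ E bs => φ.hasAgg || E.hasAgg || bs.hasAgg
def ExprList.hasAgg : ExprList → Bool
  | .nil => false
  | .cons E Es => E.hasAgg || Es.hasAgg
def Attr.hasAgg : Attr → Bool
  | .cast φ => φ.hasAgg
  | .expr E => E.hasAgg
  | .agg _ _ => true
  | .arith _ A₁ A₂ => A₁.hasAgg || A₂.hasAgg
def Pred.hasAgg : Pred → Bool
  | .const _ => false
  | .null => false
  | .cmp _ A₁ A₂ => A₁.hasAgg || A₂.hasAgg
  | .isNull E => E.hasAgg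
  | .inVals Es _ => Es.hasAgg
  | .inQuery Es _ => Es.hasAgg
  | .and φ₁ φ₂ => φ₁.hasAgg || φ₂.hasAgg
  | .or φ₁ φ₂ => φ₁.hasAgg || φ₂.hasAgg
  | .not φ => φ.hasAgg
end

def AttrList.hasAgg : AttrList → Bool
  | .id A => A.hasAgg
  | .rename _ A => A.hasAgg
  | .append L₁ L₂ => L₁.hasAgg || L₂.hasAgg

def ExprList.length : ExprList → ℕ
  | .nil => 0
  | .cons _ Es => Es.length + 1

def ExprList.Mem (E : Expr) : ExprList → Prop
  | .nil => False
  | .cons E' Es => E = E' ∨ Es.Mem E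

/-! # Schemas and the attributes of a query -/

/-- The attributes of each relation in the domain. (Attribute types play no role below, since
every operation is total on values.) -/
abbrev Schema := RelName → Option (List AttrName)

mutual
/-- `attrsQ N S Q = some 𝒜` is the judgment `S ⊢ Q : 𝒜`; it is `none` for ill-formed queries. -/
def attrsQ (N : Naming) (S : Schema) : Query → Option (List AttrName)
  | .rel R => S R
  | .proj L Q => do
      let A ← attrsQ N S Q
      if L.attrs ⊆ A then some (L.names N) else none
  | .filter _ Q => attrsQ N S Q
  | .rename R Q => do
      let A ← attrsQ N S Q
      some (A.map (N.rename R))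
  | .coll _ Q₁ Q₂ => do
      let A₁ ← attrsQ N S Q₁
      let A₂ ← attrsQ N S Q₂
      if A₁ = A₂ then some A₁ else none
  | .distinct Q => attrsQ N S Q
  | .prod Q₁ Q₂ | .innerJoin _ Q₁ Q₂ | .leftJoin _ Q₁ Q₂ | .rightJoin _ Q₁ Q₂
  | .fullJoin _ Q₁ Q₂ => do
      let A₁ ← attrsQ N S Q₁
      let A₂ ← attrsQ N S Q₂
      some (A₁ ++ A₂)
  | .groupBy Q _ L _ => do
      let A ← attrsQ N S Q
      if L.attrs ⊆ A then some (L.names N) else none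
  | .withQ bs Q => do
      let S' ← attrsB N S bs S
      attrsQ N S' Q
/-- The schema `S'[R₁ ↦ 𝒜₁, …, Rₙ ↦ 𝒜ₙ]` where `S ⊢ Qᵢ : 𝒜ᵢ`. -/
def attrsB (N : Naming) (S : Schema) : Bindings → Schema → Option Schema
  | .nil, S' => some S'
  | .cons R Q bs, S' => do
      let A ← attrsQ N S Q
      attrsB N S bs (Function.update S' R (some A))
end

def TopQuery.attrs (N : Naming) (S : Schema) : TopQuery → Option (List AttrName)
  | .plain Q => attrsQ N S Q
  | .orderBy Q _ _ => attrsQ N S Q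

/-! # Well-formed queries (the static analysis)

Every attribute that is used must be an attribute of the subquery it is evaluated on, the two
sides of a membership test must have the same width, and next to aggregates no attribute may be
used whose value is not determined by the group. -/

mutual
/-- The value is determined by the group, given the grouping expressions `G`: outside of
aggregates, attributes occur only within expressions that are listed in `G`. -/
def Expr.Grouped (G : ExprList) : Expr → Prop
  | .attr a => G.Mem (.attr a)
  | .val _ => True
  | .arith op E₁ E₂ => G.Mem (.arith op E₁ E₂) ∨ (E₁.Grouped G ∧ E₂.Grouped G)
  | .ite φ E₁ E₂ => G.Mem (.ite φ E₁ E₂) ∨ (φ.Grouped G ∧ E₁.Grouped G ∧ E₂.Grouped G)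
  | .case bs E => G.Mem (.case bs E) ∨ (bs.Grouped G ∧ E.Grouped G)
def Branches.Grouped (G : ExprList) : Branches → Prop
  | .nil => True
  | .cons φ E bs => φ.Grouped G ∧ E.Grouped G ∧ bs.Grouped G
def ExprList.Grouped (G : ExprList) : ExprList → Prop
  | .nil => True
  | .cons E Es => E.Grouped G ∧ ExprList.Grouped G Es
def Attr.Grouped (G : ExprList) : Attr → Prop
  | .cast φ => φ.Grouped G
  | .expr E => E.Grouped G
  | .agg _ _ => True
  | .arith _ A₁ A₂ => A₁.Grouped G ∧ A₂.Grouped G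
def Pred.Grouped (G : ExprList) : Pred → Prop
  | .const _ => True
  | .null => True
  | .cmp _ A₁ A₂ => A₁.Grouped G ∧ A₂.Grouped G
  | .isNull E => E.Grouped G
  | .inVals Es _ => ExprList.Grouped G Es
  | .inQuery Es _ => ExprList.Grouped G Es
  | .and φ₁ φ₂ => φ₁.Grouped G ∧ φ₂.Grouped G
  | .or φ₁ φ₂ => φ₁.Grouped G ∧ φ₂.Grouped G
  | .not φ => φ.Grouped G
end

def AttrList.Grouped (G : ExprList) : AttrList → Prop
  | .id A => A.Grouped G
  | .rename _ A => A.Grouped G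
  | .append L₁ L₂ => L₁.Grouped G ∧ L₂.Grouped G

mutual
def Query.WellFormed (N : Naming) (S : Schema) : Query → Prop
  | .rel R => (S R).isSome
  | .proj L Q => Q.WellFormed N S ∧ L.WellFormed N S ∧
      (∃ A, attrsQ N S Q = some A ∧ L.attrs ⊆ A) ∧ (L.hasAgg → L.Grouped .nil)
  | .filter φ Q => Q.WellFormed N S ∧ φ.WellFormed N S ∧
      ∃ A, attrsQ N S Q = some A ∧ φ.attrs ⊆ A
  | .rename _ Q => Q.WellFormed N S
  | .coll _ Q₁ Q₂ => Q₁.WellFormed N S ∧ Q₂.WellFormed N S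
  | .distinct Q => Q.WellFormed N S
  | .prod Q₁ Q₂ => Q₁.WellFormed N S ∧ Q₂.WellFormed N S
  | .innerJoin φ Q₁ Q₂ | .leftJoin φ Q₁ Q₂ | .rightJoin φ Q₁ Q₂ | .fullJoin φ Q₁ Q₂ =>
      Q₁.WellFormed N S ∧ Q₂.WellFormed N S ∧ φ.WellFormed N S ∧
      ∃ A₁ A₂, attrsQ N S Q₁ = some A₁ ∧ attrsQ N S Q₂ = some A₂ ∧ φ.attrs ⊆ A₁ ++ A₂
  | .groupBy Q Es L φ => Q.WellFormed N S ∧ Es.WellFormed N S ∧ L.WellFormed N S ∧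
      φ.WellFormed N S ∧
      (∃ A, attrsQ N S Q = some A ∧ Es.attrs ⊆ A ∧ L.attrs ⊆ A ∧ φ.attrs ⊆ A) ∧
      Es.hasAgg = false ∧ L.Grouped Es ∧ φ.Grouped Es
  | .withQ bs Q => bs.WellFormed N S ∧ ∃ S', attrsB N S bs S = some S' ∧ Q.WellFormed N S'
def Bindings.WellFormed (N : Naming) (S : Schema) : Bindings → Prop
  | .nil => True
  | .cons _ Q bs => Q.WellFormed N S ∧ bs.WellFormed N S
/-- For expressions, attribute terms and predicates: their subqueries are well-formed and
membership tests have matching widths. -/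
def Expr.WellFormed (N : Naming) (S : Schema) : Expr → Prop
  | .attr _ => True
  | .val _ => True
  | .arith _ E₁ E₂ => E₁.WellFormed N S ∧ E₂.WellFormed N S
  | .ite φ E₁ E₂ => φ.WellFormed N S ∧ E₁.WellFormed N S ∧ E₂.WellFormed N S
  | .case bs E => bs.WellFormed N S ∧ E.WellFormed N S
def Branches.WellFormed (N : Naming) (S : Schema) : Branches → Prop
  | .nil => True
  | .cons φ E bs => φ.WellFormed N S ∧ E.WellFormed N S ∧ bs.WellFormed N S
def ExprList.WellFormed (N : Naming) (S : Schema) : ExprList → Prop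
  | .nil => True
  | .cons E Es => E.WellFormed N S ∧ Es.WellFormed N S
def Attr.WellFormed (N : Naming) (S : Schema) : Attr → Prop
  | .cast φ => φ.WellFormed N S
  | .expr E => E.WellFormed N S
  | .agg _ E => E.WellFormed N S
  | .arith _ A₁ A₂ => A₁.WellFormed N S ∧ A₂.WellFormed N S
def AttrList.WellFormed (N : Naming) (S : Schema) : AttrList → Prop
  | .id A => A.WellFormed N S
  | .rename _ A => A.WellFormed N S
  | .append L₁ L₂ => L₁.WellFormed N S ∧ L₂.WellFormed N S
def Pred.WellFormed (N : Naming) (S : Schema) : Pred → Prop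
  | .const _ => True
  | .null => True
  | .cmp _ A₁ A₂ => A₁.WellFormed N S ∧ A₂.WellFormed N S
  | .isNull E => E.WellFormed N S
  | .inVals Es vs => Es.WellFormed N S ∧ ∀ v ∈ vs, v.length = Es.length
  | .inQuery Es Q => Es.WellFormed N S ∧ Q.WellFormed N S ∧
      ∃ A, attrsQ N S Q = some A ∧ A.length = Es.length
  | .and φ₁ φ₂ => φ₁.WellFormed N S ∧ φ₂.WellFormed N S
  | .or φ₁ φ₂ => φ₁.WellFormed N S ∧ φ₂.WellFormed N S
  | .not φ => φ.WellFormed N S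
end

def TopQuery.WellFormed (N : Naming) (S : Schema) : TopQuery → Prop
  | .plain Q => Q.WellFormed N S
  | .orderBy Q Es _ => Q.WellFormed N S ∧ Es.WellFormed N S ∧
      ∃ A, attrsQ N S Q = some A ∧ Es.attrs ⊆ A

mutual
/-- No left, right or full outer join occurs in the query (outside of predicates). -/
def Query.OuterJoinFree : Query → Prop
  | .rel _ => True
  | .proj _ Q => Q.OuterJoinFree
  | .filter _ Q => Q.OuterJoinFree
  | .rename _ Q => Q.OuterJoinFree
  | .coll _ Q₁ Q₂ => Q₁.OuterJoinFree ∧ Q₂.OuterJoinFree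
  | .distinct Q => Q.OuterJoinFree
  | .prod Q₁ Q₂ => Q₁.OuterJoinFree ∧ Q₂.OuterJoinFree
  | .innerJoin _ Q₁ Q₂ => Q₁.OuterJoinFree ∧ Q₂.OuterJoinFree
  | .leftJoin _ _ _ => False
  | .rightJoin _ _ _ => False
  | .fullJoin _ _ _ => False
  | .groupBy Q _ _ _ => Q.OuterJoinFree
  | .withQ bs Q => bs.OuterJoinFree ∧ Q.OuterJoinFree
def Bindings.OuterJoinFree : Bindings → Prop
  | .nil => True
  | .cons _ Q bs => Q.OuterJoinFree ∧ bs.OuterJoinFree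
end

def TopQuery.OuterJoinFree : TopQuery → Prop
  | .plain Q => Q.OuterJoinFree
  | .orderBy Q _ _ => Q.OuterJoinFree

/-! # Semantics of queries on concrete databases -/

abbrev Tuple := List (AttrName × Value)
abbrev Relation := List Tuple
abbrev Database := RelName → Relation

/-- The value of attribute `a` in the first tuple of `xs`. -/
def lookupHead (xs : Relation) (a : AttrName) : Value :=
  ((xs.headD []).lookup a).getD .null

/-- The value of an aggregate, given the list of the values of its argument. -/
def Agg.eval (G : Agg) (vs : List Value) : Value :=
  let count := if vs.all (fun v => v = .null) then .null else
    vs.foldl (fun n v => ArithOp.add.apply n (if v = .null then .int 0 else .int 1)) (.int 0)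
  let sum := if vs.all (fun v => v = .null) then .null else
    vs.foldl (fun n v => ArithOp.add.apply n (if v = .null then .int 0 else v)) (.int 0)
  match G with
  | .count => count
  | .sum => sum
  | .avg => ArithOp.div.apply sum count
  | .min => vs.foldl Value.min .null
  | .max => vs.foldl Value.max .null

/-- `⋀ⱼ vⱼ = wⱼ` in three-valued logic. -/
def rowEq3 (vs ws : List Value) : Value :=
  (List.zipWith (cmp3 .eq) vs ws).foldr and3 (.bool true)

/-- Keep the first occurrence of every element. -/
def dedup {α : Type*} [DecidableEq α] (xs : List α) : List α :=
  xs.foldr (fun x ys => x :: ys.filter (fun y => decide (x ≠ y))) []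

/-- Bag difference: every element of `ys` deletes one occurrence from `xs`, if there is one. -/
def bagDiff {α : Type*} [DecidableEq α] (xs ys : List α) : List α :=
  ys.foldl (fun zs y => if y ∈ zs then zs.erase y else zs) xs

/-- The Cartesian product; two tuples are merged by concatenation. -/
def crossProd (xs ys : Relation) : Relation :=
  xs.flatMap (fun x => ys.map (fun y => x ++ y))

/-- A tuple of `Null`s. -/
def nullTuple (A : List AttrName) : Tuple := A.map (fun a => (a, .null))

/-- Left outer join; `θ` is the join condition, `A₂` are the attributes of `ys`. -/
def leftOuter (θ : Tuple → Bool) (A₂ : List AttrName) (xs ys : Relation) : Relation :=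
  xs.flatMap (fun x =>
    let v₁ := (crossProd [x] ys).filter θ
    if v₁.length = 0 then [x ++ nullTuple A₂] else v₁)

/-- Right outer join; `A₁` are the attributes of `xs`. -/
def rightOuter (θ : Tuple → Bool) (A₁ : List AttrName) (xs ys : Relation) : Relation :=
  ys.flatMap (fun y =>
    let v₁ := (crossProd xs [y]).filter θ
    if v₁.length = 0 then [nullTuple A₁ ++ y] else v₁)

/-- Full outer join. -/
def fullOuter (θ : Tuple → Bool) (A₁ A₂ : List AttrName) (xs ys : Relation) : Relation :=
  leftOuter θ A₂ xs ys ++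
    (ys.filter (fun y => decide (((crossProd xs [y]).filter θ).length = 0))).map
      (fun y => nullTuple A₁ ++ y)

/-- The groups of `xs` with respect to the key function `key`. -/
def groups (key : Tuple → List Value) (xs : Relation) : List Relation :=
  (dedup (xs.map key)).map (fun k => xs.filter (fun x => decide (key x = k)))

mutual
/-- `⟦E⟧` on a list `xs` of tuples. The schema is used for the width of null tuples only. -/
def evalE (N : Naming) (S : Schema) (D : Database) (xs : Relation) : Expr → Value
  | .attr a => lookupHead xs a
  | .val v => v
  | .arith op E₁ E₂ => op.apply (evalE N S D xs E₁) (evalE N S D xs E₂)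
  | .ite φ E₁ E₂ =>
      if evalP N S D xs φ = .bool true then evalE N S D xs E₁ else evalE N S D xs E₂
  | .case bs E => evalBr N S D xs bs (evalE N S D xs E)
/-- `ITE(φ₁, E₁, ITE(φ₂, E₂, …))` with the final value `d`. -/
def evalBr (N : Naming) (S : Schema) (D : Database) (xs : Relation) : Branches → Value → Value
  | .nil, d => d
  | .cons φ E bs, d =>
      if evalP N S D xs φ = .bool true then evalE N S D xs E else evalBr N S D xs bs d
def evalEs (N : Naming) (S : Schema) (D : Database) (xs : Relation) : ExprList → List Value
  | .nil => []
  | .cons E Es => evalE N S D xs E :: evalEs N S D xs Es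
def evalA (N : Naming) (S : Schema) (D : Database) (xs : Relation) : Attr → Value
  | .cast φ =>
      let v := evalP N S D xs φ
      if v = .null then .null else if v = .bool true then .int 1 else .int 0
  | .expr E => evalE N S D xs E
  | .agg G E => G.eval (xs.map (fun x => evalE N S D [x] E))
  | .arith op A₁ A₂ => op.apply (evalA N S D xs A₁) (evalA N S D xs A₂)
def evalL (N : Naming) (S : Schema) (D : Database) (xs : Relation) : AttrList → Tuple
  | .id A => [(N.toStr A, evalA N S D xs A)]
  | .rename a A => [(a, evalA N S D xs A)]
  | .append L₁ L₂ => evalL N S D xs L₁ ++ evalL N S D xs L₂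
def evalP (N : Naming) (S : Schema) (D : Database) (xs : Relation) : Pred → Value
  | .const b => .bool b
  | .null => .null
  | .cmp op A₁ A₂ => cmp3 op (evalA N S D xs A₁) (evalA N S D xs A₂)
  | .isNull E => if evalE N S D xs E = .null then .bool true else .bool false
  | .inVals Es vs =>
      (vs.map (fun v => rowEq3 (evalEs N S D xs Es) v)).foldr or3 (.bool false)
  | .inQuery Es Q =>
      (evalQ N S D Q).foldl
        (fun b y => or3 b (rowEq3 (evalEs N S D xs Es) (y.map Prod.snd))) (.bool false)
  | .and φ₁ φ₂ => and3 (evalP N S D xs φ₁) (evalP N S D xs φ₂)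
  | .or φ₁ φ₂ => or3 (evalP N S D xs φ₁) (evalP N S D xs φ₂)
  | .not φ => not3 (evalP N S D xs φ)
/-- `⟦Q⟧_D`, a list representing a bag of tuples. -/
def evalQ (N : Naming) (S : Schema) (D : Database) : Query → Relation
  | .rel R => D R
  | .proj L Q =>
      if L.hasAgg then [evalL N S D (evalQ N S D Q) L]
      else (evalQ N S D Q).map (fun x => evalL N S D [x] L)
  | .filter φ Q => (evalQ N S D Q).filter (fun x => decide (evalP N S D [x] φ = .bool true))
  | .rename R Q => (evalQ N S D Q).map (fun x => x.map (fun av => (N.rename R av.1, av.2)))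
  | .coll op Q₁ Q₂ =>
      let xs := evalQ N S D Q₁
      let ys := evalQ N S D Q₂
      match op with
      | .union => dedup (xs ++ ys)
      | .inter => (dedup xs).filter (fun x => decide (x ∈ ys))
      | .diff => (dedup xs).filter (fun x => decide (x ∉ ys))
      | .unionAll => xs ++ ys
      | .interAll => bagDiff xs (bagDiff xs ys)
      | .diffAll => bagDiff xs ys
  | .distinct Q => dedup (evalQ N S D Q)
  | .prod Q₁ Q₂ => crossProd (evalQ N S D Q₁) (evalQ N S D Q₂)
  | .innerJoin φ Q₁ Q₂ =>
      (crossProd (evalQ N S D Q₁) (evalQ N S D Q₂)).filter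
        (fun x => decide (evalP N S D [x] φ = .bool true))
  | .leftJoin φ Q₁ Q₂ =>
      leftOuter (fun x => decide (evalP N S D [x] φ = .bool true))
        ((attrsQ N S Q₂).getD []) (evalQ N S D Q₁) (evalQ N S D Q₂)
  | .rightJoin φ Q₁ Q₂ =>
      rightOuter (fun x => decide (evalP N S D [x] φ = .bool true))
        ((attrsQ N S Q₁).getD []) (evalQ N S D Q₁) (evalQ N S D Q₂)
  | .fullJoin φ Q₁ Q₂ =>
      fullOuter (fun x => decide (evalP N S D [x] φ = .bool true))
        ((attrsQ N S Q₁).getD []) ((attrsQ N S Q₂).getD [])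
        (evalQ N S D Q₁) (evalQ N S D Q₂)
  | .groupBy Q Es L φ =>
      ((groups (fun x => evalEs N S D [x] Es) (evalQ N S D Q)).filter
        (fun xs => decide (evalP N S D xs φ = .bool true))).map (fun xs => evalL N S D xs L)
  | .withQ bs Q => evalQ N ((attrsB N S bs S).getD S) (evalB N S D bs D) Q
/-- The database `D'[Rᵢ ↦ ⟦Qᵢ⟧_D]`. -/
def evalB (N : Naming) (S : Schema) (D : Database) : Bindings → Database → Database
  | .nil, D' => D'
  | .cons R Q bs, D' => evalB N S D bs (Function.update D' R (evalQ N S D Q))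
end

/-- Comparison `x₁ ≤ x₂` of two tuples by their lists of sort keys. -/
def keyLe (ks₁ ks₂ : List Value) : Bool :=
  (List.zip ks₁ ks₂).foldr
    (fun k y => if k.1.lt k.2 then true else if k.2.lt k.1 then false else y) true

/-- `Cmp(E⃗, b, x₁, x₂)`, in terms of the sort keys. -/
def sortCmp (asc : Bool) (ks₁ ks₂ : List Value) : Bool := asc != keyLe ks₁ ks₂

/-- `MinTuple(E⃗, b, xs)`. -/
def minTuple (key : Tuple → List Value) (asc : Bool) (xs : Relation) : Tuple :=
  xs.foldl (fun x y => if sortCmp asc (key x) (key y) then y else x) (xs.headD [])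

/-- Selection sort. -/
def orderRel (key : Tuple → List Value) (asc : Bool) (r : Relation) : Relation :=
  r.foldl (fun xs _ => xs ++ [minTuple key asc (bagDiff r xs)]) []

/-- `⟦Q⟧_D` for top-level queries. -/
def TopQuery.eval (N : Naming) (S : Schema) (D : Database) : TopQuery → Relation
  | .plain Q => evalQ N S D Q
  | .orderBy Q Es asc => orderRel (fun x => evalEs N S D [x] Es) asc (evalQ N S D Q)


/-! # Symbolic databases and formulas -/

/-- An occurrence of a subquery in a query: the path from the occurrence to the root. -/
abbrev Label := List ℕ

/-- Symbolic tuples: those of the input database, and those that are introduced for the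
occurrence `p` of a subquery (`tag` separates several lists introduced at the same place). -/
inductive SymTuple where
  | input (n : ℕ)
  | fresh (p : Label) (tag i : ℕ)
  deriving DecidableEq

/-- `σ(n)`: a list of `n` fresh symbolic tuples. -/
def sigma (p : Label) (tag n : ℕ) : List SymTuple := (List.range n).map (SymTuple.fresh p tag)

/-- A symbolic database `Γ` maps relation names to lists of symbolic tuples. -/
abbrev SymDB := RelName → Option (List SymTuple)

mutual
/-- Terms, whose values are elements of `Value`. -/
inductive Term where
  | const (v : Value)
  | attr (a : AttrName) (t : SymTuple)
  | arith (op : ArithOp) (s t : Term)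
  | min (s t : Term)
  | max (s t : Term)
  | ite (F : Formula) (s t : Term)
/-- Formulas. The uninterpreted functions are the attributes of symbolic tuples, `Del`, and, for
every occurrence `p` of a subquery, the group assignment `g` and the predicate `Paired`. -/
inductive Formula where
  | tru
  | eq (s t : Term)
  | cmp (op : CmpOp) (s t : Term)
  | lt (s t : Term)
  | del (t : SymTuple)
  | grp (p : Label) (t : SymTuple) (j : ℕ)
  | paired (p : Label) (tag i j : ℕ)
  | not (F : Formula)
  | and (F G : Formula)
  | or (F G : Formula)
  | imp (F G : Formula)
  | iff (F G : Formula)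
end

/-- An interpretation of the uninterpreted functions. -/
structure Interp where
  attr : AttrName → SymTuple → Value
  del : SymTuple → Bool
  grp : Label → SymTuple → ℕ → Bool
  paired : Label → ℕ → ℕ → ℕ → Bool

mutual
def Term.eval (I : Interp) : Term → Value
  | .const v => v
  | .attr a t => I.attr a t
  | .arith op s t => op.apply (s.eval I) (t.eval I)
  | .min s t => (s.eval I).min (t.eval I)
  | .max s t => (s.eval I).max (t.eval I)
  | .ite F s t => if F.eval I then s.eval I else t.eval I
def Formula.eval (I : Interp) : Formula → Bool
  | .tru => true
  | .eq s t => decide (s.eval I = t.eval I)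
  | .cmp op s t => op.holds (s.eval I) (t.eval I)
  | .lt s t => (s.eval I).lt (t.eval I)
  | .del t => I.del t
  | .grp p t j => I.grp p t j
  | .paired p tag i j => I.paired p tag i j
  | .not F => !(F.eval I)
  | .and F G => F.eval I && G.eval I
  | .or F G => F.eval I || G.eval I
  | .imp F G => !(F.eval I) || G.eval I
  | .iff F G => F.eval I == G.eval I
end

/-- `I ⊨ Φ`. -/
def Interp.Satisfies (I : Interp) (F : Formula) : Prop := F.eval I = true

/-- `I(R)` for a symbolic relation with attributes `A`: the values of the tuples that are not
deleted. -/
def Interp.rel (I : Interp) (A : List AttrName) (T : List SymTuple) : Relation :=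
  (T.filter (fun t => !(I.del t))).map (fun t => A.map (fun a => (a, I.attr a t)))

/-- `I(Γ)`. -/
def Interp.db (I : Interp) (S : Schema) (Γ : SymDB) : Database := fun R =>
  match S R, Γ R with
  | some A, some T => I.rel A T
  | _, _ => []

def conjL (Fs : List Formula) : Formula := Fs.foldr Formula.and .tru
def disjL (Fs : List Formula) : Formula := Fs.foldr Formula.or (.not .tru)

/-! # The symbolic result of a query -/

mutual
/-- `tuplesQ Γ p Q = some T` is the judgment `Γ ⊢ Q ↪ T` for the occurrence `p` of `Q`. -/
def tuplesQ (Γ : SymDB) (p : Label) : Query → Option (List SymTuple)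
  | .rel R => Γ R
  | .proj L Q => do
      let T ← tuplesQ Γ (0 :: p) Q
      some (if L.hasAgg then sigma p 0 1 else sigma p 0 T.length)
  | .filter _ Q | .rename _ Q | .distinct Q | .groupBy Q _ _ _ => do
      let T ← tuplesQ Γ (0 :: p) Q
      some (sigma p 0 T.length)
  | .coll op Q₁ Q₂ => do
      let T₁ ← tuplesQ Γ (0 :: p) Q₁
      let T₂ ← tuplesQ Γ (1 :: p) Q₂
      match op with
      | .union | .unionAll => some (sigma p 0 (T₁.length + T₂.length))
      | .inter | .diff | .interAll | .diffAll => some (sigma p 0 T₁.length)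
  | .prod Q₁ Q₂ | .innerJoin _ Q₁ Q₂ => do
      let T₁ ← tuplesQ Γ (0 :: p) Q₁
      let T₂ ← tuplesQ Γ (1 :: p) Q₂
      some (sigma p 0 (T₁.length * T₂.length))
  | .leftJoin _ Q₁ Q₂ => do
      let T₁ ← tuplesQ Γ (0 :: p) Q₁
      let T₂ ← tuplesQ Γ (1 :: p) Q₂
      some (sigma p 0 (T₁.length * T₂.length) ++ sigma p 2 T₁.length)
  | .rightJoin _ Q₁ Q₂ => do
      let T₁ ← tuplesQ Γ (0 :: p) Q₁
      let T₂ ← tuplesQ Γ (1 :: p) Q₂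
      some (sigma p 0 (T₁.length * T₂.length) ++ sigma p 3 T₂.length)
  | .fullJoin _ Q₁ Q₂ => do
      let T₁ ← tuplesQ Γ (0 :: p) Q₁
      let T₂ ← tuplesQ Γ (1 :: p) Q₂
      some (sigma p 0 (T₁.length * T₂.length) ++ sigma p 3 T₂.length ++ sigma p 2 T₁.length)
  | .withQ bs Q => do
      let Γ' ← tuplesB Γ (0 :: p) bs Γ
      tuplesQ Γ' (1 :: p) Q
/-- The symbolic database `Γ'[Rᵢ ↦ Tᵢ]` where `Γ ⊢ Qᵢ ↪ Tᵢ`. -/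
def tuplesB (Γ : SymDB) (p : Label) : Bindings → SymDB → Option SymDB
  | .nil, Γ' => some Γ'
  | .cons R Q bs, Γ' => do
      let T ← tuplesQ Γ (0 :: p) Q
      tuplesB Γ (1 :: p) bs (Function.update Γ' R (some T))
end

/-- `Γ ⊢ Q ↪ T` for top-level queries. -/
def TopQuery.tuples (Γ : SymDB) : TopQuery → Option (List SymTuple)
  | .plain Q => tuplesQ Γ [] Q
  | .orderBy Q _ _ => do
      let T ← tuplesQ Γ [0] Q
      some (sigma [] 0 T.length)

/-! # Encoding of expressions and predicates -/

def nullT : Term := .const .null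
def topT : Term := .const (.bool true)
def botT : Term := .const (.bool false)
def isNullF (s : Term) : Formula := .eq s nullT
def isTrueF (s : Term) : Formula := .eq s topT

/-- A formula as a truth value. -/
def boolT (F : Formula) : Term := .ite F topT botT

def cmp3T (op : CmpOp) (v w : Term) : Term :=
  .ite (.or (isNullF v) (isNullF w)) nullT (boolT (.cmp op v w))

def and3T (v w : Term) : Term :=
  .ite (.or (.and (isNullF v) (isNullF w))
      (.or (.and (isNullF v) (isTrueF w)) (.and (isTrueF v) (isNullF w))))
    nullT (boolT (.and (isTrueF v) (isTrueF w)))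

def or3T (v w : Term) : Term :=
  .ite (.or (.and (isNullF v) (isNullF w))
      (.or (.and (isNullF v) (.eq w botT)) (.and (.eq v botT) (isNullF w))))
    nullT (boolT (.or (isTrueF v) (isTrueF w)))

def not3T (v : Term) : Term := .ite (isNullF v) nullT (boolT (.not (isTrueF v)))

def rowEq3T (vs ws : List Term) : Term := (List.zipWith (cmp3T .eq) vs ws).foldr and3T topT

/-- A symbolic tuple together with the condition under which it is present in a list; expressions
are evaluated on lists of such tuples, since membership in a group is itself symbolic. -/
abbrev CondTuple := Formula × SymTuple

def notDel (t : SymTuple) : Formula := .not (.del t)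

/-- A list of symbolic tuples, each of which is present unless it is deleted. -/
def present (T : List SymTuple) : List CondTuple := T.map (fun t => (notDel t, t))

/-- `t.a`, where `t` is the first present tuple of the list. -/
def first (a : AttrName) : List CondTuple → Term
  | [] => nullT
  | [c] => .attr a c.2
  | c :: cs => .ite c.1 (.attr a c.2) (first a cs)

/-- Aggregates; the list contains the argument's value on every tuple, with the condition under
which the tuple is present. -/
def Agg.enc (G : Agg) (vs : List (Formula × Term)) : Term :=
  let absent (v : Formula × Term) : Formula := .or (.not v.1) (isNullF v.2)
  let allNull := conjL (vs.map (fun v => .imp v.1 (isNullF v.2)))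
  let total (f : Formula × Term → Term) : Term :=
    .ite allNull nullT ((vs.map f).foldl (Term.arith .add) (.const (.int 0)))
  let count := total (fun v => .ite (absent v) (.const (.int 0)) (.const (.int 1)))
  let sum := total (fun v => .ite (absent v) (.const (.int 0)) v.2)
  let vals := vs.map (fun v => Term.ite (absent v) nullT v.2)
  match G with
  | .count => count
  | .sum => sum
  | .avg => .arith .div sum count
  | .min => .ite allNull nullT (vals.foldl Term.min nullT)
  | .max => .ite allNull nullT (vals.foldl Term.max nullT)

mutual
/-- `⟦E⟧_{S,Γ,T}` for the expression `E` at the occurrence `p`. -/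
def encE (N : Naming) (S : Schema) (Γ : SymDB) (p : Label) (T : List CondTuple) : Expr → Term
  | .attr a => first a T
  | .val v => .const v
  | .arith op E₁ E₂ => .arith op (encE N S Γ (0 :: p) T E₁) (encE N S Γ (1 :: p) T E₂)
  | .ite φ E₁ E₂ => .ite (isTrueF (encP N S Γ (0 :: p) T φ))
      (encE N S Γ (1 :: p) T E₁) (encE N S Γ (2 :: p) T E₂)
  | .case bs E => encBr N S Γ (0 :: p) T bs (encE N S Γ (1 :: p) T E)
def encBr (N : Naming) (S : Schema) (Γ : SymDB) (p : Label) (T : List CondTuple) :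
    Branches → Term → Term
  | .nil, d => d
  | .cons φ E bs, d => .ite (isTrueF (encP N S Γ (0 :: p) T φ))
      (encE N S Γ (1 :: p) T E) (encBr N S Γ (2 :: p) T bs d)
def encEs (N : Naming) (S : Schema) (Γ : SymDB) (p : Label) (T : List CondTuple) :
    ExprList → List Term
  | .nil => []
  | .cons E Es => encE N S Γ (0 :: p) T E :: encEs N S Γ (1 :: p) T Es
def encA (N : Naming) (S : Schema) (Γ : SymDB) (p : Label) (T : List CondTuple) : Attr → Term
  | .cast φ =>
      let v := encP N S Γ (0 :: p) T φ
      .ite (isNullF v) nullT (.ite (isTrueF v) (.const (.int 1)) (.const (.int 0)))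
  | .expr E => encE N S Γ (0 :: p) T E
  | .agg G E => G.enc (T.map (fun c => (c.1, encE N S Γ (0 :: p) [c] E)))
  | .arith op A₁ A₂ => .arith op (encA N S Γ (0 :: p) T A₁) (encA N S Γ (1 :: p) T A₂)
def encL (N : Naming) (S : Schema) (Γ : SymDB) (p : Label) (T : List CondTuple) :
    AttrList → List Term
  | .id A => [encA N S Γ (0 :: p) T A]
  | .rename _ A => [encA N S Γ (0 :: p) T A]
  | .append L₁ L₂ => encL N S Γ (0 :: p) T L₁ ++ encL N S Γ (1 :: p) T L₂
def encP (N : Naming) (S : Schema) (Γ : SymDB) (p : Label) (T : List CondTuple) : Pred → Term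
  | .const b => .const (.bool b)
  | .null => nullT
  | .cmp op A₁ A₂ => cmp3T op (encA N S Γ (0 :: p) T A₁) (encA N S Γ (1 :: p) T A₂)
  | .isNull E => .ite (isNullF (encE N S Γ (0 :: p) T E)) topT botT
  | .inVals Es vs =>
      (vs.map (fun v => rowEq3T (encEs N S Γ (0 :: p) T Es) (v.map Term.const))).foldr or3T botT
  | .inQuery Es Q =>
      let es := encEs N S Γ (0 :: p) T Es
      let A := (attrsQ N S Q).getD []
      (((tuplesQ Γ (1 :: p) Q).getD []).map (fun t =>
        .ite (.del t) botT (rowEq3T es (A.map (fun a => .attr a t))))).foldr or3T botT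
  | .and φ₁ φ₂ => and3T (encP N S Γ (0 :: p) T φ₁) (encP N S Γ (1 :: p) T φ₂)
  | .or φ₁ φ₂ => or3T (encP N S Γ (0 :: p) T φ₁) (encP N S Γ (1 :: p) T φ₂)
  | .not φ => not3T (encP N S Γ (0 :: p) T φ)
end

/-! # Encoding of queries -/

/-- The attributes `A` of `t` have the values `vs`. -/
def attrsAre (A : List AttrName) (t : SymTuple) (vs : List Term) : Formula :=
  conjL (List.zipWith (fun a v => .eq (.attr a t) v) A vs)

def attrsOf (A : List AttrName) (t : SymTuple) : List Term := A.map (fun a => .attr a t)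

/-- `t = t'` for symbolic tuples with attributes `A` and `B`: the same values, position by
position, and the same deletion status. -/
def tupEq (A B : List AttrName) (t t' : SymTuple) : Formula :=
  .and (attrsAre A t (attrsOf B t')) (.iff (.del t) (.del t'))

/-- `t ∈ T`. -/
def memF (A : List AttrName) (t : SymTuple) (T : List SymTuple) : Formula :=
  disjL (T.map (fun t' => tupEq A A t t'))

/-- Conjunction of `f i tᵢ tᵢ'` over two lists of tuples. -/
def conjZip (f : ℕ → SymTuple → SymTuple → Formula) (T T' : List SymTuple) : Formula :=
  conjL ((List.zip T T').zipIdx.map (fun c => f c.2 c.1.1 c.1.2))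

/-- `t'` equals `t` where `keep` holds, and is deleted elsewhere. -/
def keepIf (A : List AttrName) (keep : ℕ → SymTuple → Formula) (T T' : List SymTuple) : Formula :=
  conjZip (fun i t t' =>
    .and (.imp (keep i t) (tupEq A A t' t)) (.imp (.not (keep i t)) (.del t'))) T T'

/-- Filter: the condition of a tuple is `φ`, a truth value. -/
def filterF (A : List AttrName) (φ : SymTuple → Term) (T T' : List SymTuple) : Formula :=
  conjZip (fun _ t t' => .and
    (.imp (.and (notDel t) (isTrueF (φ t))) (tupEq A A t' t))
    (.imp (.or (.del t) (.not (isTrueF (φ t)))) (.del t'))) T T'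

/-- Cartesian product; `T''` lists the tuples `t''ᵢⱼ` row by row. -/
def prodF (A₁ A₂ : List AttrName) (T₁ T₂ T'' : List SymTuple) : Formula :=
  conjL (List.zipWith (fun c t'' => .and
    (.imp (.and (notDel c.1) (notDel c.2)) (.and (notDel t'')
      (.and (attrsAre A₁ t'' (attrsOf A₁ c.1)) (attrsAre A₂ t'' (attrsOf A₂ c.2)))))
    (.imp (.or (.del c.1) (.del c.2)) (.del t''))) (List.product T₁ T₂) T'')

/-- Inner join, as a filtered Cartesian product. -/
def joinF (p : Label) (A₁ A₂ : List AttrName) (φ : SymTuple → Term) (T₁ T₂ : List SymTuple) :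
    Formula :=
  .and (prodF A₁ A₂ T₁ T₂ (sigma p 1 (T₁.length * T₂.length)))
    (filterF (A₁ ++ A₂) φ (sigma p 1 (T₁.length * T₂.length))
      (sigma p 0 (T₁.length * T₂.length)))

/-- The tuples of `Q₁` padded with `Null`s; `t''ᵢⱼ` is `fresh p 0 (i * m + j)`. -/
def leftPadF (p : Label) (A₁ A₂ : List AttrName) (m : ℕ) (T₁ U : List SymTuple) : Formula :=
  conjZip (fun i t u => .and
    (.and (attrsAre A₁ u (attrsOf A₁ t)) (attrsAre A₂ u (A₂.map (fun _ => nullT))))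
    (.iff (.and (notDel t)
      (conjL ((List.range m).map (fun j => .del (.fresh p 0 (i * m + j)))))) (notDel u))) T₁ U

/-- The tuples of `Q₂` padded with `Null`s. -/
def rightPadF (p : Label) (A₁ A₂ : List AttrName) (n m : ℕ) (T₂ U : List SymTuple) : Formula :=
  conjZip (fun j t u => .and
    (.and (attrsAre A₁ u (A₁.map (fun _ => nullT))) (attrsAre A₂ u (attrsOf A₂ t)))
    (.iff (.and (notDel t)
      (conjL ((List.range n).map (fun i => .del (.fresh p 0 (i * m + j)))))) (notDel u))) T₂ U

/-- `Dedup`. -/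
def dedupF (A : List AttrName) (T T' : List SymTuple) : Formula :=
  conjZip (fun i t t' => .and
    (.imp (memF A t (T.take i)) (.del t'))
    (.imp (.not (memF A t (T.take i))) (tupEq A A t' t))) T T'

/-- Bag union. -/
def unionAllF (A : List AttrName) (T₁ T₂ T' : List SymTuple) : Formula :=
  conjZip (fun _ t t' => tupEq A A t' t) (T₁ ++ T₂) T'

/-- Bag difference: `Paired(i, j)` says that the `j`-th tuple of `T₂` cancels the `i`-th tuple
of `T₁`. -/
def diffAllF (p : Label) (tag : ℕ) (A : List AttrName) (T₁ T₂ T' : List SymTuple) : Formula :=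
  let before (n : ℕ) (f : ℕ → Formula) := conjL ((List.range n).map (fun k => .not (f k)))
  .and
    (conjL (T₁.zipIdx.map (fun c => conjL (T₂.zipIdx.map (fun d =>
      .iff (.paired p tag c.2 d.2)
        (.and (tupEq A A c.1 d.1)
          (.and (before c.2 (fun k => .paired p tag k d.2))
            (before d.2 (fun k => .paired p tag c.2 k)))))))))
    (conjZip (fun i t t' => .and
      (.imp (.and (notDel t) (before T₂.length (fun j => .paired p tag i j))) (tupEq A A t' t))
      (.imp (.or (.del t) (disjL ((List.range T₂.length).map (fun j => .paired p tag i j))))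
        (.del t'))) T₁ T')

/-- The assignment of tuples to groups: `g(tᵢ, j)` for `j ≤ i` says that `tᵢ` belongs to the group
whose first tuple is `tⱼ`. -/
def groupF (p : Label) (key : SymTuple → List Term) (T : List SymTuple) : Formula :=
  conjL (T.zipIdx.map (fun c => .and
    (.eq (((List.range (c.2 + 1)).map (fun j =>
        Term.ite (.grp p c.1 j) (.const (.int 1)) (.const (.int 0)))).foldl (Term.arith .add)
          (.const (.int 0)))
      (.ite (.del c.1) (.const (.int 0)) (.const (.int 1))))
    (conjL ((T.take c.2).zipIdx.map (fun d =>
      .iff (.grp p c.1 d.2) (.and (notDel c.1) (.and (.grp p d.1 d.2)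
        (conjL (List.zipWith Formula.eq (key c.1) (key d.1))))))))))

/-- `g⁻¹(i)`. -/
def groupTuples (p : Label) (T : List SymTuple) (i : ℕ) : List CondTuple :=
  (T.drop i).map (fun t => (.grp p t i, t))

/-- One output tuple per group that satisfies the condition `φ`; the attributes `B` of that tuple
have the values `vals`. -/
def reduceF (p : Label) (B : List AttrName) (φ : List CondTuple → Term)
    (vals : List CondTuple → List Term) (T T' : List SymTuple) : Formula :=
  conjZip (fun i t t' =>
    let g := groupTuples p T i
    .and
      (.imp (.and (.grp p t i) (isTrueF (φ g))) (.and (notDel t') (attrsAre B t' (vals g))))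
      (.imp (.or (.not (.grp p t i)) (.not (isTrueF (φ g)))) (.del t'))) T T'

mutual
/-- The encodings of the membership subqueries that occur in an expression, attribute term or
predicate at the occurrence `p`. -/
def sideE (N : Naming) (S : Schema) (Γ : SymDB) (p : Label) : Expr → Option Formula
  | .attr _ => some .tru
  | .val _ => some .tru
  | .arith _ E₁ E₂ => do
      let F₁ ← sideE N S Γ (0 :: p) E₁
      let F₂ ← sideE N S Γ (1 :: p) E₂
      some (.and F₁ F₂)
  | .ite φ E₁ E₂ => do
      let F₁ ← sideP N S Γ (0 :: p) φ
      let F₂ ← sideE N S Γ (1 :: p) E₁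
      let F₃ ← sideE N S Γ (2 :: p) E₂
      some (.and F₁ (.and F₂ F₃))
  | .case bs E => do
      let F₁ ← sideBr N S Γ (0 :: p) bs
      let F₂ ← sideE N S Γ (1 :: p) E
      some (.and F₁ F₂)
def sideBr (N : Naming) (S : Schema) (Γ : SymDB) (p : Label) : Branches → Option Formula
  | .nil => some .tru
  | .cons φ E bs => do
      let F₁ ← sideP N S Γ (0 :: p) φ
      let F₂ ← sideE N S Γ (1 :: p) E
      let F₃ ← sideBr N S Γ (2 :: p) bs
      some (.and F₁ (.and F₂ F₃))
def sideEs (N : Naming) (S : Schema) (Γ : SymDB) (p : Label) : ExprList → Option Formula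
  | .nil => some .tru
  | .cons E Es => do
      let F₁ ← sideE N S Γ (0 :: p) E
      let F₂ ← sideEs N S Γ (1 :: p) Es
      some (.and F₁ F₂)
def sideA (N : Naming) (S : Schema) (Γ : SymDB) (p : Label) : Attr → Option Formula
  | .cast φ => sideP N S Γ (0 :: p) φ
  | .expr E => sideE N S Γ (0 :: p) E
  | .agg _ E => sideE N S Γ (0 :: p) E
  | .arith _ A₁ A₂ => do
      let F₁ ← sideA N S Γ (0 :: p) A₁
      let F₂ ← sideA N S Γ (1 :: p) A₂
      some (.and F₁ F₂)
def sideL (N : Naming) (S : Schema) (Γ : SymDB) (p : Label) : AttrList → Option Formula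
  | .id A => sideA N S Γ (0 :: p) A
  | .rename _ A => sideA N S Γ (0 :: p) A
  | .append L₁ L₂ => do
      let F₁ ← sideL N S Γ (0 :: p) L₁
      let F₂ ← sideL N S Γ (1 :: p) L₂
      some (.and F₁ F₂)
def sideP (N : Naming) (S : Schema) (Γ : SymDB) (p : Label) : Pred → Option Formula
  | .const _ => some .tru
  | .null => some .tru
  | .cmp _ A₁ A₂ => do
      let F₁ ← sideA N S Γ (0 :: p) A₁
      let F₂ ← sideA N S Γ (1 :: p) A₂
      some (.and F₁ F₂)
  | .isNull E => sideE N S Γ (0 :: p) E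
  | .inVals Es _ => sideEs N S Γ (0 :: p) Es
  | .inQuery Es Q => do
      let F₁ ← sideEs N S Γ (0 :: p) Es
      let F₂ ← encQ N S Γ (1 :: p) Q
      some (.and F₁ F₂)
  | .and φ₁ φ₂ | .or φ₁ φ₂ => do
      let F₁ ← sideP N S Γ (0 :: p) φ₁
      let F₂ ← sideP N S Γ (1 :: p) φ₂
      some (.and F₁ F₂)
  | .not φ => sideP N S Γ (0 :: p) φ
/-- `encQ N S Γ p Q = some Φ` is the judgment `S, Γ ⊢ Q ⇝ Φ` for the occurrence `p` of `Q`. -/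
def encQ (N : Naming) (S : Schema) (Γ : SymDB) (p : Label) : Query → Option Formula
  | .rel R => do
      let _ ← Γ R
      some .tru
  | .proj L Q => do
      let F₁ ← encQ N S Γ (0 :: p) Q
      let T ← tuplesQ Γ (0 :: p) Q
      let F₂ ← sideL N S Γ (1 :: p) L
      let B := L.names N
      let t₁ := SymTuple.fresh p 0 0
      let F₃ := if L.hasAgg
        then .and (attrsAre B t₁ (encL N S Γ (1 :: p) (present T) L)) (notDel t₁)
        else conjZip (fun _ t t' => .and
          (attrsAre B t' (encL N S Γ (1 :: p) (present [t]) L))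
          (.iff (.del t') (.del t))) T (sigma p 0 T.length)
      some (.and F₁ (.and F₂ F₃))
  | .filter φ Q => do
      let A ← attrsQ N S Q
      let F₁ ← encQ N S Γ (0 :: p) Q
      let T ← tuplesQ Γ (0 :: p) Q
      let F₂ ← sideP N S Γ (1 :: p) φ
      let F₃ := filterF A (fun t => encP N S Γ (1 :: p) (present [t]) φ) T (sigma p 0 T.length)
      some (.and F₁ (.and F₂ F₃))
  | .rename R Q => do
      let A ← attrsQ N S Q
      let F₁ ← encQ N S Γ (0 :: p) Q
      let T ← tuplesQ Γ (0 :: p) Q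
      let F₂ := conjZip (fun _ t t' => tupEq (A.map (N.rename R)) A t' t) T (sigma p 0 T.length)
      some (.and F₁ F₂)
  | .coll op Q₁ Q₂ => do
      let A ← attrsQ N S Q₁
      let F₁ ← encQ N S Γ (0 :: p) Q₁
      let T₁ ← tuplesQ Γ (0 :: p) Q₁
      let F₂ ← encQ N S Γ (1 :: p) Q₂
      let T₂ ← tuplesQ Γ (1 :: p) Q₂
      let n := T₁.length
      let m := T₂.length
      let F₃ := match op with
        | .unionAll => unionAllF A T₁ T₂ (sigma p 0 (n + m))
        | .union => .and (unionAllF A T₁ T₂ (sigma p 1 (n + m)))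
            (dedupF A (sigma p 1 (n + m)) (sigma p 0 (n + m)))
        | .inter => .and (dedupF A T₁ (sigma p 1 n))
            (keepIf A (fun _ t => memF A t T₂) (sigma p 1 n) (sigma p 0 n))
        | .diff => .and (dedupF A T₁ (sigma p 1 n))
            (keepIf A (fun _ t => .not (memF A t T₂)) (sigma p 1 n) (sigma p 0 n))
        | .diffAll => diffAllF p 0 A T₁ T₂ (sigma p 0 n)
        | .interAll => .and (diffAllF p 1 A T₁ T₂ (sigma p 1 n))
            (diffAllF p 0 A T₁ (sigma p 1 n) (sigma p 0 n))
      some (.and F₁ (.and F₂ F₃))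
  | .distinct Q => do
      let A ← attrsQ N S Q
      let F₁ ← encQ N S Γ (0 :: p) Q
      let T ← tuplesQ Γ (0 :: p) Q
      some (.and F₁ (dedupF A T (sigma p 0 T.length)))
  | .prod Q₁ Q₂ => do
      let A₁ ← attrsQ N S Q₁
      let A₂ ← attrsQ N S Q₂
      let F₁ ← encQ N S Γ (0 :: p) Q₁
      let T₁ ← tuplesQ Γ (0 :: p) Q₁
      let F₂ ← encQ N S Γ (1 :: p) Q₂
      let T₂ ← tuplesQ Γ (1 :: p) Q₂
      some (.and F₁ (.and F₂ (prodF A₁ A₂ T₁ T₂ (sigma p 0 (T₁.length * T₂.length)))))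
  | .innerJoin φ Q₁ Q₂ => do
      let A₁ ← attrsQ N S Q₁
      let A₂ ← attrsQ N S Q₂
      let F₁ ← encQ N S Γ (0 :: p) Q₁
      let T₁ ← tuplesQ Γ (0 :: p) Q₁
      let F₂ ← encQ N S Γ (1 :: p) Q₂
      let T₂ ← tuplesQ Γ (1 :: p) Q₂
      let F₃ ← sideP N S Γ (2 :: p) φ
      let F₄ := joinF p A₁ A₂ (fun t => encP N S Γ (2 :: p) (present [t]) φ) T₁ T₂
      some (.and F₁ (.and F₂ (.and F₃ F₄)))
  | .leftJoin φ Q₁ Q₂ => do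
      let A₁ ← attrsQ N S Q₁
      let A₂ ← attrsQ N S Q₂
      let F₁ ← encQ N S Γ (0 :: p) Q₁
      let T₁ ← tuplesQ Γ (0 :: p) Q₁
      let F₂ ← encQ N S Γ (1 :: p) Q₂
      let T₂ ← tuplesQ Γ (1 :: p) Q₂
      let F₃ ← sideP N S Γ (2 :: p) φ
      let F₄ := joinF p A₁ A₂ (fun t => encP N S Γ (2 :: p) (present [t]) φ) T₁ T₂
      let F₅ := leftPadF p A₁ A₂ T₂.length T₁ (sigma p 2 T₁.length)
      some (.and F₁ (.and F₂ (.and F₃ (.and F₄ F₅))))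
  | .rightJoin φ Q₁ Q₂ => do
      let A₁ ← attrsQ N S Q₁
      let A₂ ← attrsQ N S Q₂
      let F₁ ← encQ N S Γ (0 :: p) Q₁
      let T₁ ← tuplesQ Γ (0 :: p) Q₁
      let F₂ ← encQ N S Γ (1 :: p) Q₂
      let T₂ ← tuplesQ Γ (1 :: p) Q₂
      let F₃ ← sideP N S Γ (2 :: p) φ
      let F₄ := joinF p A₁ A₂ (fun t => encP N S Γ (2 :: p) (present [t]) φ) T₁ T₂
      let F₅ := rightPadF p A₁ A₂ T₁.length T₂.length T₂ (sigma p 3 T₂.length)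
      some (.and F₁ (.and F₂ (.and F₃ (.and F₄ F₅))))
  | .fullJoin φ Q₁ Q₂ => do
      let A₁ ← attrsQ N S Q₁
      let A₂ ← attrsQ N S Q₂
      let F₁ ← encQ N S Γ (0 :: p) Q₁
      let T₁ ← tuplesQ Γ (0 :: p) Q₁
      let F₂ ← encQ N S Γ (1 :: p) Q₂
      let T₂ ← tuplesQ Γ (1 :: p) Q₂
      let F₃ ← sideP N S Γ (2 :: p) φ
      let F₄ := joinF p A₁ A₂ (fun t => encP N S Γ (2 :: p) (present [t]) φ) T₁ T₂
      let F₅ := leftPadF p A₁ A₂ T₂.length T₁ (sigma p 2 T₁.length)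
      let F₆ := rightPadF p A₁ A₂ T₁.length T₂.length T₂ (sigma p 3 T₂.length)
      some (.and F₁ (.and F₂ (.and F₃ (.and F₄ (.and F₅ F₆)))))
  | .groupBy Q Es L φ => do
      let F₁ ← encQ N S Γ (0 :: p) Q
      let T ← tuplesQ Γ (0 :: p) Q
      let F₂ ← sideEs N S Γ (1 :: p) Es
      let F₃ ← sideL N S Γ (2 :: p) L
      let F₄ ← sideP N S Γ (3 :: p) φ
      let F₅ := groupF p (fun t => encEs N S Γ (1 :: p) (present [t]) Es) T
      let F₆ := reduceF p (L.names N) (fun g => encP N S Γ (3 :: p) g φ)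
        (fun g => encL N S Γ (2 :: p) g L) T (sigma p 0 T.length)
      some (.and F₁ (.and F₂ (.and F₃ (.and F₄ (.and F₅ F₆)))))
  | .withQ bs Q => do
      let F₁ ← encB N S Γ (0 :: p) bs
      let S' ← attrsB N S bs S
      let Γ' ← tuplesB Γ (0 :: p) bs Γ
      let F₂ ← encQ N S' Γ' (1 :: p) Q
      some (.and F₁ F₂)
def encB (N : Naming) (S : Schema) (Γ : SymDB) (p : Label) : Bindings → Option Formula
  | .nil => some .tru
  | .cons _ Q bs => do
      let F₁ ← encQ N S Γ (0 :: p) Q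
      let F₂ ← encB N S Γ (1 :: p) bs
      some (.and F₁ F₂)
end

/-! ## Sorting -/

/-- The number of tuples that are not deleted. -/
def countT (T : List SymTuple) : Term :=
  (T.map (fun t => Term.ite (.del t) (.const (.int 0)) (.const (.int 1)))).foldl (Term.arith .add)
    (.const (.int 0))

/-- `moveDelToEnd`: `T''` lists the tuples of `T` that are not deleted, then deleted tuples. -/
def moveDelF (A : List AttrName) (T T'' : List SymTuple) : Formula :=
  conjL (T''.zipIdx.map (fun c => .and
    (conjL (T.zipIdx.map (fun d =>
      .imp (.and (notDel d.1) (.eq (countT (T.take d.2)) (.const (.int c.2))))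
        (tupEq A A c.1 d.1))))
    (.imp (.cmp .le (countT T) (.const (.int c.2))) (.del c.1))))

def keyLeF (ks₁ ks₂ : List Term) : Formula :=
  (List.zip ks₁ ks₂).foldr
    (fun k F => .or (.lt k.1 k.2) (.and (.not (.lt k.2 k.1)) F)) .tru

def sortCmpF (asc : Bool) (ks₁ ks₂ : List Term) : Formula :=
  if asc then .not (keyLeF ks₁ ks₂) else keyLeF ks₁ ks₂

/-- Among the tuples of `T` (with their positions) that satisfy `g`, the tuple `k` is the one that
selection sort takes next. -/
def selF (asc : Bool) (key : SymTuple → List Term) (T : List SymTuple)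
    (g : SymTuple × ℕ → Formula) (k : SymTuple × ℕ) : Formula :=
  .and (g k) (conjL (T.zipIdx.map (fun k' =>
    if k'.2 < k.2 then .imp (g k') (sortCmpF asc (key k'.1) (key k.1))
    else if k.2 < k'.2 then .imp (g k') (.not (sortCmpF asc (key k.1) (key k'.1)))
    else .tru)))

/-- The tuple `k` satisfies `g` and has the same values as the tuple that is taken next. -/
def matchF (A : List AttrName) (asc : Bool) (key : SymTuple → List Term) (T : List SymTuple)
    (g : SymTuple × ℕ → Formula) (k : SymTuple × ℕ) : Formula :=
  .and (g k) (disjL (T.zipIdx.map (fun s =>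
    .and (selF asc key T g s) (attrsAre A k.1 (attrsOf A s.1)))))

/-- The tuples that are left after `i` steps; every step removes the first tuple that has the
values of the tuple taken. -/
def leftF (A : List AttrName) (asc : Bool) (key : SymTuple → List Term) (T : List SymTuple) :
    ℕ → SymTuple × ℕ → Formula
  | 0, k => notDel k.1
  | i + 1, k =>
      let g := leftF A asc key T i
      .and (g k) (.not (.and (matchF A asc key T g k)
        (conjL ((T.take k.2).zipIdx.map (fun k' => .not (matchF A asc key T g k'))))))

/-- `t'ᵢ = t''_{find(i)}`, for all `i`. -/
def sortF (A : List AttrName) (asc : Bool) (key : SymTuple → List Term) (T'' T' : List SymTuple) :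
    Formula :=
  conjL (T'.zipIdx.map (fun c =>
    let g := leftF A asc key T'' c.2
    .and
      (conjL (T''.zipIdx.map (fun k => .imp (selF asc key T'' g k) (tupEq A A c.1 k.1))))
      (.imp (conjL (T''.zipIdx.map (fun k => .not (g k)))) (.del c.1))))

/-- `S, Γ ⊢ Q ⇝ Φ` for top-level queries. -/
def TopQuery.encode (N : Naming) (S : Schema) (Γ : SymDB) : TopQuery → Option Formula
  | .plain Q => encQ N S Γ [] Q
  | .orderBy Q Es asc => do
      let A ← attrsQ N S Q
      let F₁ ← encQ N S Γ [0] Q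
      let T ← tuplesQ Γ [0] Q
      let F₂ ← sideEs N S Γ [1] Es
      let T'' := sigma [] 1 T.length
      let T' := sigma [] 0 T.length
      let F₃ := moveDelF A T T''
      let F₄ := sortF A asc (fun t => encEs N S Γ [1] (present [t]) Es) T'' T'
      some (.and F₁ (.and F₂ (.and F₃ F₄)))

/-! # The three judgments -/

/-- `S ⊢ Q : A`. -/
def TopQuery.HasAttrs (N : Naming) (S : Schema) (Q : TopQuery) (A : List AttrName) : Prop :=
  Q.attrs N S = some A

/-- `Γ ⊢ Q ↪ R`. -/
def TopQuery.YieldsTuples (Γ : SymDB) (Q : TopQuery) (R : List SymTuple) : Prop :=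
  Q.tuples Γ = some R

/-- `S, Γ ⊢ Q ⇝ Φ`. -/
def TopQuery.EncodesTo (N : Naming) (S : Schema) (Γ : SymDB) (Q : TopQuery) (Φ : Formula) : Prop :=
  Q.encode N S Γ = some Φ

/-- The list of sort keys of a relation. -/
def sortKeys (N : Naming) (S : Schema) (D : Database) (Es : ExprList) (r : Relation) :
    List (List Value) :=
  r.map (fun x => evalEs N S D [x] Es)

end Sql

-- Under an interpretation, a list of symbolic tuples is a partial list: each position carries a row
-- or, if its tuple is deleted, nothing (`Interp.slots`). The relation `I.rel A T` collects the
-- defined positions (`Interp.rel_eq_collect`). The encoding of an operator prescribes what stands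
-- at every position of the result, and the concrete operator can be computed on partial lists by a
-- prescription of the same shape. Correctness of an operator is thus a comparison position by
-- position (`Interp.rel_eq_of_slots`). Real combinatorics is needed in three places. Greedy pairing
-- computes bag difference (`bagDiff_collect`). The constraints on the group assignment have a
-- single solution for `j ≤ i`, in which a group is opened by the first tuple with its key
-- (`grp_iff`, `rel_groupBy`). The symbolic sort simulates each step of the concrete selection sort
-- (`exists_lists_leftF`, `rel_sortF`).
--
-- Terms mirror the clauses of the semantics, with neutral elements standing for absent tuples in
-- aggregates (`Agg.eval_enc`) and `⊥` standing for them in membership tests (`eval_memQuery`).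
-- Reading an attribute off the first present tuple is faithful only if some tuple is present
-- (`eval_first`). Filters, joins and groups guarantee this. An aggregating projection does not, but
-- there well-formedness leaves no attribute outside of aggregates. Hence the alternative "nonempty,
-- or grouped by the empty list" in the statements about expressions.
--
-- The outer joins are the operators at which the order of rows may be lost: concretely the padded
-- rows stand among the matching ones, symbolically they follow them. The induction therefore proves
-- `Agree`: always a permutation, and equality of lists under a condition that excludes outer joins.
-- Once subqueries are known only up to permutation, every operator has to respect permutations. For
-- `GroupBy` and aggregating projections this rests on well-formedness: aggregates are folds by
-- commuting operations (`Agg.eval_perm`), and all other attributes occur within grouping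
-- expressions, which are constant on a group (`evalE_group_eq`).
--
-- Since predicates contain subqueries, expressions, queries and bindings are treated in one mutual
-- induction (`eval_encE`, `agree_encQ`, `models_encB`). It concerns any concrete database that
-- agrees with the symbolic one (`Interp.Models`), not only `I.db S Γ`, because `With` adds
-- relations whose contents may agree merely as bags.
--
-- For `OrderBy`, the symbolic output is literally the concrete sort of the symbolic input. The
-- concrete result sorts a permutation of that input, and the two sorted lists of keys coincide
-- because the order on keys of a fixed length is antisymmetric (`map_key_orderRel`).

namespace Sql

/-! # Truth of formulas -/

section Formulas
variable {I : Interp} {F G : Formula}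

theorem eval_not : (Formula.not F).eval I = true ↔ ¬ F.eval I = true := by simp [Formula.eval]

theorem eval_and : (Formula.and F G).eval I = true ↔ F.eval I = true ∧ G.eval I = true := by
  simp [Formula.eval]

theorem eval_or : (Formula.or F G).eval I = true ↔ F.eval I = true ∨ G.eval I = true := by
  simp [Formula.eval]

theorem eval_imp : (Formula.imp F G).eval I = true ↔ (F.eval I = true → G.eval I = true) := by
  cases h : F.eval I <;> simp [Formula.eval, h]

theorem eval_iff : (Formula.iff F G).eval I = true ↔ (F.eval I = true ↔ G.eval I = true) := by
  cases h : F.eval I <;> cases h' : G.eval I <;> simp [Formula.eval, h, h']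

theorem eval_del {t : SymTuple} : (Formula.del t).eval I = true ↔ I.del t = true := by
  simp [Formula.eval]

theorem eval_eq {s t : Term} : (Formula.eq s t).eval I = true ↔ s.eval I = t.eval I := by
  simp [Formula.eval]

theorem eval_notDel {t : SymTuple} : (notDel t).eval I = true ↔ I.del t = false := by
  simp [Formula.eval, notDel]

theorem eval_isTrueF {s : Term} : (isTrueF s).eval I = true ↔ s.eval I = .bool true := by
  simp only [isTrueF, topT, Formula.eval, Term.eval]; exact decide_eq_true_iff

theorem eval_isNullF {s : Term} : (isNullF s).eval I = true ↔ s.eval I = .null := by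
  simp only [isNullF, nullT, Formula.eval, Term.eval]; exact decide_eq_true_iff

theorem eval_grp {p : Label} {t : SymTuple} {j : ℕ} :
    (Formula.grp p t j).eval I = true ↔ I.grp p t j = true := by
  simp [Formula.eval]

theorem eval_paired {p : Label} {tag i j : ℕ} :
    (Formula.paired p tag i j).eval I = true ↔ I.paired p tag i j = true := by
  simp [Formula.eval]

theorem eval_conjL {Fs : List Formula} :
    (conjL Fs).eval I = true ↔ ∀ F ∈ Fs, F.eval I = true := by
  induction Fs with
  | nil => simp [conjL, Formula.eval]
  | cons F Fs ih => simp only [conjL, List.foldr_cons] at ih ⊢; simp [eval_and, ih]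

theorem eval_disjL {Fs : List Formula} :
    (disjL Fs).eval I = true ↔ ∃ F ∈ Fs, F.eval I = true := by
  induction Fs with
  | nil => simp [disjL, Formula.eval]
  | cons F Fs ih => simp only [disjL, List.foldr_cons] at ih ⊢; simp [eval_or, ih]

theorem eval_conjL_zipIdx {α : Type*} {xs : List α} {f : α × ℕ → Formula} :
    (conjL (xs.zipIdx.map f)).eval I = true ↔
      ∀ i (h : i < xs.length), (f (xs[i], i)).eval I = true := by
  rw [eval_conjL]
  constructor
  · intro h i hi
    exact h _ (List.mem_map.2 ⟨(xs[i], i), by simp [List.mk_mem_zipIdx_iff_getElem?], rfl⟩)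
  · rintro h F hF
    obtain ⟨⟨x, i⟩, hx, rfl⟩ := List.mem_map.1 hF
    rw [List.mk_mem_zipIdx_iff_getElem?, List.getElem?_eq_some_iff] at hx
    obtain ⟨hi, rfl⟩ := hx
    exact h i hi

theorem eval_disjL_zipIdx {α : Type*} {xs : List α} {f : α × ℕ → Formula} :
    (disjL (xs.zipIdx.map f)).eval I = true ↔
      ∃ i, ∃ h : i < xs.length, (f (xs[i], i)).eval I = true := by
  rw [eval_disjL]
  constructor
  · rintro ⟨F, hF, hI⟩
    obtain ⟨⟨x, i⟩, hx, rfl⟩ := List.mem_map.1 hF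
    rw [List.mk_mem_zipIdx_iff_getElem?, List.getElem?_eq_some_iff] at hx
    obtain ⟨hi, rfl⟩ := hx
    exact ⟨i, hi, hI⟩
  · rintro ⟨i, hi, hI⟩
    exact ⟨_, List.mem_map.2 ⟨(xs[i], i), by simp [List.mk_mem_zipIdx_iff_getElem?], rfl⟩, hI⟩

theorem eval_conjL_range {n : ℕ} {f : ℕ → Formula} :
    (conjL ((List.range n).map f)).eval I = true ↔ ∀ i < n, (f i).eval I = true := by
  simp [eval_conjL]

theorem eval_disjL_range {n : ℕ} {f : ℕ → Formula} :
    (disjL ((List.range n).map f)).eval I = true ↔ ∃ i < n, (f i).eval I = true := by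
  simp [eval_disjL]

theorem eval_conjL_zipWith {α β : Type*} {f : α → β → Formula} {xs : List α} {ys : List β} :
    (conjL (List.zipWith f xs ys)).eval I = true ↔
      ∀ i (h : i < xs.length) (h' : i < ys.length), (f xs[i] ys[i]).eval I = true := by
  rw [eval_conjL]
  simp only [List.mem_iff_getElem, List.length_zipWith, List.getElem_zipWith]
  constructor
  · intro H i h h'
    exact H _ ⟨i, by omega, rfl⟩
  · rintro H F ⟨i, hi, rfl⟩
    exact H i (by omega) (by omega)

theorem eval_conjZip {f : ℕ → SymTuple → SymTuple → Formula} {T T' : List SymTuple} :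
    (conjZip f T T').eval I = true ↔
      ∀ i (h : i < T.length) (h' : i < T'.length), (f i T[i] T'[i]).eval I = true := by
  unfold conjZip
  rw [eval_conjL_zipIdx]
  simp only [List.length_zip, List.getElem_zip]
  exact ⟨fun H i h h' => H i (by omega), fun H i h => H i (by omega) (by omega)⟩

/-- The values of the attributes `A` of a symbolic tuple. -/
def Interp.vals (I : Interp) (A : List AttrName) (t : SymTuple) : List Value :=
  A.map (fun a => I.attr a t)

/-- `zipWith` stops at the shorter list, so the equations determine all the values only if the
lengths agree. -/
theorem eval_attrsAre {A : List AttrName} {t : SymTuple} {vs : List Term}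
    (h : vs.length = A.length) :
    (attrsAre A t vs).eval I = true ↔ I.vals A t = vs.map (Term.eval I) := by
  unfold attrsAre Interp.vals
  rw [eval_conjL_zipWith, List.ext_getElem_iff]
  simp [eval_eq, Term.eval, h]

theorem map_eval_attrsOf {A : List AttrName} {t : SymTuple} :
    (attrsOf A t).map (Term.eval I) = I.vals A t := by
  simp [attrsOf, Interp.vals, Term.eval]

theorem eval_tupEq {A B : List AttrName} {t t' : SymTuple} (h : A.length = B.length) :
    (tupEq A B t t').eval I = true ↔ I.vals A t = I.vals B t' ∧ I.del t = I.del t' := by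
  unfold tupEq
  rw [eval_and, eval_attrsAre (by simp [attrsOf, h]), map_eval_attrsOf, eval_iff, eval_del,
    eval_del, Bool.coe_iff_coe]

end Formulas

/-! # Symbolic relations as partial lists -/

/-- The row of a symbolic tuple. -/
def Interp.row (I : Interp) (A : List AttrName) (t : SymTuple) : Tuple :=
  A.map (fun a => (a, I.attr a t))

theorem Interp.row_eq_zip (I : Interp) (A : List AttrName) (t : SymTuple) :
    I.row A t = A.zip (I.vals A t) := by
  simp only [Interp.row, Interp.vals, List.zip_map_right]
  rw [List.zip_eq_zipWith, List.zipWith_self, List.map_map]; rfl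

theorem Interp.row_map_snd (I : Interp) (A : List AttrName) (t : SymTuple) :
    (I.row A t).map Prod.snd = I.vals A t := by
  simp [Interp.row, Interp.vals]

theorem Interp.row_eq_row_iff {I : Interp} {A : List AttrName} {t t' : SymTuple} :
    I.row A t = I.row A t' ↔ I.vals A t = I.vals A t' := by
  constructor
  · intro h
    rw [← row_map_snd, h, row_map_snd]
  · intro h
    rw [row_eq_zip, h, row_eq_zip]

theorem Interp.row_append (I : Interp) (A B : List AttrName) (t : SymTuple) :
    I.row (A ++ B) t = I.row A t ++ I.row B t := by
  simp [Interp.row]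

/-- The row of a symbolic tuple, unless it is deleted. -/
def Interp.slot (I : Interp) (A : List AttrName) (t : SymTuple) : Option Tuple :=
  if I.del t then none else some (I.row A t)

theorem Interp.slot_of_del {I : Interp} {A : List AttrName} {t : SymTuple} (h : I.del t = true) :
    I.slot A t = none := by simp [Interp.slot, h]

theorem Interp.slot_of_not_del {I : Interp} {A : List AttrName} {t : SymTuple}
    (h : I.del t = false) : I.slot A t = some (I.row A t) := by simp [Interp.slot, h]

theorem Interp.slot_eq_none_iff {I : Interp} {A : List AttrName} {t : SymTuple} :
    I.slot A t = none ↔ I.del t = true := by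
  cases h : I.del t <;> simp [Interp.slot, h]

theorem Interp.slot_eq_some_iff {I : Interp} {A : List AttrName} {t : SymTuple} {x : Tuple} :
    I.slot A t = some x ↔ I.del t = false ∧ I.row A t = x := by
  cases h : I.del t <;> simp [Interp.slot, h]

/-- A slot depends only on the values and the deletion status. There is no converse: two deleted
tuples have the same slot whatever their values. -/
theorem Interp.slot_congr {I : Interp} {A : List AttrName} {t t' : SymTuple}
    (h : (tupEq A A t t').eval I = true) : I.slot A t = I.slot A t' := by
  rw [eval_tupEq rfl] at h
  unfold Interp.slot
  rw [h.2, Interp.row_eq_row_iff.2 h.1]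

/-- The row at position `i` of a symbolic relation, if it is present. -/
def Interp.slots (I : Interp) (A : List AttrName) (T : List SymTuple) (i : ℕ) : Option Tuple :=
  T[i]?.bind (I.slot A)

theorem Interp.slots_eq {I : Interp} {A : List AttrName} {T : List SymTuple} {i : ℕ}
    (h : i < T.length) : I.slots A T i = I.slot A T[i] := by
  simp [Interp.slots, h]

/-- The list of the defined values among `s 0, …, s (n - 1)`. -/
def collect {α : Type*} (s : ℕ → Option α) (n : ℕ) : List α := (List.range n).filterMap s

-- Calculus of partial lists

section Collect
variable {α β : Type*}

theorem collect_congr {s s' : ℕ → Option α} {n : ℕ} (h : ∀ i < n, s i = s' i) :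
    collect s n = collect s' n :=
  List.filterMap_congr (fun i hi => h i (List.mem_range.1 hi))

theorem collect_succ (s : ℕ → Option α) (n : ℕ) :
    collect s (n + 1) = collect s n ++ (s n).toList := by
  unfold collect
  rw [List.range_succ, List.filterMap_append]
  cases h : s n <;> simp [h]

theorem collect_zero (s : ℕ → Option α) : collect s 0 = [] := rfl

theorem mem_collect {s : ℕ → Option α} {n : ℕ} {x : α} :
    x ∈ collect s n ↔ ∃ i < n, s i = some x := by
  simp [collect]

theorem map_collect (f : α → β) (s : ℕ → Option α) (n : ℕ) :
    (collect s n).map f = collect (fun i => (s i).map f) n := by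
  unfold collect; rw [List.map_filterMap]

theorem filter_collect (f : α → Bool) (s : ℕ → Option α) (n : ℕ) :
    (collect s n).filter f = collect (fun i => (s i).filter f) n := by
  unfold collect
  rw [List.filter_filterMap]

theorem collect_add (s : ℕ → Option α) (n m : ℕ) :
    collect s (n + m) = collect s n ++ collect (fun i => s (n + i)) m := by
  unfold collect
  rw [List.range_add, List.filterMap_append, List.filterMap_map]; rfl

/-- Position `i * m + j` stands for the pair `(i, j)`, which is how the tuples of a product are
numbered. -/
theorem collect_mul (s : ℕ → Option α) (n m : ℕ) :
    collect s (n * m) = (List.range n).flatMap (fun i => collect (fun j => s (i * m + j)) m) := by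
  induction n with
  | zero => simp [collect]
  | succ n ih =>
    rw [Nat.succ_mul, collect_add, ih, List.range_succ, List.flatMap_append]; simp

theorem flatMap_collect (f : α → List β) (s : ℕ → Option α) (n : ℕ) :
    (collect s n).flatMap f = (List.range n).flatMap (fun i => (s i).toList.flatMap f) := by
  induction n with
  | zero => rfl
  | succ n ih => rw [collect_succ, List.flatMap_append, ih, List.range_succ, List.flatMap_append]; simp

end Collect

/-- Passes from the list of present rows to positions. Deleted tuples keep their places there, so
the formulas can be read off index by index. -/
theorem Interp.rel_eq_collect (I : Interp) (A : List AttrName) (T : List SymTuple) :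
    I.rel A T = collect (I.slots A T) T.length := by
  induction T using List.reverseRecOn with
  | nil => rfl
  | append_singleton T t ih =>
    rw [List.length_append, List.length_singleton, collect_succ]
    have h : collect (I.slots A (T ++ [t])) T.length = collect (I.slots A T) T.length :=
      collect_congr (fun i hi => by simp [Interp.slots, List.getElem?_append_left hi])
    rw [h, ← ih]
    unfold Interp.rel
    rw [List.filter_append, List.map_append]
    cases hd : I.del t <;> simp [Interp.slots, Interp.slot, hd, Interp.row]

/-- The pattern of the operator proofs: the concrete operator is written as a `collect` and then
compared with the symbolic result slot by slot. -/
theorem Interp.rel_eq_of_slots {I : Interp} {A : List AttrName} {T : List SymTuple} {n : ℕ}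
    {s : ℕ → Option Tuple} (hn : T.length = n)
    (h : ∀ i (hi : i < T.length), I.slot A T[i] = s i) : I.rel A T = collect s n := by
  subst hn
  rw [Interp.rel_eq_collect]
  exact collect_congr (fun i hi => by rw [Interp.slots_eq hi, h i hi])

theorem Interp.mem_rel {I : Interp} {A : List AttrName} {T : List SymTuple} {x : Tuple} :
    x ∈ I.rel A T ↔ ∃ t ∈ T, I.del t = false ∧ I.row A t = x := by
  simp [Interp.rel, Interp.row, and_assoc]

theorem Interp.rel_append (I : Interp) (A : List AttrName) (T T' : List SymTuple) :
    I.rel A (T ++ T') = I.rel A T ++ I.rel A T' := by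
  simp [Interp.rel]

theorem length_sigma (p : Label) (tag n : ℕ) : (sigma p tag n).length = n := by simp [sigma]

theorem getElem_sigma {p : Label} {tag n i : ℕ} (h : i < (sigma p tag n).length) :
    (sigma p tag n)[i] = .fresh p tag i := by simp [sigma]

/-! # Deleting duplicates and differences of partial lists -/

section Dedup
variable {α : Type*} [DecidableEq α]

theorem mem_dedup {xs : List α} {x : α} : x ∈ dedup xs ↔ x ∈ xs := by
  induction xs with
  | nil => simp [dedup]
  | cons y xs ih =>
    rw [dedup] at ih ⊢
    simp only [List.foldr_cons, List.mem_cons, List.mem_filter, ih, decide_eq_true_eq]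
    by_cases h : x = y
    · simp [h]
    · simp [h, Ne.symm h]

theorem dedup_cons (x : α) (xs : List α) :
    dedup (x :: xs) = x :: (dedup xs).filter (fun y => decide (x ≠ y)) := rfl

theorem nodup_dedup (xs : List α) : (dedup xs).Nodup := by
  induction xs with
  | nil => simp [dedup]
  | cons y xs ih =>
    rw [dedup_cons, List.nodup_cons]
    exact ⟨by simp, ih.filter _⟩

/-- `dedup` recurses from the left while `collect` grows on the right; this recursion fits the
latter. -/
theorem dedup_append_singleton (xs : List α) (x : α) :
    dedup (xs ++ [x]) = if x ∈ xs then dedup xs else dedup xs ++ [x] := by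
  induction xs with
  | nil => simp [dedup]
  | cons y xs ih =>
    rw [List.cons_append, dedup_cons, ih, dedup_cons]
    by_cases h : x ∈ xs
    · simp [h]
    · by_cases hxy : x = y
      · subst hxy; simp [h]
      · simp [h, hxy, Ne.symm hxy]

/-- Two undefined positions count as equal here, harmlessly: the value is `none` in either branch.
-/
theorem dedup_collect (s : ℕ → Option α) (n : ℕ) :
    dedup (collect s n) = collect (fun i => if ∃ k < i, s k = s i then none else s i) n := by
  induction n with
  | zero => rfl
  | succ n ih =>
    rw [collect_succ, collect_succ]
    cases h : s n with
    | none => simp [ih]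
    | some x =>
      rw [Option.toList_some, dedup_append_singleton, ih]
      simp only [mem_collect]
      split_ifs <;> simp

/-- Erasing an absent element does nothing, so the membership guard is immaterial and the theory of
`List.diff`, in particular its invariance under permutations, applies. -/
theorem bagDiff_eq_diff (xs ys : List α) : bagDiff xs ys = xs.diff ys := by
  rw [List.diff_eq_foldl, bagDiff]
  congr 1
  funext zs y
  split_ifs with h
  · rfl
  · rw [List.erase_of_not_mem h]

theorem bagDiff_append_singleton (xs ys : List α) (y : α) :
    bagDiff xs (ys ++ [y]) = (bagDiff xs ys).erase y := by
  simp [bagDiff_eq_diff, List.diff_append]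

theorem erase_collect (s : ℕ → Option α) (n : ℕ) (y : α) :
    (collect s n).erase y =
      collect (fun i => if s i = some y ∧ ∀ k < i, s k ≠ some y then none else s i) n := by
  induction n with
  | zero => rfl
  | succ n ih =>
    rw [collect_succ, collect_succ, List.erase_append, ih]
    simp only [mem_collect]
    by_cases h : ∃ i < n, s i = some y
    · rw [if_pos h, if_neg]
      rintro ⟨-, h'⟩
      obtain ⟨i, hi, hs⟩ := h
      exact h' i hi hs
    · rw [if_neg h]
      have h1 : ∀ i < n, s i ≠ some y := fun i hi hs => h ⟨i, hi, hs⟩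
      congr 1
      · exact collect_congr (fun i hi => by rw [if_neg (fun h' => h1 i hi h'.1)])
      · by_cases h2 : s n = some y
        · rw [if_pos ⟨h2, h1⟩, h2]; simp
        · rw [if_neg (fun h' => h2 h'.1), List.erase_of_not_mem]
          cases hs : s n <;> simp_all [eq_comm]

/-- Cancelling greedily is bag difference. -/
theorem bagDiff_collect {s u : ℕ → Option α} {n m : ℕ} {P E : ℕ → ℕ → Prop}
    [∀ i, Decidable (∃ j < m, P i j)]
    (hP : ∀ i < n, ∀ j < m, P i j ↔ E i j ∧ (∀ k < i, ¬ P k j) ∧ ∀ k < j, ¬ P i k)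
    (hE : ∀ i < n, ∀ j < m, E i j → s i = u j)
    (hE' : ∀ i < n, ∀ j < m, ∀ x, s i = some x → u j = some x → E i j) :
    bagDiff (collect s n) (collect u m) =
      collect (fun i => if ∃ j < m, P i j then none else s i) n := by
  classical
  -- Induction on the part of the right operand processed so far: after `m'` positions, exactly the
  -- positions paired with some `j < m'` are cancelled.
  suffices H : ∀ m' ≤ m, bagDiff (collect s n) (collect u m') =
      collect (fun i => if ∃ j < m', P i j then none else s i) n by
    convert H m le_rfl
  intro m'
  induction m' with
  | zero => intro _; simp [collect_zero, bagDiff]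
  | succ m' ih =>
    intro hm
    rw [collect_succ]
    have ih := ih (by omega)
    cases hu : u m' with
    | none =>
      rw [Option.toList_none, List.append_nil, ih]
      -- An absent `u m'` can be paired only with an absent `s i`, by `hE`, so a new pair cancels
      -- nothing.
      refine collect_congr (fun i hi => ?_)
      by_cases h1 : ∃ j < m', P i j
      · obtain ⟨j, hj, h⟩ := h1
        rw [if_pos ⟨j, hj, h⟩, if_pos ⟨j, by omega, h⟩]
      · rw [if_neg h1]
        split_ifs with h2
        · obtain ⟨j, hj, h⟩ := h2
          have : j = m' := by
            by_contra hne
            exact h1 ⟨j, by omega, h⟩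
          subst this
          rw [hE i hi j (by omega) ((hP i hi j (by omega)).1 h).1, hu]
        · rfl
    | some y =>
      rw [Option.toList_some, bagDiff_append_singleton, ih, erase_collect]
      -- Position `i` is paired with `m'` exactly if it is the first one that still carries `y`, and
      -- that is the one `erase` removes.
      have key : ∀ i < n, (P i m' ↔ (if ∃ j < m', P i j then none else s i) = some y ∧
          ∀ k < i, (if ∃ j < m', P k j then none else s k) ≠ some y) := by
        intro i
        induction i using Nat.strong_induction_on with
        | _ i ihi =>
          intro hi
          -- Position `i` still carries `y` iff it is eligible for `m'` and not yet paired.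
          have h0 : ∀ i < n, ((if ∃ j < m', P i j then none else s i) = some y ↔
              E i m' ∧ ∀ k < m', ¬ P i k) := by
            intro i hi
            by_cases h1 : ∃ j < m', P i j
            · rw [if_pos h1]
              simp only [reduceCtorEq, false_iff, not_and, not_forall, not_not]
              intro _
              obtain ⟨j, hj, h⟩ := h1
              exact ⟨j, hj, h⟩
            · rw [if_neg h1]
              constructor
              · intro h
                exact ⟨hE' i hi m' (by omega) y h hu, fun k hk h' => h1 ⟨k, hk, h'⟩⟩
              · intro h
                rw [hE i hi m' (by omega) h.1, hu]
          rw [hP i hi m' (by omega), h0 i hi]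
          constructor
          · rintro ⟨h1, h2, h3⟩
            refine ⟨⟨h1, h3⟩, ?_⟩
            by_contra hcon
            push Not at hcon
            obtain ⟨k, hk, hks⟩ := hcon
            -- The least earlier position still carrying `y` is paired with `m'` by the induction
            -- hypothesis, contrary to `h2`.
            have hex : ∃ k, k < i ∧ (if ∃ j < m', P k j then none else s k) = some y :=
              ⟨k, hk, hks⟩
            have hsp := Nat.find_spec hex
            refine h2 _ hsp.1 ((ihi _ hsp.1 (by omega)).2 ⟨hsp.2, fun l hl hl' => ?_⟩)
            exact Nat.find_min hex hl ⟨by omega, hl'⟩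
          · rintro ⟨⟨h1, h3⟩, h2⟩
            exact ⟨h1, fun k hk h => h2 k hk ((ihi k hk (by omega)).1 h).1, h3⟩
      refine collect_congr (fun i hi => ?_)
      simp only [← key i hi]
      by_cases h1 : P i m'
      · rw [if_pos h1, if_pos ⟨m', by omega, h1⟩]
      · rw [if_neg h1]
        congr 1
        refine propext ⟨fun ⟨j, hj, h⟩ => ⟨j, by omega, h⟩, fun ⟨j, hj, h⟩ => ⟨j, ?_, h⟩⟩
        by_contra hne
        have : j = m' := by omega
        exact h1 (this ▸ h)

end Dedup

/-! # Three-valued logic -/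

/-- The disjunction of a list of truth values. -/
def anyTrue3 (vs : List Value) : Value :=
  if .bool true ∈ vs then .bool true else if .null ∈ vs then .null else .bool false

/-- The values `⊤`, `⊥` and `Null`. -/
def Value.IsTruth (v : Value) : Prop := v = .null ∨ v = .bool true ∨ v = .bool false

theorem or3_comm (v w : Value) : or3 v w = or3 w v := by
  unfold or3
  congr 1
  · apply propext; tauto
  · congr 2; apply propext; tauto

/-- The restriction to truth values matters: `or3` of an integer and `Null` is `⊥`, whereas
`anyTrue3` would still report the `Null`. -/
theorem foldr_or3 {vs : List Value} (h : ∀ v ∈ vs, v.IsTruth) :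
    vs.foldr or3 (.bool false) = anyTrue3 vs := by
  induction vs with
  | nil => simp [anyTrue3]
  | cons v vs ih =>
    rw [List.foldr_cons, ih (fun v hv => h v (List.mem_cons_of_mem _ hv))]
    unfold anyTrue3
    rcases h v (by simp) with rfl | rfl | rfl <;> by_cases h1 : Value.bool true ∈ vs <;>
      by_cases h2 : Value.null ∈ vs <;> simp [h1, h2, or3]

/-- `anyTrue3` depends only on which values occur, so the left fold of the semantics and the right
fold of the encoding have a common normal form. -/
theorem foldl_or3 {α : Type*} {f : α → Value} {xs : List α} (h : ∀ x ∈ xs, (f x).IsTruth) :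
    xs.foldl (fun b x => or3 b (f x)) (.bool false) = anyTrue3 (xs.map f) := by
  have h1 : xs.foldl (fun b x => or3 b (f x)) (.bool false) =
      (xs.map f).reverse.foldr or3 (.bool false) := by
    rw [List.foldr_reverse, List.foldl_map]
    congr 1; funext b x; exact or3_comm _ _
  rw [h1, foldr_or3 (by simpa using h)]
  simp [anyTrue3]

theorem and3_isTruth (v w : Value) : (and3 v w).IsTruth := by
  unfold and3 Value.IsTruth
  split_ifs
  · simp
  · right
    cases decide (v = .bool true ∧ w = .bool true) <;> simp

theorem rowEq3_isTruth (vs ws : List Value) : (rowEq3 vs ws).IsTruth := by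
  unfold rowEq3
  cases List.zipWith (cmp3 .eq) vs ws with
  | nil => simp [Value.IsTruth]
  | cons v vs => exact and3_isTruth _ _

-- Values of the logical connectives and folds in terms

section Terms
variable (I : Interp)

theorem eval_boolT (F : Formula) : (boolT F).eval I = .bool (F.eval I) := by
  cases h : F.eval I <;> simp [boolT, topT, botT, Term.eval, h]

theorem eval_nullT : nullT.eval I = .null := by simp [nullT, Term.eval]

theorem eval_topT : topT.eval I = .bool true := by simp [topT, Term.eval]

theorem eval_botT : botT.eval I = .bool false := by simp [botT, Term.eval]

theorem eval_cmp3T (op : CmpOp) (v w : Term) :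
    (cmp3T op v w).eval I = cmp3 op (v.eval I) (w.eval I) := by
  simp only [cmp3T, cmp3, Term.eval, eval_or, eval_isNullF, eval_nullT, eval_boolT]
  simp only [Formula.eval]

theorem eval_and3T (v w : Term) : (and3T v w).eval I = and3 (v.eval I) (w.eval I) := by
  simp only [and3T, and3, Term.eval, eval_or, eval_and, eval_isNullF, eval_isTrueF, eval_nullT,
    eval_boolT]
  congr 2
  rw [Bool.eq_iff_iff, decide_eq_true_iff, eval_and, eval_isTrueF, eval_isTrueF]

theorem eval_or3T (v w : Term) : (or3T v w).eval I = or3 (v.eval I) (w.eval I) := by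
  simp only [or3T, or3, Term.eval, eval_or, eval_and, eval_isNullF, eval_eq, eval_botT,
    eval_nullT, eval_boolT]
  congr 2
  rw [Bool.eq_iff_iff, decide_eq_true_iff, eval_or, eval_isTrueF, eval_isTrueF]

theorem eval_not3T (v : Term) : (not3T v).eval I = not3 (v.eval I) := by
  simp only [not3T, not3, Term.eval, eval_isNullF, eval_nullT, eval_boolT]
  congr 2
  rw [Bool.eq_iff_iff, decide_eq_true_iff, eval_not, eval_isTrueF]

theorem eval_rowEq3T (vs ws : List Term) :
    (rowEq3T vs ws).eval I = rowEq3 (vs.map (Term.eval I)) (ws.map (Term.eval I)) := by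
  unfold rowEq3T rowEq3
  induction vs generalizing ws with
  | nil => simp [eval_topT]
  | cons v vs ih =>
    cases ws with
    | nil => simp [eval_topT]
    | cons w ws => simp [eval_and3T, eval_cmp3T, ih]

theorem eval_foldr_or3T (vs : List Term) :
    (vs.foldr or3T botT).eval I = (vs.map (Term.eval I)).foldr or3 (.bool false) := by
  induction vs with
  | nil => simp [eval_botT]
  | cons v vs ih => simp [eval_or3T, ih]

theorem eval_foldl_arith (op : ArithOp) (vs : List Term) (t : Term) :
    (vs.foldl (Term.arith op) t).eval I = (vs.map (Term.eval I)).foldl op.apply (t.eval I) := by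
  induction vs generalizing t with
  | nil => rfl
  | cons v vs ih => simp [ih, Term.eval]

theorem eval_foldl_min (vs : List Term) (t : Term) :
    (vs.foldl Term.min t).eval I = (vs.map (Term.eval I)).foldl Value.min (t.eval I) := by
  induction vs generalizing t with
  | nil => rfl
  | cons v vs ih => simp [ih, Term.eval]

theorem eval_foldl_max (vs : List Term) (t : Term) :
    (vs.foldl Term.max t).eval I = (vs.map (Term.eval I)).foldl Value.max (t.eval I) := by
  induction vs generalizing t with
  | nil => rfl
  | cons v vs ih => simp [ih, Term.eval]

end Terms

/-! # The order of values -/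

theorem Value.lt_irrefl (v : Value) : v.lt v = false := by
  cases v <;> simp [Value.lt]

theorem Value.lt_trans {u v w : Value} (h : u.lt v = true) (h' : v.lt w = true) :
    u.lt w = true := by
  cases u <;> cases v <;> cases w <;> simp_all [Value.lt]
  omega

theorem Value.lt_asymm {v w : Value} (h : v.lt w = true) : w.lt v = false := by
  by_contra hc
  have := Value.lt_trans h (by simpa using hc)
  simp [Value.lt_irrefl] at this

theorem Value.eq_of_not_lt {v w : Value} (h : v.lt w = false) (h' : w.lt v = false) : v = w := by
  cases v <;> cases w <;> simp_all [Value.lt]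
  · omega
  · rename_i a b; cases a <;> cases b <;> simp_all

/-! # Aggregates -/

theorem Value.min_null_right (v : Value) : Value.min v .null = v := by
  by_cases h : v = .null <;> simp [Value.min, h]

theorem Value.max_null_right (v : Value) : Value.max v .null = v := by
  by_cases h : v = .null <;> simp [Value.max, h]

/-- With `null` as neutral element this is the minimum of a total order on the other values. Right
commutativity makes the left fold independent of the order of the list. -/
instance : RightCommutative Value.min where
  right_comm a b c := by
    rcases a with _ | a | a <;> rcases b with _ | b | b <;> rcases c with _ | c | c <;>
      simp only [Value.min, Value.lt, reduceCtorEq, if_true, if_false, Bool.false_eq_true,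
        decide_eq_true_eq, ite_self]
    all_goals first
      | (cases a <;> cases b <;> cases c <;> rfl)
      | (cases a <;> cases b <;> rfl)
      | (cases a <;> cases c <;> rfl)
      | (cases b <;> cases c <;> rfl)
      | (split_ifs <;> simp_all <;> omega)

instance : RightCommutative Value.max where
  right_comm a b c := by
    rcases a with _ | a | a <;> rcases b with _ | b | b <;> rcases c with _ | c | c <;>
      simp only [Value.max, Value.lt, reduceCtorEq, if_true, if_false, Bool.false_eq_true,
        decide_eq_true_eq, ite_self]
    all_goals first
      | (cases a <;> cases b <;> cases c <;> rfl)
      | (cases a <;> cases b <;> rfl)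
      | (cases a <;> cases c <;> rfl)
      | (cases b <;> cases c <;> rfl)
      | (split_ifs <;> simp_all <;> omega)

theorem add_right_comm (a b c : Value) :
    ArithOp.add.apply (ArithOp.add.apply a b) c = ArithOp.add.apply (ArithOp.add.apply a c) b := by
  cases a <;> cases b <;> cases c <;> simp [ArithOp.apply]
  omega

/-- All aggregates are built from left folds by right-commutative operations and from a test on all
elements, and none of these sees the order. Aggregates can thus be evaluated on relations that are
known only as bags. -/
theorem Agg.eval_perm (G : Agg) {vs ws : List Value} (h : vs.Perm ws) : G.eval vs = G.eval ws := by
  have hf : ∀ f : Value → Value,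
      vs.foldl (fun n v => ArithOp.add.apply n (f v)) (.int 0) =
        ws.foldl (fun n v => ArithOp.add.apply n (f v)) (.int 0) := fun f =>
    h.foldl_eq' (f := fun n v => ArithOp.add.apply n (f v))
      (fun x _ y _ z => add_right_comm _ _ _) _
  have hall : vs.all (fun v => v = .null) = ws.all (fun v => v = .null) := h.all_eq
  have hmin : vs.foldl Value.min .null = ws.foldl Value.min .null := h.foldl_eq _
  have hmax : vs.foldl Value.max .null = ws.foldl Value.max .null := h.foldl_eq _
  unfold Agg.eval
  rw [hall, hf, hf, hmin, hmax]

/-- The values that are present in a conditional list. -/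
def Interp.presentVals (I : Interp) (vs : List (Formula × Term)) : List Value :=
  (vs.filter (fun v => v.1.eval I)).map (fun v => v.2.eval I)

/-- An absent tuple contributes the summand `0`. This is neutral for integers and `Null` but not for
Booleans, to which adding gives `Null`; hence the condition on the accumulator, which every addition
restores. -/
theorem foldl_add_present (I : Interp) (f : Value → Value) (g : Formula × Term → Term)
    (vs : List (Formula × Term))
    (h : ∀ v ∈ vs, (g v).eval I = if v.1.eval I = true then f (v.2.eval I) else .int 0)
    {a : Value} (ha : a = .null ∨ ∃ z, a = .int z) :
    ((vs.map g).map (Term.eval I)).foldl ArithOp.add.apply a =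
      (I.presentVals vs).foldl (fun n v => ArithOp.add.apply n (f v)) a := by
  have hadd : ∀ v w : Value, ArithOp.add.apply v w = .null ∨ ∃ z, ArithOp.add.apply v w = .int z := by
    intro v w; cases v <;> cases w <;> simp [ArithOp.apply]
  induction vs generalizing a with
  | nil => rfl
  | cons v vs ih =>
    have ih := @ih (fun w hw => h w (List.mem_cons_of_mem _ hw))
    simp only [List.map_cons, List.foldl_cons]
    rw [h v (by simp)]
    unfold Interp.presentVals at ih ⊢
    rw [List.filter_cons]
    cases hv : v.1.eval I
    · have : ArithOp.add.apply a (.int 0) = a := by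
        rcases ha with rfl | ⟨z, rfl⟩ <;> simp [ArithOp.apply]
      simp only [Bool.false_eq_true, if_false, this, ih ha]
    · simp only [if_true, List.map_cons, List.foldl_cons, ih (hadd _ _)]

/-- The counterpart for `min` and `max`, where an absent tuple contributes the neutral `null`. -/
theorem foldl_present (I : Interp) (op : Value → Value → Value) (hop : ∀ v, op v .null = v)
    (g : Formula × Term → Term) (vs : List (Formula × Term))
    (h : ∀ v ∈ vs, (g v).eval I = if v.1.eval I = true then v.2.eval I else .null) (a : Value) :
    ((vs.map g).map (Term.eval I)).foldl op a = (I.presentVals vs).foldl op a := by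
  induction vs generalizing a with
  | nil => rfl
  | cons v vs ih =>
    have ih := @ih (fun w hw => h w (List.mem_cons_of_mem _ hw))
    simp only [List.map_cons, List.foldl_cons]
    rw [h v (by simp)]
    unfold Interp.presentVals at ih ⊢
    rw [List.filter_cons]
    cases hv : v.1.eval I
    · simp only [Bool.false_eq_true, if_false, hop, ih]
    · simp only [if_true, List.map_cons, List.foldl_cons, ih]

theorem foldl_idem {α : Type*} (op : α → α → α) (a : α) (h : op a a = a) (vs : List α)
    (hv : ∀ v ∈ vs, v = a) : vs.foldl op a = a := by
  induction vs with
  | nil => rfl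
  | cons v vs ih =>
    rw [List.foldl_cons, hv v (by simp), h]
    exact ih (fun w hw => hv w (List.mem_cons_of_mem _ hw))

theorem Agg.eval_enc (G : Agg) (I : Interp) (vs : List (Formula × Term)) :
    (G.enc vs).eval I = G.eval (I.presentVals vs) := by
  have hall : (conjL (vs.map (fun v => Formula.imp v.1 (isNullF v.2)))).eval I =
      (I.presentVals vs).all (fun v => v = .null) := by
    rw [Bool.eq_iff_iff, eval_conjL]
    simp only [List.forall_mem_map, eval_imp, eval_isNullF]
    simp [Interp.presentVals, imp_iff_not_or]
  have habs : ∀ v : Formula × Term, (Formula.or (.not v.1) (isNullF v.2)).eval I = true ↔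
      (v.1.eval I = true → v.2.eval I = .null) := by
    intro v
    rw [eval_or, eval_not, eval_isNullF]; tauto
  have hcount := foldl_add_present I (fun v => if v = .null then .int 0 else .int 1)
    (fun v => .ite (.or (.not v.1) (isNullF v.2)) (.const (.int 0)) (.const (.int 1))) vs
    (by intro v _
        simp only [Term.eval, habs]
        by_cases h1 : v.1.eval I = true <;> simp [h1]) (a := .int 0) (Or.inr ⟨0, rfl⟩)
  have hsum := foldl_add_present I (fun v => if v = .null then .int 0 else v)
    (fun v => .ite (.or (.not v.1) (isNullF v.2)) (.const (.int 0)) v.2) vs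
    (by intro v _
        simp only [Term.eval, habs]
        by_cases h1 : v.1.eval I = true <;> simp [h1]) (a := .int 0) (Or.inr ⟨0, rfl⟩)
  have hval : ∀ v ∈ vs, (Term.ite (.or (.not v.1) (isNullF v.2)) nullT v.2).eval I =
      if v.1.eval I = true then v.2.eval I else .null := by
    intro v _
    simp only [Term.eval, habs, eval_nullT]
    by_cases h1 : v.1.eval I = true
    · by_cases h2 : v.2.eval I = .null <;> simp [h1, h2]
    · simp [h1]
  have hmin := foldl_present I Value.min Value.min_null_right
    (fun v => Term.ite (.or (.not v.1) (isNullF v.2)) nullT v.2) vs hval .null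
  have hmax := foldl_present I Value.max Value.max_null_right
    (fun v => Term.ite (.or (.not v.1) (isNullF v.2)) nullT v.2) vs hval .null
  -- Before `min` and `max` the encoding tests whether all values are `Null`, the semantics does
  -- not. The test is redundant, since a fold of `Null`s is `Null`.
  have hnull : ∀ op : Value → Value → Value, (∀ v, op v .null = v) →
      (I.presentVals vs).all (fun v => v = .null) = true →
      (I.presentVals vs).foldl op .null = .null := by
    intro op hop h
    exact foldl_idem op _ (hop _) _ (by simpa using h)
  have hmin' := hnull _ Value.min_null_right
  have hmax' := hnull _ Value.max_null_right
  cases G <;> simp only [Agg.enc, Agg.eval, Term.eval, hall, eval_foldl_arith, eval_foldl_min,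
    eval_foldl_max, eval_nullT, hcount, hsum, hmin, hmax]
  · split_ifs with h
    · exact (hmin' h).symm
    · rfl
  · split_ifs with h
    · exact (hmax' h).symm
    · rfl

/-! # Invariance of the concrete semantics -/

section HeadOnly
variable {N : Naming} {S : Schema} {D : Database} {xs ys : Relation}

mutual
/-- Without aggregates, only the first tuple matters. -/
theorem evalE_congr_head (h : xs.headD [] = ys.headD []) : (E : Expr) → E.hasAgg = false →
    evalE N S D xs E = evalE N S D ys E
  | .attr a, _ => by simp only [evalE, lookupHead, h]
  | .val v, _ => by simp only [evalE]
  | .arith op E₁ E₂, hE => by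
      simp only [Expr.hasAgg, Bool.or_eq_false_iff] at hE
      simp only [evalE, evalE_congr_head h E₁ hE.1, evalE_congr_head h E₂ hE.2]
  | .ite φ E₁ E₂, hE => by
      simp only [Expr.hasAgg, Bool.or_eq_false_iff] at hE
      simp only [evalE, evalP_congr_head h φ hE.1.1, evalE_congr_head h E₁ hE.1.2,
        evalE_congr_head h E₂ hE.2]
  | .case bs E, hE => by
      simp only [Expr.hasAgg, Bool.or_eq_false_iff] at hE
      simp only [evalE, evalE_congr_head h E hE.2, evalBr_congr_head h bs hE.1]
theorem evalBr_congr_head (h : xs.headD [] = ys.headD []) : (bs : Branches) →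
    bs.hasAgg = false → (d : Value) → evalBr N S D xs bs d = evalBr N S D ys bs d
  | .nil, _, d => by simp only [evalBr]
  | .cons φ E bs, hb, d => by
      simp only [Branches.hasAgg, Bool.or_eq_false_iff] at hb
      simp only [evalBr, evalP_congr_head h φ hb.1.1, evalE_congr_head h E hb.1.2,
        evalBr_congr_head h bs hb.2]
theorem evalEs_congr_head (h : xs.headD [] = ys.headD []) : (Es : ExprList) →
    Es.hasAgg = false → evalEs N S D xs Es = evalEs N S D ys Es
  | .nil, _ => by simp only [evalEs]
  | .cons E Es, hE => by
      simp only [ExprList.hasAgg, Bool.or_eq_false_iff] at hE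
      simp only [evalEs, evalE_congr_head h E hE.1, evalEs_congr_head h Es hE.2]
theorem evalA_congr_head (h : xs.headD [] = ys.headD []) : (A : Attr) → A.hasAgg = false →
    evalA N S D xs A = evalA N S D ys A
  | .cast φ, hA => by
      simp only [Attr.hasAgg] at hA
      simp only [evalA, evalP_congr_head h φ hA]
  | .expr E, hA => by
      simp only [Attr.hasAgg] at hA
      simp only [evalA, evalE_congr_head h E hA]
  | .agg G E, hA => by simp [Attr.hasAgg] at hA
  | .arith op A₁ A₂, hA => by
      simp only [Attr.hasAgg, Bool.or_eq_false_iff] at hA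
      simp only [evalA, evalA_congr_head h A₁ hA.1, evalA_congr_head h A₂ hA.2]
theorem evalP_congr_head (h : xs.headD [] = ys.headD []) : (φ : Pred) → φ.hasAgg = false →
    evalP N S D xs φ = evalP N S D ys φ
  | .const b, _ => by simp only [evalP]
  | .null, _ => by simp only [evalP]
  | .cmp op A₁ A₂, hP => by
      simp only [Pred.hasAgg, Bool.or_eq_false_iff] at hP
      simp only [evalP, evalA_congr_head h A₁ hP.1, evalA_congr_head h A₂ hP.2]
  | .isNull E, hP => by
      simp only [Pred.hasAgg] at hP
      simp only [evalP, evalE_congr_head h E hP]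
  | .inVals Es vs, hP => by
      simp only [Pred.hasAgg] at hP
      simp only [evalP, evalEs_congr_head h Es hP]
  | .inQuery Es Q, hP => by
      simp only [Pred.hasAgg] at hP
      simp only [evalP, evalEs_congr_head h Es hP]
  | .and φ₁ φ₂, hP => by
      simp only [Pred.hasAgg, Bool.or_eq_false_iff] at hP
      simp only [evalP, evalP_congr_head h φ₁ hP.1, evalP_congr_head h φ₂ hP.2]
  | .or φ₁ φ₂, hP => by
      simp only [Pred.hasAgg, Bool.or_eq_false_iff] at hP
      simp only [evalP, evalP_congr_head h φ₁ hP.1, evalP_congr_head h φ₂ hP.2]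
  | .not φ, hP => by
      simp only [Pred.hasAgg] at hP
      simp only [evalP, evalP_congr_head h φ hP]
end

end HeadOnly

-- Invariance under permutations of a group

section Grouped
variable {N : Naming} {S : Schema} {D : Database} {xs ys : Relation} {G : ExprList}

mutual
/-- Grouped expressions do not depend on the order of the tuples of a group. -/
theorem evalE_perm (h : xs.Perm ys)
    (hG : ∀ E, G.Mem E → evalE N S D xs E = evalE N S D ys E) : (E : Expr) → E.Grouped G →
    evalE N S D xs E = evalE N S D ys E
  | .attr a, hE => hG _ hE
  | .val v, _ => by simp only [evalE]
  | .arith op E₁ E₂, hE => by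
      simp only [Expr.Grouped] at hE
      rcases hE with hE | hE
      · exact hG _ hE
      · simp only [evalE, evalE_perm h hG E₁ hE.1, evalE_perm h hG E₂ hE.2]
  | .ite φ E₁ E₂, hE => by
      simp only [Expr.Grouped] at hE
      rcases hE with hE | hE
      · exact hG _ hE
      · simp only [evalE, evalP_perm h hG φ hE.1, evalE_perm h hG E₁ hE.2.1,
          evalE_perm h hG E₂ hE.2.2]
  | .case bs E, hE => by
      simp only [Expr.Grouped] at hE
      rcases hE with hE | hE
      · exact hG _ hE
      · simp only [evalE, evalE_perm h hG E hE.2, evalBr_perm h hG bs hE.1]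
theorem evalBr_perm (h : xs.Perm ys)
    (hG : ∀ E, G.Mem E → evalE N S D xs E = evalE N S D ys E) : (bs : Branches) →
    bs.Grouped G → (d : Value) → evalBr N S D xs bs d = evalBr N S D ys bs d
  | .nil, _, d => by simp only [evalBr]
  | .cons φ E bs, hb, d => by
      simp only [Branches.Grouped] at hb
      simp only [evalBr, evalP_perm h hG φ hb.1, evalE_perm h hG E hb.2.1,
        evalBr_perm h hG bs hb.2.2]
theorem evalEs_perm (h : xs.Perm ys)
    (hG : ∀ E, G.Mem E → evalE N S D xs E = evalE N S D ys E) : (Es : ExprList) →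
    ExprList.Grouped G Es → evalEs N S D xs Es = evalEs N S D ys Es
  | .nil, _ => by simp only [evalEs]
  | .cons E Es, hE => by
      simp only [ExprList.Grouped] at hE
      simp only [evalEs, evalE_perm h hG E hE.1, evalEs_perm h hG Es hE.2]
theorem evalA_perm (h : xs.Perm ys)
    (hG : ∀ E, G.Mem E → evalE N S D xs E = evalE N S D ys E) : (A : Attr) → A.Grouped G →
    evalA N S D xs A = evalA N S D ys A
  | .cast φ, hA => by
      simp only [Attr.Grouped] at hA
      simp only [evalA, evalP_perm h hG φ hA]
  | .expr E, hA => by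
      simp only [Attr.Grouped] at hA
      simp only [evalA, evalE_perm h hG E hA]
  | .agg F E, _ => by
      simp only [evalA]
      exact F.eval_perm (h.map _)
  | .arith op A₁ A₂, hA => by
      simp only [Attr.Grouped] at hA
      simp only [evalA, evalA_perm h hG A₁ hA.1, evalA_perm h hG A₂ hA.2]
theorem evalP_perm (h : xs.Perm ys)
    (hG : ∀ E, G.Mem E → evalE N S D xs E = evalE N S D ys E) : (φ : Pred) → φ.Grouped G →
    evalP N S D xs φ = evalP N S D ys φ
  | .const b, _ => by simp only [evalP]
  | .null, _ => by simp only [evalP]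
  | .cmp op A₁ A₂, hP => by
      simp only [Pred.Grouped] at hP
      simp only [evalP, evalA_perm h hG A₁ hP.1, evalA_perm h hG A₂ hP.2]
  | .isNull E, hP => by
      simp only [Pred.Grouped] at hP
      simp only [evalP, evalE_perm h hG E hP]
  | .inVals Es vs, hP => by
      simp only [Pred.Grouped] at hP
      simp only [evalP, evalEs_perm h hG Es hP]
  | .inQuery Es Q, hP => by
      simp only [Pred.Grouped] at hP
      simp only [evalP, evalEs_perm h hG Es hP]
  | .and φ₁ φ₂, hP => by
      simp only [Pred.Grouped] at hP
      simp only [evalP, evalP_perm h hG φ₁ hP.1, evalP_perm h hG φ₂ hP.2]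
  | .or φ₁ φ₂, hP => by
      simp only [Pred.Grouped] at hP
      simp only [evalP, evalP_perm h hG φ₁ hP.1, evalP_perm h hG φ₂ hP.2]
  | .not φ, hP => by
      simp only [Pred.Grouped] at hP
      simp only [evalP, evalP_perm h hG φ hP]
end

theorem evalL_perm (h : xs.Perm ys)
    (hG : ∀ E, G.Mem E → evalE N S D xs E = evalE N S D ys E) : (L : AttrList) → L.Grouped G →
    evalL N S D xs L = evalL N S D ys L
  | .id A, hL => by
      simp only [AttrList.Grouped] at hL
      simp only [evalL, evalA_perm h hG A hL]
  | .rename a A, hL => by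
      simp only [AttrList.Grouped] at hL
      simp only [evalL, evalA_perm h hG A hL]
  | .append L₁ L₂, hL => by
      simp only [AttrList.Grouped] at hL
      simp only [evalL, evalL_perm h hG L₁ hL.1, evalL_perm h hG L₂ hL.2]

theorem ExprList.hasAgg_of_mem {E : Expr} : {Es : ExprList} → Es.hasAgg = false → Es.Mem E →
    E.hasAgg = false
  | .nil, _, h => h.elim
  | .cons E' Es, h, hE => by
      simp only [ExprList.hasAgg, Bool.or_eq_false_iff] at h
      rcases hE with rfl | hE
      · exact h.1
      · exact ExprList.hasAgg_of_mem h.2 hE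

theorem evalE_eq_of_evalEs_eq {E : Expr} : {Es : ExprList} →
    evalEs N S D xs Es = evalEs N S D ys Es → Es.Mem E → evalE N S D xs E = evalE N S D ys E
  | .nil, _, h => h.elim
  | .cons E' Es, h, hE => by
      simp only [evalEs, List.cons.injEq] at h
      rcases hE with rfl | hE
      · exact h.1
      · exact evalE_eq_of_evalEs_eq h.2 hE

/-- On permutations of a group, the grouping expressions have the same values. -/
theorem evalE_group_eq (h : xs.Perm ys) (hG : G.hasAgg = false)
    (hkey : ∀ x ∈ xs, ∀ y ∈ xs, evalEs N S D [x] G = evalEs N S D [y] G) (E : Expr)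
    (hE : G.Mem E) : evalE N S D xs E = evalE N S D ys E := by
  have hE' := ExprList.hasAgg_of_mem hG hE
  cases xs with
  | nil => rw [h.nil_eq]
  | cons x xs =>
    cases ys with
    | nil => simp at h
    | cons y ys =>
      -- Without aggregates, the value on a group is the value on its first tuple. The first tuples
      -- of the two lists may differ, but both belong to the group and so have equal keys.
      rw [evalE_congr_head (xs := x :: xs) (ys := [x]) (by simp) E hE',
        evalE_congr_head (xs := y :: ys) (ys := [y]) (by simp) E hE']
      exact evalE_eq_of_evalEs_eq (hkey x (by simp) y (h.mem_iff.2 (by simp))) hE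

end Grouped

/-! # Operators on permuted relations -/

theorem filter_perm {α : Type*} {xs ys : List α} {f g : α → Bool} (h : xs.Perm ys) (hfg : ∀ x, f x = g x) :
    (xs.filter f).Perm (ys.filter g) := by
  rw [funext hfg]; exact h.filter _

section Perm
variable {α : Type*} [DecidableEq α]

/-- First occurrences may come in another order, but both sides are free of duplicates and have the
same elements. -/
theorem dedup_perm {xs ys : List α} (h : xs.Perm ys) : (dedup xs).Perm (dedup ys) :=
  (List.perm_ext_iff_of_nodup (nodup_dedup _) (nodup_dedup _)).2
    (fun x => by rw [mem_dedup, mem_dedup, h.mem_iff])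

theorem bagDiff_perm {xs xs' ys ys' : List α} (h : xs.Perm xs') (h' : ys.Perm ys') :
    (bagDiff xs ys).Perm (bagDiff xs' ys') := by
  rw [bagDiff_eq_diff, bagDiff_eq_diff]
  exact h.diff h'

end Perm

theorem crossProd_perm {xs xs' ys ys' : Relation} (h : xs.Perm xs') (h' : ys.Perm ys') :
    (crossProd xs ys).Perm (crossProd xs' ys') :=
  (h.flatMap_right _).trans (List.Perm.flatMap_left _ (fun _ _ => h'.map _))

/-- The rows of `xs` without partner, padded with `Null`s. -/
def leftPads (θ : Tuple → Bool) (A₂ : List AttrName) (xs ys : Relation) : Relation :=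
  (xs.filter (fun x => decide (((crossProd [x] ys).filter θ).length = 0))).map
    (fun x => x ++ nullTuple A₂)

/-- The rows of `ys` without partner, padded with `Null`s. -/
def rightPads (θ : Tuple → Bool) (A₁ : List AttrName) (xs ys : Relation) : Relation :=
  (ys.filter (fun y => decide (((crossProd xs [y]).filter θ).length = 0))).map
    (fun y => nullTuple A₁ ++ y)

theorem leftPads_perm (θ : Tuple → Bool) (A₂ : List AttrName) {xs xs' ys ys' : Relation}
    (h : xs.Perm xs') (h' : ys.Perm ys') : (leftPads θ A₂ xs ys).Perm (leftPads θ A₂ xs' ys') :=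
  (filter_perm h (fun x => by
    rw [((crossProd_perm (List.Perm.refl [x]) h').filter θ).length_eq])).map _

theorem rightPads_perm (θ : Tuple → Bool) (A₁ : List AttrName) {xs xs' ys ys' : Relation}
    (h : xs.Perm xs') (h' : ys.Perm ys') : (rightPads θ A₁ xs ys).Perm (rightPads θ A₁ xs' ys') :=
  (filter_perm h' (fun y => by
    rw [((crossProd_perm h (List.Perm.refl [y])).filter θ).length_eq])).map _

/-- The default `[g x]` is used only if `f x` is empty, so every block is `f x` followed by an
optional `g x`. Up to permutation, the two parts of all blocks can be gathered separately. This is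
where outer joins give up the order of the list. -/
theorem flatMap_ite_perm {α β : Type*} (xs : List α) (f : α → List β) (g : α → β) :
    (xs.flatMap (fun x => if (f x).length = 0 then [g x] else f x)).Perm
      (xs.flatMap f ++ (xs.filter (fun x => decide ((f x).length = 0))).map g) := by
  have h1 : (xs.filter (fun x => decide ((f x).length = 0))).map g =
      xs.flatMap (fun x => if (f x).length = 0 then [g x] else []) := by
    induction xs with
    | nil => rfl
    | cons x xs ih =>
      rw [List.filter_cons, List.flatMap_cons, ← ih]
      by_cases h : (f x).length = 0 <;> simp [h]
  have h2 : xs.flatMap (fun x => if (f x).length = 0 then [g x] else f x) =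
      xs.flatMap (fun x => f x ++ if (f x).length = 0 then [g x] else []) := by
    congr 1; funext x
    by_cases h : (f x).length = 0
    · rw [if_pos h, if_pos h, List.length_eq_zero_iff.1 h, List.nil_append]
    · rw [if_neg h, if_neg h, List.append_nil]
  rw [h1, h2]
  exact (List.flatMap_append_perm _ _ _).symm

theorem leftOuter_perm (θ : Tuple → Bool) (A₂ : List AttrName) (xs ys : Relation) :
    (leftOuter θ A₂ xs ys).Perm ((crossProd xs ys).filter θ ++ leftPads θ A₂ xs ys) := by
  have h : (crossProd xs ys).filter θ = xs.flatMap (fun x => (crossProd [x] ys).filter θ) := by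
    simp [crossProd, List.filter_flatMap]
  rw [h]
  exact flatMap_ite_perm _ _ _

theorem crossProd_nil (xs : Relation) : crossProd xs [] = [] := by
  simp [crossProd]

theorem crossProd_cons_perm (xs ys : Relation) (y : Tuple) :
    (crossProd xs (y :: ys)).Perm (crossProd xs [y] ++ crossProd xs ys) := by
  have := List.flatMap_append_perm xs (fun x => [x ++ y]) (fun x => ys.map (fun y => x ++ y))
  simpa [crossProd] using this.symm

/-- The right join has `ys` in its outer loop, the product has `xs`, so even the matching rows may
be ordered differently. -/
theorem rightOuter_perm (θ : Tuple → Bool) (A₁ : List AttrName) (xs ys : Relation) :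
    (rightOuter θ A₁ xs ys).Perm ((crossProd xs ys).filter θ ++ rightPads θ A₁ xs ys) := by
  have h : (ys.flatMap (fun y => (crossProd xs [y]).filter θ)).Perm
      ((crossProd xs ys).filter θ) := by
    induction ys with
    | nil => simp [crossProd_nil]
    | cons y ys ih =>
      rw [List.flatMap_cons]
      refine (ih.append_left _).trans ?_
      rw [← List.filter_append]
      exact ((crossProd_cons_perm xs ys y).filter θ).symm
  exact (flatMap_ite_perm _ _ _).trans (h.append_right _)

/-- The right pads are moved in front of the left pads, the order in which the symbolic result lists
them. -/
theorem fullOuter_perm (θ : Tuple → Bool) (A₁ A₂ : List AttrName) (xs ys : Relation) :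
    (fullOuter θ A₁ A₂ xs ys).Perm
      ((crossProd xs ys).filter θ ++ rightPads θ A₁ xs ys ++ leftPads θ A₂ xs ys) := by
  refine ((leftOuter_perm θ A₂ xs ys).append_right _).trans ?_
  rw [List.append_assoc, List.append_assoc]
  exact List.perm_append_comm.append_left _

/-- Grouping of permuted relations. -/
theorem groupBy_perm {N : Naming} {S : Schema} {D : Database} {Es : ExprList} {L : AttrList}
    {φ : Pred} (hEs : Es.hasAgg = false) (hL : L.Grouped Es) (hφ : φ.Grouped Es)
    {xs ys : Relation} (h : xs.Perm ys) :
    (((groups (fun x => evalEs N S D [x] Es) xs).filter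
        (fun xs => decide (evalP N S D xs φ = .bool true))).map (fun xs => evalL N S D xs L)).Perm
      (((groups (fun x => evalEs N S D [x] Es) ys).filter
        (fun xs => decide (evalP N S D xs φ = .bool true))).map (fun xs => evalL N S D xs L)) := by
  unfold groups
  rw [List.filter_map, List.map_map, List.filter_map, List.map_map]
  -- All members of the group have the key `k`, so it does not matter for the grouping expressions
  -- which of them comes first.
  have hE : ∀ k : List Value, ∀ E, Es.Mem E →
      evalE N S D (xs.filter (fun x => decide (evalEs N S D [x] Es = k))) E =
      evalE N S D (ys.filter (fun x => decide (evalEs N S D [x] Es = k))) E := fun k =>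
    evalE_group_eq (h.filter _) hEs (fun x hx y hy => by
      simp only [List.mem_filter, decide_eq_true_eq] at hx hy
      rw [hx.2, hy.2])
  have h1 : ∀ k, evalL N S D (xs.filter (fun x => decide (evalEs N S D [x] Es = k))) L =
      evalL N S D (ys.filter (fun x => decide (evalEs N S D [x] Es = k))) L := fun k =>
    evalL_perm (h.filter _) (hE k) L hL
  have h2 : ∀ k, evalP N S D (xs.filter (fun x => decide (evalEs N S D [x] Es = k))) φ =
      evalP N S D (ys.filter (fun x => decide (evalEs N S D [x] Es = k))) φ := fun k =>
    evalP_perm (h.filter _) (hE k) φ hφ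
  simp only [Function.comp_def, h1, h2]
  exact ((dedup_perm (h.map _)).filter _).map _

/-! # Correctness of the encodings of the operators -/

section Operators
variable {I : Interp} {A A₁ A₂ : List AttrName} {T T' T₁ T₂ : List SymTuple}

theorem Interp.filter_rel (θ : Tuple → Bool) :
    (I.rel A T).filter θ = collect (fun i => (I.slots A T i).filter θ) T.length := by
  rw [Interp.rel_eq_collect, filter_collect]

theorem eval_memF {t : SymTuple} :
    (memF A t T).eval I = true ↔ ∃ t' ∈ T, I.vals A t = I.vals A t' ∧ I.del t = I.del t' := by
  simp [memF, eval_disjL, eval_tupEq]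

/-- A present tuple can equal only present ones, because `tupEq` also compares deletion status; the
disjunction is thereby confined to the rows of `I.rel A T`. -/
theorem eval_memF_of_not_del {t : SymTuple} (ht : I.del t = false) :
    (memF A t T).eval I = true ↔ I.row A t ∈ I.rel A T := by
  rw [eval_memF, Interp.mem_rel]
  simp only [ht, eq_comm (a := false), Interp.row_eq_row_iff]
  constructor <;> rintro ⟨t', h, h1, h2⟩ <;> [exact ⟨t', h, h2, h1.symm⟩; exact ⟨t', h, h2.symm, h1⟩]

/-- A filter in terms of a predicate on tuples. -/
theorem rel_keepIf {keep : ℕ → SymTuple → Formula} {θ : Tuple → Bool}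
    (hlen : T'.length = T.length) (h : (keepIf A keep T T').eval I = true)
    (hθ : ∀ i, ∀ t ∈ T, I.del t = false →
      ((keep i t).eval I = true ↔ θ (I.row A t) = true)) :
    I.rel A T' = (I.rel A T).filter θ := by
  rw [Interp.filter_rel]
  refine Interp.rel_eq_of_slots hlen (fun i hi => ?_)
  have hi' : i < T.length := by omega
  rw [Interp.slots_eq hi']
  have h := eval_conjZip.1 h i hi' hi
  rw [eval_and, eval_imp, eval_imp, eval_not, eval_del] at h
  -- On a deleted tuple `hθ` says nothing about `keep`, but `tupEq` copies the deletion, so both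
  -- branches leave the slot empty.
  by_cases hk : (keep i T[i]).eval I = true
  · rw [Interp.slot_congr (h.1 hk)]
    cases hd : I.del T[i]
    · rw [Interp.slot_of_not_del hd]
      simp [Option.filter_some, (hθ i _ (List.getElem_mem _) hd).1 hk]
    · simp [Interp.slot_of_del hd]
  · rw [Interp.slot_of_del (h.2 hk)]
    cases hd : I.del T[i]
    · rw [Interp.slot_of_not_del hd]
      have := mt (hθ i _ (List.getElem_mem _) hd).2 hk
      simp [Option.filter_some, this]
    · simp [Interp.slot_of_del hd]

/-- Stated for a single position because outer joins ask whether an individual tuple `t''ᵢⱼ` of the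
inner join is deleted. -/
theorem slot_filterF {φ : SymTuple → Term} {θ : Tuple → Bool}
    (h : (filterF A φ T T').eval I = true)
    (hθ : ∀ t, I.del t = false → ((φ t).eval I = .bool true ↔ θ (I.row A t) = true))
    {i : ℕ} (hi : i < T.length) (hi' : i < T'.length) :
    I.slot A T'[i] = (I.slot A T[i]).filter θ := by
  have h := eval_conjZip.1 h i hi hi'
  rw [eval_and, eval_imp, eval_imp, eval_and, eval_or, eval_not, eval_del, eval_del, eval_notDel,
    eval_isTrueF] at h
  cases hd : I.del T[i]
  · by_cases hk : (φ T[i]).eval I = .bool true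
    · rw [Interp.slot_congr (h.1 ⟨hd, hk⟩), Interp.slot_of_not_del hd]
      simp [Option.filter_some, (hθ _ hd).1 hk]
    · rw [Interp.slot_of_del (h.2 (Or.inr hk)), Interp.slot_of_not_del hd]
      have := mt (hθ _ hd).2 hk
      simp [Option.filter_some, this]
  · rw [Interp.slot_of_del (h.2 (Or.inl hd)), Interp.slot_of_del hd]; rfl

theorem rel_filterF {φ : SymTuple → Term} {θ : Tuple → Bool}
    (hlen : T'.length = T.length) (h : (filterF A φ T T').eval I = true)
    (hθ : ∀ t, I.del t = false → ((φ t).eval I = .bool true ↔ θ (I.row A t) = true)) :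
    I.rel A T' = (I.rel A T).filter θ := by
  rw [Interp.filter_rel]
  refine Interp.rel_eq_of_slots hlen (fun i hi => ?_)
  rw [Interp.slots_eq (hlen ▸ hi), slot_filterF h hθ]

/-- Operators that treat every tuple separately. -/
theorem rel_map {B : List AttrName} {f : Tuple → Tuple} (hlen : T'.length = T.length)
    (hdel : ∀ i (h : i < T.length) (h' : i < T'.length), I.del T'[i] = I.del T[i])
    (hf : ∀ i (h : i < T.length) (h' : i < T'.length), I.del T[i] = false →
      I.row B T'[i] = f (I.row A T[i])) :
    I.rel B T' = (I.rel A T).map f := by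
  rw [Interp.rel_eq_collect I A, map_collect]
  refine Interp.rel_eq_of_slots hlen (fun i hi => ?_)
  have hi' : i < T.length := by omega
  rw [Interp.slots_eq hi', Interp.slot, Interp.slot, hdel i hi' hi]
  cases hd : I.del T[i]
  · simp [hf i hi' hi hd]
  · simp

theorem rel_renameF (ren : AttrName → AttrName) (hlen : T'.length = T.length)
    (h : (conjZip (fun _ t t' => tupEq (A.map ren) A t' t) T T').eval I = true) :
    I.rel (A.map ren) T' = (I.rel A T).map (fun x => x.map (fun av => (ren av.1, av.2))) := by
  have h := fun i h1 h2 => (eval_tupEq (by simp)).1 (eval_conjZip.1 h i h1 h2)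
  refine rel_map hlen (fun i h1 h2 => (h i h1 h2).2) (fun i h1 h2 _ => ?_)
  rw [Interp.row_eq_zip, (h i h1 h2).1]
  simp only [Interp.row, Interp.vals, List.map_map, List.zip_map', Function.comp_def]

theorem rel_unionAllF (hlen : T'.length = T₁.length + T₂.length)
    (h : (unionAllF A T₁ T₂ T').eval I = true) :
    I.rel A T' = I.rel A T₁ ++ I.rel A T₂ := by
  have h := fun i h1 h2 => (eval_tupEq rfl).1 (eval_conjZip.1 h i h1 h2)
  rw [← Interp.rel_append, ← List.map_id (I.rel A (T₁ ++ T₂))]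
  refine rel_map (by simpa using hlen) (fun i h1 h2 => (h i h1 h2).2) (fun i h1 h2 _ => ?_)
  exact Interp.row_eq_row_iff.2 (h i h1 h2).1

theorem rel_dedupF (hlen : T'.length = T.length) (h : (dedupF A T T').eval I = true) :
    I.rel A T' = dedup (I.rel A T) := by
  rw [Interp.rel_eq_collect I A T, dedup_collect]
  refine Interp.rel_eq_of_slots hlen (fun i hi => ?_)
  have hi' : i < T.length := by omega
  have h := eval_conjZip.1 h i hi' hi
  rw [eval_and, eval_imp, eval_imp, eval_not, eval_del] at h
  rw [Interp.slots_eq hi']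
  cases hd : I.del T[i]
  · have hmem : (memF A T[i] (T.take i)).eval I = true ↔
        ∃ k < i, I.slots A T k = I.slot A T[i] := by
      rw [eval_memF_of_not_del hd, Interp.slot_of_not_del hd, Interp.rel_eq_collect, mem_collect]
      simp only [List.length_take, Nat.min_eq_left hi'.le]
      refine exists_congr (fun k => and_congr_right (fun hk => ?_))
      simp [Interp.slots, hk]
    rw [hmem] at h
    split_ifs with hc
    · exact Interp.slot_of_del (h.1 hc)
    · exact Interp.slot_congr (h.2 hc)
  -- A deleted tuple produces a deleted one either way: as a duplicate of an earlier deleted tuple,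
  -- or by being copied.
  · rw [Interp.slot_of_del hd, ite_self, Interp.slot_eq_none_iff]
    by_cases hc : (memF A T[i] (T.take i)).eval I = true
    · exact h.1 hc
    · rw [((eval_tupEq rfl).1 (h.2 hc)).2, hd]

/-- An instance of `bagDiff_collect` for `Paired`. Deleted tuples can be paired with each other too,
but only if their values agree; so eligibility `E` implies equality of slots, and conversely only
where the slots are defined. -/
theorem rel_diffAllF {p : Label} {tag : ℕ} (hlen : T'.length = T₁.length)
    (h : (diffAllF p tag A T₁ T₂ T').eval I = true) :
    I.rel A T' = bagDiff (I.rel A T₁) (I.rel A T₂) := by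
  simp only [diffAllF, eval_and, eval_conjL_zipIdx, eval_conjZip, eval_iff, eval_imp, eval_or,
    eval_conjL_range, eval_disjL_range, eval_not, eval_paired, eval_del, eval_notDel,
    eval_tupEq rfl] at h
  obtain ⟨hP, hT'⟩ := h
  rw [Interp.rel_eq_collect I A T₁, Interp.rel_eq_collect I A T₂,
    bagDiff_collect (P := fun i j => I.paired p tag i j = true)
      (E := fun i j => ∃ (h : i < T₁.length) (h' : j < T₂.length),
        I.vals A T₁[i] = I.vals A T₂[j] ∧ I.del T₁[i] = I.del T₂[j])]
  · refine Interp.rel_eq_of_slots hlen (fun i hi => ?_)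
    have hi' : i < T₁.length := by omega
    have h := hT' i hi' hi
    rw [Interp.slots_eq hi']
    split_ifs with hc
    · exact Interp.slot_of_del (h.2 (Or.inr hc))
    · cases hd : I.del T₁[i]
      · refine Interp.slot_congr ((eval_tupEq rfl).2 (h.1 ⟨hd, fun j hj hj' => hc ⟨j, hj, hj'⟩⟩))
      · rw [Interp.slot_of_del hd, Interp.slot_of_del (h.2 (Or.inl hd))]
  · intro i hi j hj
    rw [hP i hi j hj]
    simp [hi, hj]
  · rintro i hi j hj ⟨_, _, h1, h2⟩
    rw [Interp.slots_eq hi, Interp.slots_eq hj]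
    exact Interp.slot_congr ((eval_tupEq rfl).2 ⟨h1, h2⟩)
  · intro i hi j hj x hx hy
    rw [Interp.slots_eq hi, Interp.slot_eq_some_iff] at hx
    rw [Interp.slots_eq hj, Interp.slot_eq_some_iff] at hy
    exact ⟨hi, hj, Interp.row_eq_row_iff.1 (hx.2.trans hy.2.symm), hx.1.trans hy.1.symm⟩

/-! ## Products and joins -/

theorem getElem?_product {α β : Type*} (xs : List α) (ys : List β) {i j : ℕ} (hi : i < xs.length)
    (hj : j < ys.length) : (xs.product ys)[i * ys.length + j]? = some (xs[i], ys[j]) := by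
  induction xs generalizing i with
  | nil => simp at hi
  | cons x xs ih =>
    rw [show (x :: xs).product ys = ys.map (fun b => (x, b)) ++ xs.product ys from rfl]
    cases i with
    | zero =>
      rw [List.getElem?_append_left (by simpa using hj)]
      simp [hj]
    | succ i =>
      rw [List.getElem?_append_right (by simp; nlinarith)]
      have : (i + 1) * ys.length + j - (ys.map (fun b => (x, b))).length = i * ys.length + j := by
        rw [List.length_map, Nat.succ_mul]; omega
      rw [this, ih (by simpa using hi)]
      simp

/-- The concatenation of two rows that are both present. -/
def pairSlot (o o' : Option Tuple) : Option Tuple := o.bind (fun x => o'.map (fun y => x ++ y))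

theorem index_lt_mul {n m i j : ℕ} (hi : i < n) (hj : j < m) : i * m + j < n * m := by
  calc i * m + j < i * m + m := by omega
    _ = (i + 1) * m := by ring
    _ ≤ n * m := Nat.mul_le_mul_right _ hi

/-- The values of both operands are imposed on one tuple. If the operands share an attribute name,
both equations hold for it, so the row can be read off by position without any disjointness. -/
theorem slot_prodF {p : Label} {tag : ℕ}
    (h : (prodF A₁ A₂ T₁ T₂ (sigma p tag (T₁.length * T₂.length))).eval I = true)
    {i j : ℕ} (hi : i < T₁.length) (hj : j < T₂.length) :
    I.slot (A₁ ++ A₂) (.fresh p tag (i * T₂.length + j)) =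
      pairSlot (I.slot A₁ T₁[i]) (I.slot A₂ T₂[j]) := by
  have hlt := index_lt_mul hi hj
  have hg := getElem?_product T₁ T₂ hi hj
  rw [List.getElem?_eq_some_iff] at hg
  obtain ⟨hlt', hg⟩ := hg
  have h := eval_conjL_zipWith.1 h (i * T₂.length + j) hlt' (by rwa [length_sigma])
  rw [hg, getElem_sigma] at h
  simp only [eval_and, eval_imp, eval_or, eval_notDel, eval_del,
    eval_attrsAre (A := A₁) (vs := attrsOf A₁ T₁[i]) (by simp [attrsOf]),
    eval_attrsAre (A := A₂) (vs := attrsOf A₂ T₂[j]) (by simp [attrsOf]),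
    map_eval_attrsOf] at h
  cases hd : I.del T₁[i]
  · cases hd' : I.del T₂[j]
    · obtain ⟨h1, h2, h3⟩ := h.1 ⟨hd, hd'⟩
      rw [Interp.slot_of_not_del h1, Interp.slot_of_not_del hd, Interp.slot_of_not_del hd',
        Interp.row_append, Interp.row_eq_zip, h2, Interp.row_eq_zip, h3, ← Interp.row_eq_zip,
        ← Interp.row_eq_zip]
      rfl
    · rw [Interp.slot_of_del (h.2 (Or.inr hd')), Interp.slot_of_del hd', Interp.slot_of_not_del hd]
      rfl
  · rw [Interp.slot_of_del (h.2 (Or.inl hd)), Interp.slot_of_del hd]; rfl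

theorem filter_crossProd_collect (θ : Tuple → Bool) (s u : ℕ → Option Tuple) (n m : ℕ) :
    (crossProd (collect s n) (collect u m)).filter θ =
      (List.range n).flatMap (fun i => collect (fun j => (pairSlot (s i) (u j)).filter θ) m) := by
  unfold crossProd
  rw [flatMap_collect, List.filter_flatMap]
  congr 1
  funext i
  cases h : s i with
  | none => simp [pairSlot, collect]
  | some x => simp [pairSlot, map_collect, filter_collect]

/-- Common to product and inner join: both list the pairs `(i, j)` row by row, as `crossProd` does,
so even the order of the rows agrees. -/
theorem rel_of_slot_pairs {p : Label} {tag : ℕ} (θ : Tuple → Bool)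
    (h : ∀ i j (hi : i < T₁.length) (hj : j < T₂.length),
      I.slot (A₁ ++ A₂) (.fresh p tag (i * T₂.length + j)) =
        (pairSlot (I.slot A₁ T₁[i]) (I.slot A₂ T₂[j])).filter θ) :
    I.rel (A₁ ++ A₂) (sigma p tag (T₁.length * T₂.length)) =
      (crossProd (I.rel A₁ T₁) (I.rel A₂ T₂)).filter θ := by
  rw [Interp.rel_eq_of_slots (s := fun i => I.slot (A₁ ++ A₂) (.fresh p tag i))
    (length_sigma _ _ _) (fun i hi => by rw [getElem_sigma]), collect_mul,
    Interp.rel_eq_collect I A₁, Interp.rel_eq_collect I A₂, filter_crossProd_collect]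
  refine List.flatMap_congr (fun i hi => collect_congr (fun j hj => ?_))
  have hi := List.mem_range.1 hi
  rw [h i j hi hj, Interp.slots_eq hi, Interp.slots_eq hj]

theorem rel_prodF {p : Label} {tag : ℕ}
    (h : (prodF A₁ A₂ T₁ T₂ (sigma p tag (T₁.length * T₂.length))).eval I = true) :
    I.rel (A₁ ++ A₂) (sigma p tag (T₁.length * T₂.length)) =
      crossProd (I.rel A₁ T₁) (I.rel A₂ T₂) := by
  rw [rel_of_slot_pairs (fun _ => true) (fun i j hi hj => by
    rw [slot_prodF h hi hj]
    cases pairSlot (I.slot A₁ T₁[i]) (I.slot A₂ T₂[j]) <;> rfl)]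
  simp

theorem slot_joinF {p : Label} {φ : SymTuple → Term} {θ : Tuple → Bool}
    (h : (joinF p A₁ A₂ φ T₁ T₂).eval I = true)
    (hθ : ∀ t, I.del t = false → ((φ t).eval I = .bool true ↔ θ (I.row (A₁ ++ A₂) t) = true))
    {i j : ℕ} (hi : i < T₁.length) (hj : j < T₂.length) :
    I.slot (A₁ ++ A₂) (.fresh p 0 (i * T₂.length + j)) =
      (pairSlot (I.slot A₁ T₁[i]) (I.slot A₂ T₂[j])).filter θ := by
  obtain ⟨h1, h2⟩ := eval_and.1 h
  have hlt := index_lt_mul hi hj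
  have := slot_filterF h2 hθ (i := i * T₂.length + j) (by rwa [length_sigma])
    (by rwa [length_sigma])
  rw [getElem_sigma, getElem_sigma] at this
  rw [this, slot_prodF h1 hi hj]

theorem rel_joinF {p : Label} {φ : SymTuple → Term} {θ : Tuple → Bool}
    (h : (joinF p A₁ A₂ φ T₁ T₂).eval I = true)
    (hθ : ∀ t, I.del t = false → ((φ t).eval I = .bool true ↔ θ (I.row (A₁ ++ A₂) t) = true)) :
    I.rel (A₁ ++ A₂) (sigma p 0 (T₁.length * T₂.length)) =
      (crossProd (I.rel A₁ T₁) (I.rel A₂ T₂)).filter θ :=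
  rel_of_slot_pairs θ (fun _ _ hi hj => slot_joinF h hθ hi hj)

theorem length_eq_zero_iff_forall_not_mem {α : Type*} {xs : List α} :
    xs.length = 0 ↔ ∀ x, x ∉ xs := by
  rw [List.length_eq_zero_iff, List.eq_nil_iff_forall_not_mem]

theorem Interp.vals_eq_null {A : List AttrName} {t : SymTuple}
    (h : I.vals A t = (A.map (fun _ => nullT)).map (Term.eval I)) :
    I.row A t = nullTuple A := by
  rw [Interp.row_eq_zip, h, nullTuple, List.map_map]
  simp only [Function.comp_def, eval_nullT]
  rw [List.zip_map_right, List.zip_eq_zipWith, List.zipWith_self, List.map_map]; rfl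

/-- By `hslot`, all `t''ᵢⱼ` in row `i` being deleted means that a present `tᵢ` has no partner, which
is the condition for a row to enter `leftPads`. -/
theorem rel_leftPadF {p : Label} {tag : ℕ} {θ : Tuple → Bool}
    (hslot : ∀ i j (hi : i < T₁.length) (hj : j < T₂.length),
      I.slot (A₁ ++ A₂) (.fresh p 0 (i * T₂.length + j)) =
        (pairSlot (I.slot A₁ T₁[i]) (I.slot A₂ T₂[j])).filter θ)
    (h : (leftPadF p A₁ A₂ T₂.length T₁ (sigma p tag T₁.length)).eval I = true) :
    I.rel (A₁ ++ A₂) (sigma p tag T₁.length) = leftPads θ A₂ (I.rel A₁ T₁) (I.rel A₂ T₂) := by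
  unfold leftPads
  rw [Interp.filter_rel, map_collect]
  refine Interp.rel_eq_of_slots (length_sigma _ _ _) (fun i hi => ?_)
  have hi' : i < T₁.length := by rwa [length_sigma] at hi
  have h := eval_conjZip.1 h i hi' hi
  simp only [eval_and, eval_iff, eval_notDel, eval_conjL_range, eval_del,
    eval_attrsAre (A := A₁) (vs := attrsOf A₁ T₁[i]) (by simp [attrsOf]),
    eval_attrsAre (A := A₂) (vs := A₂.map (fun _ => nullT)) (by simp),
    map_eval_attrsOf] at h
  obtain ⟨⟨h1, h2⟩, h3⟩ := h
  rw [Interp.slots_eq hi']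
  cases hd : I.del T₁[i]
  · have hc : (∀ j < T₂.length, I.del (.fresh p 0 (i * T₂.length + j)) = true) ↔
        ((crossProd [I.row A₁ T₁[i]] (I.rel A₂ T₂)).filter θ).length = 0 := by
      rw [length_eq_zero_iff_forall_not_mem, Interp.rel_eq_collect]
      simp only [crossProd, List.flatMap_singleton, map_collect, filter_collect, mem_collect,
        not_exists, not_and]
      rw [forall_comm]
      refine forall_congr' (fun j => ?_)
      rw [forall_comm]
      refine forall_congr' (fun hj => ?_)
      rw [← Interp.slot_eq_none_iff (A := A₁ ++ A₂), hslot i j hi' hj, Interp.slots_eq hj,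
        Interp.slot_of_not_del hd, Option.eq_none_iff_forall_ne_some]
      rfl
    rw [Interp.slot_of_not_del hd, Option.filter_some]
    by_cases hz : ((crossProd [I.row A₁ T₁[i]] (I.rel A₂ T₂)).filter θ).length = 0
    · rw [Interp.slot_of_not_del (h3.1 ⟨hd, hc.2 hz⟩), decide_eq_true hz, Interp.row_append,
        Interp.vals_eq_null h2, Interp.row_eq_zip, h1, ← Interp.row_eq_zip]
      rfl
    · rw [Interp.slot_of_del, decide_eq_false hz]
      · rfl
      · by_contra hdel
        exact hz (hc.1 (h3.2 (by simpa using hdel)).2)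
  · rw [Interp.slot_of_del hd, Interp.slot_of_del]
    · rfl
    · by_contra hdel
      have := (h3.2 (by simpa using hdel)).1
      simp [hd] at this

/-- The mirror image, with column `j` (the positions `i * m + j` for varying `i`) in place of a row.
-/
theorem rel_rightPadF {p : Label} {tag : ℕ} {θ : Tuple → Bool}
    (hslot : ∀ i j (hi : i < T₁.length) (hj : j < T₂.length),
      I.slot (A₁ ++ A₂) (.fresh p 0 (i * T₂.length + j)) =
        (pairSlot (I.slot A₁ T₁[i]) (I.slot A₂ T₂[j])).filter θ)
    (h : (rightPadF p A₁ A₂ T₁.length T₂.length T₂ (sigma p tag T₂.length)).eval I = true) :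
    I.rel (A₁ ++ A₂) (sigma p tag T₂.length) = rightPads θ A₁ (I.rel A₁ T₁) (I.rel A₂ T₂) := by
  unfold rightPads
  rw [Interp.filter_rel, map_collect]
  refine Interp.rel_eq_of_slots (length_sigma _ _ _) (fun j hj => ?_)
  have hj' : j < T₂.length := by rwa [length_sigma] at hj
  have h := eval_conjZip.1 h j hj' hj
  simp only [eval_and, eval_iff, eval_notDel, eval_conjL_range, eval_del,
    eval_attrsAre (A := A₂) (vs := attrsOf A₂ T₂[j]) (by simp [attrsOf]),
    eval_attrsAre (A := A₁) (vs := A₁.map (fun _ => nullT)) (by simp),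
    map_eval_attrsOf] at h
  obtain ⟨⟨h1, h2⟩, h3⟩ := h
  rw [Interp.slots_eq hj']
  cases hd : I.del T₂[j]
  · have hc : (∀ i < T₁.length, I.del (.fresh p 0 (i * T₂.length + j)) = true) ↔
        ((crossProd (I.rel A₁ T₁) [I.row A₂ T₂[j]]).filter θ).length = 0 := by
      rw [length_eq_zero_iff_forall_not_mem, Interp.rel_eq_collect]
      simp only [crossProd, List.map_cons, List.map_nil]
      rw [← List.map_eq_flatMap, map_collect, filter_collect]
      simp only [mem_collect, not_exists, not_and]
      rw [forall_comm]
      refine forall_congr' (fun i => ?_)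
      rw [forall_comm]
      refine forall_congr' (fun hi => ?_)
      rw [← Interp.slot_eq_none_iff (A := A₁ ++ A₂), hslot i j hi hj', Interp.slots_eq hi,
        Interp.slot_of_not_del hd, Option.eq_none_iff_forall_ne_some]
      cases I.slot A₁ T₁[i] <;> rfl
    rw [Interp.slot_of_not_del hd, Option.filter_some]
    by_cases hz : ((crossProd (I.rel A₁ T₁) [I.row A₂ T₂[j]]).filter θ).length = 0
    · rw [Interp.slot_of_not_del (h3.1 ⟨hd, hc.2 hz⟩), decide_eq_true hz, Interp.row_append,
        Interp.vals_eq_null h1, Interp.row_eq_zip I A₂, h2, ← Interp.row_eq_zip]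
      rfl
    · rw [Interp.slot_of_del, decide_eq_false hz]
      · rfl
      · by_contra hdel
        exact hz (hc.1 (h3.2 (by simpa using hdel)).2)
  · rw [Interp.slot_of_del hd, Interp.slot_of_del]
    · rfl
    · by_contra hdel
      have := (h3.2 (by simpa using hdel)).1
      simp [hd] at this

/-! ## Groups -/

/-- The rows of the symbolic tuples that are present. -/
def Interp.condRel (I : Interp) (A : List AttrName) (T : List CondTuple) : Relation :=
  (T.filter (fun c => c.1.eval I)).map (fun c => I.row A c.2)

theorem Interp.condRel_present (I : Interp) (A : List AttrName) (T : List SymTuple) :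
    I.condRel A (present T) = I.rel A T := by
  simp only [Interp.condRel, present, List.filter_map, List.map_map, Interp.rel]
  congr 1

theorem Interp.condRel_present_singleton {t : SymTuple} (h : I.del t = false) :
    I.condRel A (present [t]) = [I.row A t] := by
  simp [Interp.condRel, present, eval_notDel.2 h]

/-- Makes the sum in `groupF` a cardinality, so that the values `0` and `1` mean that the tuple
belongs to no group or to exactly one. -/
theorem foldl_add_indicator (b : ℕ → Bool) (n : ℕ) :
    ((List.range n).map (fun j => if b j = true then Value.int 1 else Value.int 0)).foldl
      ArithOp.add.apply (.int 0) = .int ((Finset.range n).filter (fun j => b j = true)).card := by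
  induction n with
  | zero => rfl
  | succ n ih =>
    rw [List.range_succ, List.map_append, List.foldl_append, ih, Finset.range_add_one,
      Finset.filter_insert]
    cases h : b n <;> simp [h, ArithOp.apply]

/-- `t` is the first tuple of a group. -/
def Leads (I : Interp) (key : SymTuple → List Term) (T : List SymTuple) (i : ℕ) : Prop :=
  ∃ h : i < T.length, I.del T[i] = false ∧ ∀ k (hk : k < i), I.del T[k] = false →
    (key T[k]).map (Term.eval I) ≠ (key T[i]).map (Term.eval I)

theorem eval_conjL_eq {ss ts : List Term} (h : ss.length = ts.length) :
    (conjL (List.zipWith Formula.eq ss ts)).eval I = true ↔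
      ss.map (Term.eval I) = ts.map (Term.eval I) := by
  rw [eval_conjL_zipWith, List.ext_getElem_iff]
  simp [eval_eq, h]

/-- For `j < i`, the formula reduces `g(tᵢ, j)` to `g(tⱼ, j)`, and the sum then determines `g(tᵢ,
i)`: a present tuple is in exactly one group, so it opens its own iff no earlier group takes it. By
strong induction, groups are opened exactly by the tuples that come first with their key. -/
theorem grp_iff {p : Label} {key : SymTuple → List Term}
    (hkey : ∀ t t', (key t).length = (key t').length)
    (h : (groupF p key T).eval I = true) (i : ℕ) (hi : i < T.length) (j : ℕ) (hj : j ≤ i) :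
    I.grp p T[i] j = true ↔ I.del T[i] = false ∧ Leads I key T j ∧
      (key T[i]).map (Term.eval I) = (key (T[j]'(by omega))).map (Term.eval I) := by
  have h' : ∀ i (hi : i < T.length),
      ((Finset.range (i + 1)).filter (fun j => I.grp p T[i] j = true)).card =
        (if I.del T[i] = true then 0 else 1) ∧
      ∀ j (hj : j < i), (I.grp p T[i] j = true ↔ I.del T[i] = false ∧ I.grp p T[j] j = true ∧
        (key T[i]).map (Term.eval I) = (key T[j]).map (Term.eval I)) := by
    intro i hi
    have h := eval_conjL_zipIdx.1 h i hi
    rw [eval_and, eval_conjL_zipIdx, eval_eq, eval_foldl_arith, List.map_map] at h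
    refine ⟨?_, fun j hj => ?_⟩
    · have h1 := h.1
      simp only [Function.comp_def, Term.eval, eval_grp, eval_del, foldl_add_indicator] at h1
      split_ifs at h1 ⊢ with hd
      · simpa using h1
      · simpa using h1
    · have h2 := h.2 j (by simp; omega)
      simpa [eval_iff, eval_and, eval_grp, eval_notDel, eval_conjL_eq (hkey _ _)] using h2
  have hlead : ∀ i (hi : i < T.length), I.grp p T[i] i = true ↔ Leads I key T i := by
    intro i
    induction i using Nat.strong_induction_on with
    | _ i ih =>
      intro hi
      obtain ⟨hsum, hlt⟩ := h' i hi
      have hlt' : ∀ j (hj : j < i), (I.grp p T[i] j = true ↔ I.del T[i] = false ∧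
          Leads I key T j ∧
          (key T[i]).map (Term.eval I) = (key T[j]).map (Term.eval I)) := by
        intro j hj
        rw [hlt j hj, ih j hj (by omega)]
      rw [Finset.range_add_one, Finset.filter_insert] at hsum
      cases hd : I.del T[i]
      -- The number of groups is `1`; the index `j = i` is split off from the earlier ones.
      · have hcount : I.grp p T[i] i = true ↔ ∀ j < i, ¬ I.grp p T[i] j = true := by
          rw [hd, if_neg Bool.false_ne_true] at hsum
          by_cases hg : I.grp p T[i] i = true
          · rw [if_pos hg, Finset.card_insert_of_notMem (by simp)] at hsum
            simp only [Nat.add_eq_right, Finset.card_eq_zero,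
              Finset.filter_eq_empty_iff, Finset.mem_range] at hsum
            exact ⟨fun _ j hj => hsum hj, fun _ => hg⟩
          · refine ⟨fun hg' => absurd hg' hg, fun hn => ?_⟩
            rw [if_neg hg, Finset.filter_eq_empty_iff.2 (fun j hj => hn j (Finset.mem_range.1 hj))] at hsum
            simp at hsum
        rw [hcount]
        constructor
        · intro hn
          refine ⟨hi, hd, fun k => ?_⟩
          induction k using Nat.strong_induction_on with
          | _ k ihk =>
            intro hk hdk heq
            -- An earlier `k` with the same key would lead a group containing `tᵢ`, because the
            -- inner induction excludes a still earlier tuple with that key.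
            refine hn k hk ((hlt' k hk).2 ⟨hd, ⟨by omega, hdk, fun l hl hdl hl' => ?_⟩, heq.symm⟩)
            exact ihk l hl (by omega) hdl (hl'.trans heq)
        · rintro ⟨_, _, hn⟩ j hj hg
          obtain ⟨_, ⟨_, hdj, _⟩, heq⟩ := (hlt' j hj).1 hg
          exact hn j hj hdj heq.symm
      · rw [hd] at hsum
        have hg : ¬ I.grp p T[i] i = true := by
          intro hg
          rw [if_pos hg, Finset.card_insert_of_notMem (by simp)] at hsum
          simp at hsum
        refine iff_of_false hg ?_
        rintro ⟨_, hd', _⟩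
        simp [hd] at hd'
  rcases Nat.lt_or_eq_of_le hj with hj | rfl
  · rw [(h' i hi).2 j hj, hlead j (by omega)]
  · rw [hlead j hi]
    constructor
    · intro hl
      exact ⟨hl.2.1, hl, rfl⟩
    · exact fun hl => hl.2.1

/-- Slot `i` of the result stands for the group led by `tᵢ`. A tuple leads exactly where its key
occurs first, and this is where `dedup` keeps the key, so the groups appear in the same order on
both sides. The assumptions on `φ` and `vals` concern nonempty groups only, since attributes are
read off a first tuple. -/
theorem rel_groupBy {p : Label} {B : List AttrName} {keyT : SymTuple → List Term}
    {φ : List CondTuple → Term} {vals : List CondTuple → List Term}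
    {key : Tuple → List Value} {θ : Relation → Bool} {val : Relation → Tuple}
    (hlen : T'.length = T.length)
    (hkeylen : ∀ t t', (keyT t).length = (keyT t').length)
    (hkey : ∀ t, I.del t = false → (keyT t).map (Term.eval I) = key (I.row A t))
    (hvlen : ∀ g, (vals g).length = B.length)
    (hθ : ∀ g, I.condRel A g ≠ [] →
      ((φ g).eval I = .bool true ↔ θ (I.condRel A g) = true))
    (hval : ∀ g, I.condRel A g ≠ [] →
      val (I.condRel A g) = B.zip ((vals g).map (Term.eval I)))
    (hg : (groupF p keyT T).eval I = true)
    (hr : (reduceF p B φ vals T T').eval I = true) :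
    I.rel B T' = ((groups key (I.rel A T)).filter θ).map val := by
  unfold groups
  rw [Interp.rel_eq_collect I A T, map_collect, dedup_collect, map_collect, filter_collect,
    map_collect, ← Interp.rel_eq_collect]
  refine Interp.rel_eq_of_slots hlen (fun i hi => ?_)
  have hi' : i < T.length := by omega
  have hr := eval_conjZip.1 hr i hi' hi
  simp only [eval_and, eval_imp, eval_or, eval_not, eval_grp, eval_isTrueF, eval_del, eval_notDel,
    eval_attrsAre (hvlen _), grp_iff hkeylen hg i hi' i le_rfl] at hr
  have hlead : Leads I keyT T i ↔ I.del T[i] = false ∧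
      ¬ ∃ k < i, (I.slots A T k).map key = (I.slots A T i).map key := by
    constructor
    · rintro ⟨_, hd, hn⟩
      refine ⟨hd, ?_⟩
      rintro ⟨k, hk, heq⟩
      rw [Interp.slots_eq (by omega), Interp.slots_eq hi', Interp.slot_of_not_del hd] at heq
      cases hdk : I.del T[k]
      · rw [Interp.slot_of_not_del hdk, Option.map_some, Option.map_some, Option.some.injEq,
          ← hkey _ hd, ← hkey _ hdk] at heq
        exact hn k hk hdk heq
      · simp [Interp.slot_of_del hdk] at heq
    · rintro ⟨hd, hn⟩
      refine ⟨hi', hd, fun k hk hdk heq => hn ⟨k, hk, ?_⟩⟩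
      rw [hkey _ hd, hkey _ hdk] at heq
      rw [Interp.slots_eq (by omega), Interp.slots_eq hi', Interp.slot_of_not_del hd,
        Interp.slot_of_not_del hdk, Option.map_some, Option.map_some, heq]
  by_cases hl : Leads I keyT T i
  · obtain ⟨hd, hn⟩ := hlead.1 hl
    -- No present tuple before the leader has its key, so restricting to the positions from `i` on
    -- loses nothing.
    have hgroup : (I.rel A T).filter (fun x => decide (key x = key (I.row A T[i]))) =
        I.condRel A (groupTuples p T i) := by
      have h1 : I.rel A T = I.rel A (T.take i) ++ I.rel A (T.drop i) := by
        rw [← Interp.rel_append, List.take_append_drop]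
      have h2 : (I.rel A (T.take i)).filter
          (fun x => decide (key x = key (I.row A T[i]))) = [] := by
        rw [List.filter_eq_nil_iff]
        intro x hx
        obtain ⟨t, ht, hdt, rfl⟩ := Interp.mem_rel.1 hx
        obtain ⟨k, hk, rfl⟩ := List.mem_iff_getElem.1 ht
        rw [List.length_take] at hk
        rw [List.getElem_take] at hdt ⊢
        have := hl.2.2 k (by omega) hdt
        rw [hkey _ hdt, hkey _ hd] at this
        simpa using this
      rw [h1, List.filter_append, h2, List.nil_append]
      unfold Interp.rel Interp.condRel groupTuples
      rw [List.filter_map, List.filter_map, List.map_map, List.filter_filter]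
      refine congrArg₂ _ rfl (List.filter_congr (fun t ht => ?_))
      obtain ⟨k, hk, rfl⟩ := List.mem_iff_getElem.1 ht
      rw [List.length_drop] at hk
      rw [List.getElem_drop]
      rw [Bool.eq_iff_iff]
      simp only [Function.comp_apply, eval_grp,
        grp_iff hkeylen hg (i + k) (by omega) i (by omega), hl, true_and, Bool.and_eq_true,
        decide_eq_true_eq, Bool.not_eq_true']
      rw [and_comm]
      refine and_congr_right (fun hdk => ?_)
      rw [hkey _ hdk, hkey _ hd]; rfl
    have hne : I.condRel A (groupTuples p T i) ≠ [] := by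
      rw [← hgroup]
      refine List.ne_nil_of_mem (a := I.row A T[i]) (List.mem_filter.2 ⟨?_, by simp⟩)
      exact Interp.mem_rel.2 ⟨_, List.getElem_mem _, hd, rfl⟩
    rw [if_neg hn, Interp.slots_eq hi', Interp.slot_of_not_del hd, Option.map_some,
      Option.map_some, hgroup, Option.filter_some]
    by_cases hφ : (φ (groupTuples p T i)).eval I = .bool true
    · obtain ⟨h1, h2⟩ := hr.1 ⟨⟨hd, hl, trivial⟩, hφ⟩
      rw [if_pos ((hθ _ hne).1 hφ), Option.map_some, hval _ hne, Interp.slot_of_not_del h1,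
        Interp.row_eq_zip, h2]
    · rw [if_neg (mt (hθ _ hne).2 hφ), Interp.slot_of_del (hr.2 (Or.inr hφ)), Option.map_none]
  · rw [Interp.slot_of_del (hr.2 (Or.inl (fun h => hl h.2.1)))]
    cases hd : I.del T[i]
    · have hn : ∃ k < i, (I.slots A T k).map key = (I.slots A T i).map key := by
        by_contra hn
        exact hl (hlead.2 ⟨hd, hn⟩)
      rw [if_pos hn]; rfl
    · rw [Interp.slots_eq hi', Interp.slot_of_del hd]
      simp

end Operators

/-! # Agreement of concrete and symbolic relations -/

/-- Equal as bags and, provided that `b` holds, also as lists. -/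
def Agree {α : Type*} (b : Prop) (xs ys : List α) : Prop := xs.Perm ys ∧ (b → xs = ys)

theorem Agree.mono {α : Type*} {b c : Prop} {xs ys : List α} (h : Agree b xs ys) (hc : c → b) :
    Agree c xs ys := ⟨h.1, fun h' => h.2 (hc h')⟩

theorem Agree.congr {α β : Type*} {b : Prop} {xs ys : List α} (h : Agree b xs ys)
    (f : List α → List β) (hf : xs.Perm ys → (f xs).Perm (f ys)) : Agree b (f xs) (f ys) :=
  ⟨hf h.1, fun h' => congrArg f (h.2 h')⟩

theorem Agree.congr₂ {α β γ : Type*} {b c : Prop} {xs ys : List α} {xs' ys' : List β}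
    (h : Agree b xs ys) (h' : Agree c xs' ys') (f : List α → List β → List γ)
    (hf : xs.Perm ys → xs'.Perm ys' → (f xs xs').Perm (f ys ys')) :
    Agree (b ∧ c) (f xs xs') (f ys ys') :=
  ⟨hf h.1 h'.1, fun hb => by rw [h.2 hb.1, h'.2 hb.2]⟩

/-- The database `D` agrees with the interpretation of the symbolic database `Γ`. -/
def Interp.Models (I : Interp) (b : Prop) (S : Schema) (Γ : SymDB) (D : Database) : Prop :=
  ∀ R A T, S R = some A → Γ R = some T → Agree b (D R) (I.rel A T)

theorem Interp.models_db (I : Interp) (S : Schema) (Γ : SymDB) :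
    I.Models True S Γ (I.db S Γ) := by
  intro R A T hA hT
  simp only [Interp.db, hA, hT]
  exact ⟨List.Perm.refl _, fun _ => rfl⟩

theorem Interp.Models.update {I : Interp} {b : Prop} {S : Schema} {Γ : SymDB} {D : Database}
    (h : I.Models b S Γ D) {R : RelName} {A : List AttrName} {T : List SymTuple} {r : Relation}
    (hr : Agree b r (I.rel A T)) :
    I.Models b (Function.update S R (some A)) (Function.update Γ R (some T))
      (Function.update D R r) := by
  intro R' A' T' hA hT
  by_cases hR : R' = R
  · subst hR
    simp only [Function.update_self, Option.some.injEq] at hA hT ⊢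
    subst hA hT
    exact hr
  · rw [Function.update_of_ne hR] at hA hT ⊢
    exact h R' A' T' hA hT

/-! # Reading off attributes -/

theorem Interp.lookup_row {I : Interp} {A : List AttrName} {t : SymTuple} {a : AttrName}
    (h : a ∈ A) : (I.row A t).lookup a = some (I.attr a t) := by
  induction A with
  | nil => simp at h
  | cons b A ih =>
    simp only [Interp.row, List.map_cons, List.lookup_cons] at ih ⊢
    by_cases hab : a = b
    · simp [hab]
    · have hf : (a == b) = false := by simpa using hab
      rw [hf]
      exact ih (by simpa [hab] using h)

theorem Interp.condRel_cons (I : Interp) (A : List AttrName) (c : CondTuple)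
    (T : List CondTuple) :
    I.condRel A (c :: T) =
      if c.1.eval I = true then I.row A c.2 :: I.condRel A T else I.condRel A T := by
  simp only [Interp.condRel, List.filter_cons]
  split_ifs <;> rfl

/-- The last alternative in `first` is not guarded by its condition. If some tuple is present this
is sound, for then the last one is reached only when it is present; otherwise the term may read an
absent tuple where the semantics gives `Null`. -/
theorem eval_first {I : Interp} {A : List AttrName} {a : AttrName} (ha : a ∈ A) :
    (T : List CondTuple) → I.condRel A T ≠ [] →
      lookupHead (I.condRel A T) a = (first a T).eval I
  | [], h => (h rfl).elim
  | [c], h => by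
      rw [Interp.condRel_cons] at h ⊢
      split_ifs at h ⊢ with hc
      · simp [lookupHead, Interp.lookup_row ha, first, Term.eval]
      · exact (h rfl).elim
  | c :: c' :: T, h => by
      rw [Interp.condRel_cons] at h ⊢
      rw [first, Term.eval]
      · split_ifs at h ⊢ with hc
        · simp [lookupHead, Interp.lookup_row ha, Term.eval]
        · exact eval_first ha (c' :: T) h
      · simp

/-! # Lengths of encoded vectors -/

theorem length_encEs {N : Naming} {S : Schema} {Γ : SymDB} {T : List CondTuple} :
    (p : Label) → (Es : ExprList) → (encEs N S Γ p T Es).length = Es.length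
  | _, .nil => by simp [encEs, ExprList.length]
  | p, .cons E Es => by simp [encEs, ExprList.length, length_encEs (1 :: p) Es]

theorem length_encL {N : Naming} {S : Schema} {Γ : SymDB} {T : List CondTuple} :
    (p : Label) → (L : AttrList) → (encL N S Γ p T L).length = (L.names N).length
  | _, .id A => by simp [encL, AttrList.names]
  | _, .rename a A => by simp [encL, AttrList.names]
  | p, .append L₁ L₂ => by
      simp [encL, AttrList.names, length_encL (0 :: p) L₁, length_encL (1 :: p) L₂]

/-- The encoding of a query is undefined unless its tuples are defined. In a membership test this
shows that `encP` does not fall back on the default `[]`. -/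
theorem exists_tuplesQ {N : Naming} : (Q : Query) → ∀ {S : Schema} {Γ : SymDB} {p : Label}
    {F : Formula}, encQ N S Γ p Q = some F → ∃ T, tuplesQ Γ p Q = some T
  | .rel R, S, Γ, p, F, h => by
      simp only [encQ, Option.bind_eq_bind, Option.bind_eq_some_iff] at h
      obtain ⟨T, hT, -⟩ := h
      exact ⟨T, by simp [tuplesQ, hT]⟩
  | .proj L Q, S, Γ, p, F, h => by
      simp only [encQ, Option.bind_eq_bind, Option.bind_eq_some_iff] at h
      obtain ⟨_, _, T, hT, -⟩ := h
      exact ⟨_, by simp only [tuplesQ, hT]; rfl⟩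
  | .filter φ Q, S, Γ, p, F, h => by
      simp only [encQ, Option.bind_eq_bind, Option.bind_eq_some_iff] at h
      obtain ⟨_, _, _, _, T, hT, -⟩ := h
      exact ⟨_, by simp only [tuplesQ, hT]; rfl⟩
  | .rename R Q, S, Γ, p, F, h => by
      simp only [encQ, Option.bind_eq_bind, Option.bind_eq_some_iff] at h
      obtain ⟨_, _, _, _, T, hT, -⟩ := h
      exact ⟨_, by simp only [tuplesQ, hT]; rfl⟩
  | .coll op Q₁ Q₂, S, Γ, p, F, h => by
      simp only [encQ, Option.bind_eq_bind, Option.bind_eq_some_iff] at h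
      obtain ⟨_, _, _, _, T₁, hT₁, _, _, T₂, hT₂, -⟩ := h
      cases op <;> exact ⟨_, by simp only [tuplesQ, hT₁, hT₂]; rfl⟩
  | .distinct Q, S, Γ, p, F, h => by
      simp only [encQ, Option.bind_eq_bind, Option.bind_eq_some_iff] at h
      obtain ⟨_, _, _, _, T, hT, -⟩ := h
      exact ⟨_, by simp only [tuplesQ, hT]; rfl⟩
  | .prod Q₁ Q₂, S, Γ, p, F, h => by
      simp only [encQ, Option.bind_eq_bind, Option.bind_eq_some_iff] at h
      obtain ⟨_, _, _, _, _, _, T₁, hT₁, _, _, T₂, hT₂, -⟩ := h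
      exact ⟨_, by simp only [tuplesQ, hT₁, hT₂]; rfl⟩
  | .innerJoin φ Q₁ Q₂, S, Γ, p, F, h => by
      simp only [encQ, Option.bind_eq_bind, Option.bind_eq_some_iff] at h
      obtain ⟨_, _, _, _, _, _, T₁, hT₁, _, _, T₂, hT₂, -⟩ := h
      exact ⟨_, by simp only [tuplesQ, hT₁, hT₂]; rfl⟩
  | .leftJoin φ Q₁ Q₂, S, Γ, p, F, h => by
      simp only [encQ, Option.bind_eq_bind, Option.bind_eq_some_iff] at h
      obtain ⟨_, _, _, _, _, _, T₁, hT₁, _, _, T₂, hT₂, -⟩ := h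
      exact ⟨_, by simp only [tuplesQ, hT₁, hT₂]; rfl⟩
  | .rightJoin φ Q₁ Q₂, S, Γ, p, F, h => by
      simp only [encQ, Option.bind_eq_bind, Option.bind_eq_some_iff] at h
      obtain ⟨_, _, _, _, _, _, T₁, hT₁, _, _, T₂, hT₂, -⟩ := h
      exact ⟨_, by simp only [tuplesQ, hT₁, hT₂]; rfl⟩
  | .fullJoin φ Q₁ Q₂, S, Γ, p, F, h => by
      simp only [encQ, Option.bind_eq_bind, Option.bind_eq_some_iff] at h
      obtain ⟨_, _, _, _, _, _, T₁, hT₁, _, _, T₂, hT₂, -⟩ := h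
      exact ⟨_, by simp only [tuplesQ, hT₁, hT₂]; rfl⟩
  | .groupBy Q Es L φ, S, Γ, p, F, h => by
      simp only [encQ, Option.bind_eq_bind, Option.bind_eq_some_iff] at h
      obtain ⟨_, _, T, hT, -⟩ := h
      exact ⟨_, by simp only [tuplesQ, hT]; rfl⟩
  | .withQ bs Q, S, Γ, p, F, h => by
      simp only [encQ, Option.bind_eq_bind, Option.bind_eq_some_iff] at h
      obtain ⟨_, _, _, _, Γ', hΓ', _, hF, -⟩ := h
      obtain ⟨T, hT⟩ := exists_tuplesQ Q hF
      exact ⟨T, by simp [tuplesQ, hΓ', hT]⟩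

/-! # Membership in a subquery -/

/-- A disjunct `⊥` can be added or dropped freely, which is how deleted tuples disappear from a
membership test. -/
theorem anyTrue3_congr {vs ws : List Value} (h : ∀ v, v ≠ .bool false → (v ∈ vs ↔ v ∈ ws)) :
    anyTrue3 vs = anyTrue3 ws := by
  unfold anyTrue3
  simp only [h (.bool true) (by simp), h .null (by simp)]

/-- A three-valued disjunction depends only on the set of its disjuncts, so it suffices that the
subquery agrees as a bag. This is why outer joins inside predicates do not spoil equality of lists.
-/
theorem eval_memQuery {I : Interp} {A : List AttrName} {T : List SymTuple} {r : Relation}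
    (hr : r.Perm (I.rel A T)) {es : List Term} {vs : List Value}
    (hes : vs = es.map (Term.eval I)) :
    r.foldl (fun b y => or3 b (rowEq3 vs (y.map Prod.snd))) (.bool false) =
      ((T.map (fun t => Term.ite (.del t) botT
        (rowEq3T es (A.map (fun a => .attr a t))))).foldr or3T botT).eval I := by
  have hg : ∀ t, (Term.ite (.del t) botT (rowEq3T es (A.map (fun a => .attr a t)))).eval I =
      if I.del t = true then .bool false else rowEq3 vs ((I.row A t).map Prod.snd) := by
    intro t
    rw [Term.eval, eval_rowEq3T, eval_botT, hes]
    simp only [Interp.row_map_snd, Interp.vals, List.map_map, Function.comp_def, Term.eval,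
      eval_del]
  rw [foldl_or3 (fun _ _ => rowEq3_isTruth _ _), eval_foldr_or3T, List.map_map]
  simp only [Function.comp_def, hg]
  rw [foldr_or3]
  · refine anyTrue3_congr (fun v hv => ?_)
    rw [(hr.map _).mem_iff]
    simp only [List.mem_map, Interp.mem_rel]
    constructor
    · rintro ⟨_, ⟨t, ht, hd, rfl⟩, rfl⟩
      exact ⟨t, ht, by simp [hd]⟩
    · rintro ⟨t, ht, rfl⟩
      split_ifs at hv ⊢ with hd
      · exact (hv rfl).elim
      · exact ⟨_, ⟨t, ht, by simpa using hd, rfl⟩, rfl⟩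
  · intro v hv
    obtain ⟨t, -, rfl⟩ := List.mem_map.1 hv
    split_ifs
    · simp [Value.IsTruth]
    · exact rowEq3_isTruth _ _

/-! # Soundness of the encoding -/

mutual
/-- The encoding of an expression evaluates to its concrete value on the present tuples. -/
theorem eval_encE {N : Naming} {I : Interp} : (E : Expr) →
    ∀ {S : Schema} {Γ : SymDB} {D : Database} {b : Prop} {p : Label} {A : List AttrName}
    {T : List CondTuple} {F : Formula},
    I.Models b S Γ D → sideE N S Γ p E = some F → F.eval I = true → E.WellFormed N S →
    E.attrs ⊆ A → (I.condRel A T ≠ [] ∨ E.Grouped .nil) →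
    evalE N S D (I.condRel A T) E = (encE N S Γ p T E).eval I
  | .attr a, S, Γ, D, b, p, A, T, F, hD, h, hF, hw, ha, hne => by
      -- No attribute is grouped by the empty list, so some tuple is present.
      simp only [Expr.Grouped, ExprList.Mem, or_false] at hne
      rw [evalE, encE, eval_first (ha (by simp [Expr.attrs])) T hne]
  | .val v, S, Γ, D, b, p, A, T, F, hD, h, hF, hw, ha, hne => by
      simp only [evalE, encE, Term.eval]
  | .arith op E₁ E₂, S, Γ, D, b, p, A, T, F, hD, h, hF, hw, ha, hne => by
      simp only [sideE, Option.bind_eq_bind, Option.bind_eq_some_iff, Option.some.injEq] at h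
      obtain ⟨F₁, h₁, F₂, h₂, rfl⟩ := h
      obtain ⟨hF₁, hF₂⟩ := eval_and.1 hF
      simp only [Expr.WellFormed] at hw
      simp only [Expr.attrs, List.append_subset] at ha
      simp only [Expr.Grouped, ExprList.Mem, false_or] at hne
      have ih₁ := eval_encE E₁ hD h₁ hF₁ hw.1 ha.1 (hne.imp_right And.left)
      have ih₂ := eval_encE E₂ hD h₂ hF₂ hw.2 ha.2 (hne.imp_right And.right)
      simp only [evalE, encE, Term.eval, ih₁, ih₂]
  | .ite φ E₁ E₂, S, Γ, D, b, p, A, T, F, hD, h, hF, hw, ha, hne => by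
      simp only [sideE, Option.bind_eq_bind, Option.bind_eq_some_iff, Option.some.injEq] at h
      obtain ⟨F₁, h₁, F₂, h₂, F₃, h₃, rfl⟩ := h
      obtain ⟨hF₁, hF₂, hF₃⟩ : _ ∧ _ ∧ _ := by simpa only [eval_and] using hF
      simp only [Expr.WellFormed] at hw
      simp only [Expr.attrs, List.append_subset, and_assoc] at ha
      simp only [Expr.Grouped, ExprList.Mem, false_or] at hne
      have ih₁ := eval_encP φ hD h₁ hF₁ hw.1 ha.1 (hne.imp_right And.left)
      have ih₂ := eval_encE E₁ hD h₂ hF₂ hw.2.1 ha.2.1 (hne.imp_right (fun h => h.2.1))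
      have ih₃ := eval_encE E₂ hD h₃ hF₃ hw.2.2 ha.2.2 (hne.imp_right (fun h => h.2.2))
      simp only [evalE, encE, Term.eval, eval_isTrueF, ih₁, ih₂, ih₃]
  | .case bs E, S, Γ, D, b, p, A, T, F, hD, h, hF, hw, ha, hne => by
      simp only [sideE, Option.bind_eq_bind, Option.bind_eq_some_iff, Option.some.injEq] at h
      obtain ⟨F₁, h₁, F₂, h₂, rfl⟩ := h
      obtain ⟨hF₁, hF₂⟩ := eval_and.1 hF
      simp only [Expr.WellFormed] at hw
      simp only [Expr.attrs, List.append_subset] at ha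
      simp only [Expr.Grouped, ExprList.Mem, false_or] at hne
      have ih₁ := eval_encBr bs hD h₁ hF₁ hw.1 ha.1 (hne.imp_right And.left)
      have ih₂ := eval_encE E hD h₂ hF₂ hw.2 ha.2 (hne.imp_right And.right)
      simp only [evalE, encE, ih₁, ih₂]
theorem eval_encBr {N : Naming} {I : Interp} : (bs : Branches) →
    ∀ {S : Schema} {Γ : SymDB} {D : Database} {b : Prop} {p : Label} {A : List AttrName}
    {T : List CondTuple} {F : Formula},
    I.Models b S Γ D → sideBr N S Γ p bs = some F → F.eval I = true → bs.WellFormed N S →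
    bs.attrs ⊆ A → (I.condRel A T ≠ [] ∨ bs.Grouped .nil) →
    ∀ (d : Term), evalBr N S D (I.condRel A T) bs (d.eval I) = (encBr N S Γ p T bs d).eval I
  | .nil, S, Γ, D, b, p, A, T, F, hD, h, hF, hw, ha, hne => by
      intro d
      simp only [evalBr, encBr]
  | .cons φ E bs, S, Γ, D, b, p, A, T, F, hD, h, hF, hw, ha, hne => by
      simp only [sideBr, Option.bind_eq_bind, Option.bind_eq_some_iff, Option.some.injEq] at h
      obtain ⟨F₁, h₁, F₂, h₂, F₃, h₃, rfl⟩ := h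
      obtain ⟨hF₁, hF₂, hF₃⟩ : _ ∧ _ ∧ _ := by simpa only [eval_and] using hF
      simp only [Branches.WellFormed] at hw
      simp only [Branches.attrs, List.append_subset, and_assoc] at ha
      simp only [Branches.Grouped] at hne
      have ih₁ := eval_encP φ hD h₁ hF₁ hw.1 ha.1 (hne.imp_right And.left)
      have ih₂ := eval_encE E hD h₂ hF₂ hw.2.1 ha.2.1 (hne.imp_right (fun h => h.2.1))
      have ih₃ := eval_encBr bs hD h₃ hF₃ hw.2.2 ha.2.2 (hne.imp_right (fun h => h.2.2))
      intro d
      simp only [evalBr, encBr, Term.eval, eval_isTrueF, ih₁, ih₂, ih₃]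
theorem eval_encEs {N : Naming} {I : Interp} : (Es : ExprList) →
    ∀ {S : Schema} {Γ : SymDB} {D : Database} {b : Prop} {p : Label} {A : List AttrName}
    {T : List CondTuple} {F : Formula},
    I.Models b S Γ D → sideEs N S Γ p Es = some F → F.eval I = true → Es.WellFormed N S →
    Es.attrs ⊆ A → (I.condRel A T ≠ [] ∨ ExprList.Grouped .nil Es) →
    evalEs N S D (I.condRel A T) Es = (encEs N S Γ p T Es).map (Term.eval I)
  | .nil, S, Γ, D, b, p, A, T, F, hD, h, hF, hw, ha, hne => by
      simp only [evalEs, encEs, List.map_nil]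
  | .cons E Es, S, Γ, D, b, p, A, T, F, hD, h, hF, hw, ha, hne => by
      simp only [sideEs, Option.bind_eq_bind, Option.bind_eq_some_iff, Option.some.injEq] at h
      obtain ⟨F₁, h₁, F₂, h₂, rfl⟩ := h
      obtain ⟨hF₁, hF₂⟩ := eval_and.1 hF
      simp only [ExprList.WellFormed] at hw
      simp only [ExprList.attrs, List.append_subset] at ha
      simp only [ExprList.Grouped] at hne
      have ih₁ := eval_encE E hD h₁ hF₁ hw.1 ha.1 (hne.imp_right And.left)
      have ih₂ := eval_encEs Es hD h₂ hF₂ hw.2 ha.2 (hne.imp_right And.right)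
      simp only [evalEs, encEs, List.map_cons, ih₁, ih₂]
theorem eval_encA {N : Naming} {I : Interp} : (A' : Attr) →
    ∀ {S : Schema} {Γ : SymDB} {D : Database} {b : Prop} {p : Label} {A : List AttrName}
    {T : List CondTuple} {F : Formula},
    I.Models b S Γ D → sideA N S Γ p A' = some F → F.eval I = true → A'.WellFormed N S →
    A'.attrs ⊆ A → (I.condRel A T ≠ [] ∨ A'.Grouped .nil) →
    evalA N S D (I.condRel A T) A' = (encA N S Γ p T A').eval I
  | .cast φ, S, Γ, D, b, p, A, T, F, hD, h, hF, hw, ha, hne => by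
      simp only [sideA] at h
      simp only [Attr.WellFormed] at hw
      simp only [Attr.attrs] at ha
      simp only [Attr.Grouped] at hne
      have ih := eval_encP φ hD h hF hw ha hne
      simp only [evalA, encA, Term.eval, eval_isNullF, eval_isTrueF, eval_nullT, ih]
  | .expr E, S, Γ, D, b, p, A, T, F, hD, h, hF, hw, ha, hne => by
      simp only [sideA] at h
      simp only [Attr.WellFormed] at hw
      simp only [Attr.attrs] at ha
      simp only [Attr.Grouped] at hne
      have ih := eval_encE E hD h hF hw ha hne
      simp only [evalA, encA, ih]
  | .agg G E, S, Γ, D, b, p, A, T, F, hD, h, hF, hw, ha, hne => by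
      simp only [sideA] at h
      simp only [Attr.WellFormed] at hw
      simp only [Attr.attrs] at ha
      -- The argument of an aggregate is evaluated on one present tuple at a time, hence on a
      -- nonempty list, even if `T` itself has no present tuple.
      have ih := fun T hT => eval_encE (T := T) E hD h hF hw ha (Or.inl hT)
      simp only [evalA, encA, Agg.eval_enc]
      congr 1
      simp only [Interp.presentVals, Interp.condRel, List.filter_map, List.map_map]
      refine List.map_congr_left (fun c hc => ?_)
      have hc' : c.1.eval I = true := (List.mem_filter.1 hc).2
      have h1 : I.condRel A [c] = [I.row A c.2] := by
        rw [Interp.condRel_cons, if_pos hc']; rfl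
      have := ih [c] (by rw [h1]; simp)
      rw [h1] at this
      exact this
  | .arith op A₁ A₂, S, Γ, D, b, p, A, T, F, hD, h, hF, hw, ha, hne => by
      simp only [sideA, Option.bind_eq_bind, Option.bind_eq_some_iff, Option.some.injEq] at h
      obtain ⟨F₁, h₁, F₂, h₂, rfl⟩ := h
      obtain ⟨hF₁, hF₂⟩ := eval_and.1 hF
      simp only [Attr.WellFormed] at hw
      simp only [Attr.attrs, List.append_subset] at ha
      simp only [Attr.Grouped] at hne
      have ih₁ := eval_encA A₁ hD h₁ hF₁ hw.1 ha.1 (hne.imp_right And.left)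
      have ih₂ := eval_encA A₂ hD h₂ hF₂ hw.2 ha.2 (hne.imp_right And.right)
      simp only [evalA, encA, Term.eval, ih₁, ih₂]
theorem eval_encP {N : Naming} {I : Interp} : (φ : Pred) →
    ∀ {S : Schema} {Γ : SymDB} {D : Database} {b : Prop} {p : Label} {A : List AttrName}
    {T : List CondTuple} {F : Formula},
    I.Models b S Γ D → sideP N S Γ p φ = some F → F.eval I = true → φ.WellFormed N S →
    φ.attrs ⊆ A → (I.condRel A T ≠ [] ∨ φ.Grouped .nil) →
    evalP N S D (I.condRel A T) φ = (encP N S Γ p T φ).eval I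
  | .const v, S, Γ, D, b, p, A, T, F, hD, h, hF, hw, ha, hne => by
      simp only [evalP, encP, Term.eval]
  | .null, S, Γ, D, b, p, A, T, F, hD, h, hF, hw, ha, hne => by
      simp only [evalP, encP, eval_nullT]
  | .cmp op A₁ A₂, S, Γ, D, b, p, A, T, F, hD, h, hF, hw, ha, hne => by
      simp only [sideP, Option.bind_eq_bind, Option.bind_eq_some_iff, Option.some.injEq] at h
      obtain ⟨F₁, h₁, F₂, h₂, rfl⟩ := h
      obtain ⟨hF₁, hF₂⟩ := eval_and.1 hF
      simp only [Pred.WellFormed] at hw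
      simp only [Pred.attrs, List.append_subset] at ha
      simp only [Pred.Grouped] at hne
      have ih₁ := eval_encA A₁ hD h₁ hF₁ hw.1 ha.1 (hne.imp_right And.left)
      have ih₂ := eval_encA A₂ hD h₂ hF₂ hw.2 ha.2 (hne.imp_right And.right)
      simp only [evalP, encP, eval_cmp3T, ih₁, ih₂]
  | .isNull E, S, Γ, D, b, p, A, T, F, hD, h, hF, hw, ha, hne => by
      simp only [sideP] at h
      simp only [Pred.WellFormed] at hw
      simp only [Pred.attrs] at ha
      simp only [Pred.Grouped] at hne
      have ih := eval_encE E hD h hF hw ha hne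
      simp only [evalP, encP, Term.eval, eval_isNullF, eval_topT, eval_botT, ih]
  | .inVals Es vs, S, Γ, D, b, p, A, T, F, hD, h, hF, hw, ha, hne => by
      simp only [sideP] at h
      simp only [Pred.WellFormed] at hw
      simp only [Pred.attrs] at ha
      simp only [Pred.Grouped] at hne
      have ih := eval_encEs Es hD h hF hw.1 ha hne
      simp only [evalP, encP, eval_foldr_or3T, List.map_map, Function.comp_def, eval_rowEq3T, ih,
        Term.eval, List.map_id']
  | .inQuery Es Q, S, Γ, D, b, p, A, T, F, hD, h, hF, hw, ha, hne => by
      simp only [sideP, Option.bind_eq_bind, Option.bind_eq_some_iff, Option.some.injEq] at h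
      obtain ⟨F₁, h₁, F₂, h₂, rfl⟩ := h
      obtain ⟨hF₁, hF₂⟩ := eval_and.1 hF
      simp only [Pred.WellFormed] at hw
      simp only [Pred.attrs] at ha
      simp only [Pred.Grouped] at hne
      obtain ⟨hw₁, hw₂, B, hB, -⟩ := hw
      have ih := eval_encEs Es hD h₁ hF₁ hw₁ ha hne
      obtain ⟨U, hU⟩ := exists_tuplesQ Q h₂
      have ihQ := agree_encQ Q hD h₂ hF₂ hw₂ hB hU
      simp only [evalP, encP, hB, hU, Option.getD_some]
      exact eval_memQuery ihQ.1 ih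
  | .and φ₁ φ₂, S, Γ, D, b, p, A, T, F, hD, h, hF, hw, ha, hne => by
      simp only [sideP, Option.bind_eq_bind, Option.bind_eq_some_iff, Option.some.injEq] at h
      obtain ⟨F₁, h₁, F₂, h₂, rfl⟩ := h
      obtain ⟨hF₁, hF₂⟩ := eval_and.1 hF
      simp only [Pred.WellFormed] at hw
      simp only [Pred.attrs, List.append_subset] at ha
      simp only [Pred.Grouped] at hne
      have ih₁ := eval_encP φ₁ hD h₁ hF₁ hw.1 ha.1 (hne.imp_right And.left)
      have ih₂ := eval_encP φ₂ hD h₂ hF₂ hw.2 ha.2 (hne.imp_right And.right)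
      simp only [evalP, encP, eval_and3T, ih₁, ih₂]
  | .or φ₁ φ₂, S, Γ, D, b, p, A, T, F, hD, h, hF, hw, ha, hne => by
      simp only [sideP, Option.bind_eq_bind, Option.bind_eq_some_iff, Option.some.injEq] at h
      obtain ⟨F₁, h₁, F₂, h₂, rfl⟩ := h
      obtain ⟨hF₁, hF₂⟩ := eval_and.1 hF
      simp only [Pred.WellFormed] at hw
      simp only [Pred.attrs, List.append_subset] at ha
      simp only [Pred.Grouped] at hne
      have ih₁ := eval_encP φ₁ hD h₁ hF₁ hw.1 ha.1 (hne.imp_right And.left)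
      have ih₂ := eval_encP φ₂ hD h₂ hF₂ hw.2 ha.2 (hne.imp_right And.right)
      simp only [evalP, encP, eval_or3T, ih₁, ih₂]
  | .not φ, S, Γ, D, b, p, A, T, F, hD, h, hF, hw, ha, hne => by
      simp only [sideP] at h
      simp only [Pred.WellFormed] at hw
      simp only [Pred.attrs] at ha
      simp only [Pred.Grouped] at hne
      have ih := eval_encP φ hD h hF hw ha hne
      simp only [evalP, encP, eval_not3T, ih]
theorem eval_encL {N : Naming} {I : Interp} : (L : AttrList) →
    ∀ {S : Schema} {Γ : SymDB} {D : Database} {b : Prop} {p : Label} {A : List AttrName}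
    {T : List CondTuple} {F : Formula},
    I.Models b S Γ D → sideL N S Γ p L = some F → F.eval I = true → L.WellFormed N S →
    L.attrs ⊆ A → (I.condRel A T ≠ [] ∨ L.Grouped .nil) →
    evalL N S D (I.condRel A T) L =
      (L.names N).zip ((encL N S Γ p T L).map (Term.eval I))
  | .id A', S, Γ, D, b, p, A, T, F, hD, h, hF, hw, ha, hne => by
      simp only [sideL] at h
      simp only [AttrList.WellFormed] at hw
      simp only [AttrList.attrs] at ha
      simp only [AttrList.Grouped] at hne
      have ih := eval_encA A' hD h hF hw ha hne
      simp [evalL, encL, AttrList.names, ih]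
  | .rename a A', S, Γ, D, b, p, A, T, F, hD, h, hF, hw, ha, hne => by
      simp only [sideL] at h
      simp only [AttrList.WellFormed] at hw
      simp only [AttrList.attrs] at ha
      simp only [AttrList.Grouped] at hne
      have ih := eval_encA A' hD h hF hw ha hne
      simp [evalL, encL, AttrList.names, ih]
  | .append L₁ L₂, S, Γ, D, b, p, A, T, F, hD, h, hF, hw, ha, hne => by
      simp only [sideL, Option.bind_eq_bind, Option.bind_eq_some_iff, Option.some.injEq] at h
      obtain ⟨F₁, h₁, F₂, h₂, rfl⟩ := h
      obtain ⟨hF₁, hF₂⟩ := eval_and.1 hF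
      simp only [AttrList.WellFormed] at hw
      simp only [AttrList.attrs, List.append_subset] at ha
      simp only [AttrList.Grouped] at hne
      have ih₁ := eval_encL L₁ hD h₁ hF₁ hw.1 ha.1 (hne.imp_right And.left)
      have ih₂ := eval_encL L₂ hD h₂ hF₂ hw.2 ha.2 (hne.imp_right And.right)
      rw [evalL, encL, AttrList.names, List.map_append, List.zip_append (by simp [length_encL]),
        ih₁, ih₂]
/-- The concrete result of a query agrees with its symbolic result. -/
theorem agree_encQ {N : Naming} {I : Interp} : (Q : Query) → ∀ {S : Schema} {Γ : SymDB}
    {D : Database} {b : Prop} {p : Label} {A : List AttrName} {T : List SymTuple} {F : Formula},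
    I.Models b S Γ D → encQ N S Γ p Q = some F → F.eval I = true → Q.WellFormed N S →
    attrsQ N S Q = some A → tuplesQ Γ p Q = some T →
    Agree (b ∧ Q.OuterJoinFree) (evalQ N S D Q) (I.rel A T)
  | .rel R, S, Γ, D, b, p, A, T, F, hD, h, hF, hw, hA, hT => by
      simp only [attrsQ] at hA
      simp only [tuplesQ] at hT
      simp only [evalQ, Query.OuterJoinFree, and_true]
      exact hD R A T hA hT
  | .proj L Q, S, Γ, D, b, p, A, T, F, hD, h, hF, hw, hA, hT => by
      simp only [encQ, Option.bind_eq_bind, Option.bind_eq_some_iff, Option.some.injEq] at h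
      obtain ⟨F₁, h₁, T₁, hT₁, F₂, h₂, rfl⟩ := h
      obtain ⟨hF₁, hF₂, hF₃⟩ : _ ∧ _ ∧ _ := by simpa only [eval_and] using hF
      simp only [Query.WellFormed] at hw
      obtain ⟨hw₁, hw₂, ⟨B, hB, hLB⟩, hagg⟩ := hw
      simp only [attrsQ, hB, Option.bind_eq_bind, Option.bind_some, if_pos hLB,
        Option.some.injEq] at hA
      simp only [tuplesQ, hT₁, Option.bind_eq_bind, Option.bind_some, Option.some.injEq] at hT
      subst hA hT
      have ih := agree_encQ Q hD h₁ hF₁ hw₁ hB hT₁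
      have ihL := fun U hU => eval_encL (T := U) L hD h₂ hF₂ hw₂ hLB hU
      simp only [evalQ, Query.OuterJoinFree]
      by_cases hL : L.hasAgg = true
      · simp only [if_pos hL] at hF₃ ⊢
        rw [eval_and, eval_attrsAre (length_encL _ _), eval_notDel] at hF₃
        -- Possibly no tuple of `T₁` is present; well-formedness then ensures that no attribute is
        -- read outside of an aggregate.
        have h1 := ihL (present T₁) (Or.inr (hagg hL))
        rw [Interp.condRel_present] at h1
        have h2 : I.rel (L.names N) (sigma p 0 1) = [evalL N S D (I.rel B T₁) L] := by
          rw [h1, ← hF₃.1, ← Interp.row_eq_zip]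
          simp [sigma, Interp.rel, hF₃.2, Interp.row]
        rw [h2]
        -- The bag of rows determines the single output tuple, since every attribute occurs inside
        -- an aggregate.
        refine ih.congr (fun xs => [evalL N S D xs L]) (fun hp => ?_)
        rw [evalL_perm hp (G := .nil) (fun E hE => hE.elim) L (hagg hL)]
      · simp only [if_neg hL] at hF₃ ⊢
        have hF₃ := eval_conjZip.1 hF₃
        simp only [eval_and, eval_iff, eval_del, Bool.coe_iff_coe,
          eval_attrsAre (length_encL _ _)] at hF₃
        have h2 : I.rel (L.names N) (sigma p 0 T₁.length) =
            (I.rel B T₁).map (fun x => evalL N S D [x] L) := by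
          refine rel_map (length_sigma _ _ _) (fun i hi hi' => (hF₃ i hi hi').2)
            (fun i hi hi' hd => ?_)
          have h1 := ihL (present [T₁[i]]) (Or.inl (by simp [Interp.condRel_present_singleton hd]))
          rw [Interp.condRel_present_singleton hd] at h1
          rw [h1, ← (hF₃ i hi hi').1, ← Interp.row_eq_zip]
        rw [h2]
        exact ih.congr (fun xs => xs.map (fun x => evalL N S D [x] L)) (fun hp => hp.map _)
  | .filter φ Q, S, Γ, D, b, p, A, T, F, hD, h, hF, hw, hA, hT => by
      simp only [encQ, Option.bind_eq_bind, Option.bind_eq_some_iff, Option.some.injEq] at h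
      obtain ⟨B, hB, F₁, h₁, T₁, hT₁, F₂, h₂, rfl⟩ := h
      obtain ⟨hF₁, hF₂, hF₃⟩ : _ ∧ _ ∧ _ := by simpa only [eval_and] using hF
      simp only [Query.WellFormed, hB, Option.some.injEq, exists_eq_left'] at hw
      obtain ⟨hw₁, hw₂, hφ⟩ := hw
      simp only [attrsQ, hB, Option.some.injEq] at hA
      simp only [tuplesQ, hT₁, Option.bind_eq_bind, Option.bind_some, Option.some.injEq] at hT
      subst hA hT
      have ih := agree_encQ Q hD h₁ hF₁ hw₁ hB hT₁
      have hθ : ∀ t, I.del t = false →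
          ((encP N S Γ (1 :: p) (present [t]) φ).eval I = .bool true ↔
            decide (evalP N S D [I.row (B) t] φ = .bool true) = true) := by
        intro t ht
        have h1 := eval_encP (T := present [t]) φ hD h₂ hF₂ hw₂ hφ
          (Or.inl (by simp [Interp.condRel_present_singleton ht]))
        rw [Interp.condRel_present_singleton ht] at h1
        rw [h1, decide_eq_true_iff]
      simp only [evalQ, Query.OuterJoinFree]
      rw [rel_filterF (θ := fun x => decide (evalP N S D [x] φ = .bool true))
        (length_sigma _ _ _) hF₃ hθ]
      exact ih.congr _ (fun hp => hp.filter _)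
  | .rename R Q, S, Γ, D, b, p, A, T, F, hD, h, hF, hw, hA, hT => by
      simp only [encQ, Option.bind_eq_bind, Option.bind_eq_some_iff, Option.some.injEq] at h
      obtain ⟨B, hB, F₁, h₁, T₁, hT₁, rfl⟩ := h
      obtain ⟨hF₁, hF₂⟩ := eval_and.1 hF
      simp only [Query.WellFormed] at hw
      simp only [attrsQ, hB, Option.bind_eq_bind, Option.bind_some, Option.some.injEq] at hA
      simp only [tuplesQ, hT₁, Option.bind_eq_bind, Option.bind_some, Option.some.injEq] at hT
      subst hA hT
      have ih := agree_encQ Q hD h₁ hF₁ hw hB hT₁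
      simp only [evalQ, Query.OuterJoinFree]
      rw [rel_renameF (N.rename R) (length_sigma _ _ _) hF₂]
      exact ih.congr _ (fun hp => hp.map _)
  | .coll op Q₁ Q₂, S, Γ, D, b, p, A, T, F, hD, h, hF, hw, hA, hT => by
      simp only [encQ, Option.bind_eq_bind, Option.bind_eq_some_iff, Option.some.injEq] at h
      obtain ⟨B, hB, F₁, h₁, T₁, hT₁, F₂, h₂, T₂, hT₂, rfl⟩ := h
      obtain ⟨hF₁, hF₂, hF₃⟩ : _ ∧ _ ∧ _ := by simpa only [eval_and] using hF
      simp only [Query.WellFormed] at hw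
      simp only [attrsQ, Option.bind_eq_bind, Option.bind_eq_some_iff] at hA
      obtain ⟨B', hB', B₂, hB₂, hA⟩ := hA
      obtain rfl : B = B' := by rw [hB] at hB'; exact Option.some.inj hB'
      split_ifs at hA with hBB
      subst hBB
      obtain rfl := Option.some.inj hA
      have ih₁ := agree_encQ Q₁ hD h₁ hF₁ hw.1 hB hT₁
      have ih₂ := agree_encQ Q₂ hD h₂ hF₂ hw.2 hB₂ hT₂
      simp only [tuplesQ, hT₁, hT₂, Option.bind_eq_bind, Option.bind_some] at hT
      simp only [evalQ, Query.OuterJoinFree]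
      refine Agree.mono ?_ (b := (b ∧ Q₁.OuterJoinFree) ∧ b ∧ Q₂.OuterJoinFree) (by tauto)
      cases op <;> obtain rfl := Option.some.inj hT <;> simp only at hF₃ ⊢
      · obtain ⟨h3, h4⟩ := eval_and.1 hF₃
        rw [rel_dedupF (by simp [length_sigma]) h4, rel_unionAllF (length_sigma _ _ _) h3]
        exact ih₁.congr₂ ih₂ (fun xs ys => dedup (xs ++ ys)) (fun hp hp' => dedup_perm (hp.append hp'))
      · obtain ⟨h3, h4⟩ := eval_and.1 hF₃
        rw [rel_keepIf (θ := fun x => decide (x ∈ I.rel B T₂)) (by simp [length_sigma]) h4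
          (fun i t _ ht => by rw [eval_memF_of_not_del ht, decide_eq_true_iff]),
          rel_dedupF (length_sigma _ _ _) h3]
        exact ih₁.congr₂ ih₂ (fun xs ys => (dedup xs).filter (fun x => decide (x ∈ ys)))
          (fun hp hp' => filter_perm (dedup_perm hp) (fun x => by simp only [hp'.mem_iff]))
      · obtain ⟨h3, h4⟩ := eval_and.1 hF₃
        rw [rel_keepIf (θ := fun x => decide (x ∉ I.rel B T₂)) (by simp [length_sigma]) h4
          (fun i t _ ht => by rw [eval_not, eval_memF_of_not_del ht, decide_eq_true_iff]),
          rel_dedupF (length_sigma _ _ _) h3]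
        exact ih₁.congr₂ ih₂ (fun xs ys => (dedup xs).filter (fun x => decide (x ∉ ys)))
          (fun hp hp' => filter_perm (dedup_perm hp) (fun x => by simp only [hp'.mem_iff]))
      · rw [rel_unionAllF (length_sigma _ _ _) hF₃]
        exact ih₁.congr₂ ih₂ (fun xs ys => xs ++ ys) (fun hp hp' => hp.append hp')
      · obtain ⟨h3, h4⟩ := eval_and.1 hF₃
        rw [rel_diffAllF (length_sigma _ _ _) h4, rel_diffAllF (length_sigma _ _ _) h3]
        exact ih₁.congr₂ ih₂ (fun xs ys => bagDiff xs (bagDiff xs ys))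
          (fun hp hp' => bagDiff_perm hp (bagDiff_perm hp hp'))
      · rw [rel_diffAllF (length_sigma _ _ _) hF₃]
        exact ih₁.congr₂ ih₂ (fun xs ys => bagDiff xs ys) (fun hp hp' => bagDiff_perm hp hp')
  | .distinct Q, S, Γ, D, b, p, A, T, F, hD, h, hF, hw, hA, hT => by
      simp only [encQ, Option.bind_eq_bind, Option.bind_eq_some_iff, Option.some.injEq] at h
      obtain ⟨B, hB, F₁, h₁, T₁, hT₁, rfl⟩ := h
      obtain ⟨hF₁, hF₂⟩ := eval_and.1 hF
      simp only [Query.WellFormed] at hw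
      simp only [attrsQ, hB, Option.some.injEq] at hA
      simp only [tuplesQ, hT₁, Option.bind_eq_bind, Option.bind_some, Option.some.injEq] at hT
      subst hA hT
      have ih := agree_encQ Q hD h₁ hF₁ hw hB hT₁
      simp only [evalQ, Query.OuterJoinFree]
      rw [rel_dedupF (length_sigma _ _ _) hF₂]
      exact ih.congr _ dedup_perm
  | .prod Q₁ Q₂, S, Γ, D, b, p, A, T, F, hD, h, hF, hw, hA, hT => by
      simp only [encQ, Option.bind_eq_bind, Option.bind_eq_some_iff, Option.some.injEq] at h
      obtain ⟨A₁, hA₁, A₂, hA₂, F₁, h₁, T₁, hT₁, F₂, h₂, T₂, hT₂, rfl⟩ := h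
      obtain ⟨hF₁, hF₂, hF₃⟩ : _ ∧ _ ∧ _ := by simpa only [eval_and] using hF
      simp only [Query.WellFormed] at hw
      simp only [attrsQ, hA₁, hA₂, Option.bind_eq_bind, Option.bind_some, Option.some.injEq] at hA
      simp only [tuplesQ, hT₁, hT₂, Option.bind_eq_bind, Option.bind_some, Option.some.injEq] at hT
      subst hA hT
      have ih₁ := agree_encQ Q₁ hD h₁ hF₁ hw.1 hA₁ hT₁
      have ih₂ := agree_encQ Q₂ hD h₂ hF₂ hw.2 hA₂ hT₂
      simp only [evalQ, Query.OuterJoinFree]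
      rw [rel_prodF hF₃]
      exact (ih₁.congr₂ ih₂ crossProd crossProd_perm).mono (by tauto)
  | .innerJoin φ Q₁ Q₂, S, Γ, D, b, p, A, T, F, hD, h, hF, hw, hA, hT => by
      simp only [encQ, Option.bind_eq_bind, Option.bind_eq_some_iff, Option.some.injEq] at h
      obtain ⟨A₁, hA₁, A₂, hA₂, F₁, h₁, T₁, hT₁, F₂, h₂, T₂, hT₂, F₃, h₃, rfl⟩ := h
      simp only [eval_and] at hF
      obtain ⟨hF₁, hF₂, hF₃, hF₄⟩ := hF
      simp only [Query.WellFormed, hA₁, hA₂, Option.some.injEq, exists_and_left,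
        exists_eq_left'] at hw
      obtain ⟨hw₁, hw₂, hw₃, hφ⟩ := hw
      simp only [attrsQ, hA₁, hA₂, Option.bind_eq_bind, Option.bind_some, Option.some.injEq] at hA
      simp only [tuplesQ, hT₁, hT₂, Option.bind_eq_bind, Option.bind_some, Option.some.injEq] at hT
      subst hA hT
      have ih₁ := agree_encQ Q₁ hD h₁ hF₁ hw₁ hA₁ hT₁
      have ih₂ := agree_encQ Q₂ hD h₂ hF₂ hw₂ hA₂ hT₂
      have hθ : ∀ t, I.del t = false →
          ((encP N S Γ (2 :: p) (present [t]) φ).eval I = .bool true ↔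
            decide (evalP N S D [I.row (A₁ ++ A₂) t] φ = .bool true) = true) := by
        intro t ht
        have h1 := eval_encP (T := present [t]) φ hD h₃ hF₃ hw₃ hφ
          (Or.inl (by simp [Interp.condRel_present_singleton ht]))
        rw [Interp.condRel_present_singleton ht] at h1
        rw [h1, decide_eq_true_iff]
      simp only [evalQ, Query.OuterJoinFree]
      rw [rel_joinF (θ := fun x => decide (evalP N S D [x] φ = .bool true)) hF₄ hθ]
      exact (ih₁.congr₂ ih₂ (fun xs ys => (crossProd xs ys).filter _)
        (fun hp hp' => (crossProd_perm hp hp').filter _)).mono (by tauto)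
  | .leftJoin φ Q₁ Q₂, S, Γ, D, b, p, A, T, F, hD, h, hF, hw, hA, hT => by
      simp only [encQ, Option.bind_eq_bind, Option.bind_eq_some_iff, Option.some.injEq] at h
      obtain ⟨A₁, hA₁, A₂, hA₂, F₁, h₁, T₁, hT₁, F₂, h₂, T₂, hT₂, F₃, h₃, rfl⟩ := h
      simp only [eval_and] at hF
      obtain ⟨hF₁, hF₂, hF₃, hF₄⟩ := hF
      simp only [Query.WellFormed, hA₁, hA₂, Option.some.injEq, exists_and_left,
        exists_eq_left'] at hw
      obtain ⟨hw₁, hw₂, hw₃, hφ⟩ := hw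
      simp only [attrsQ, hA₁, hA₂, Option.bind_eq_bind, Option.bind_some, Option.some.injEq] at hA
      simp only [tuplesQ, hT₁, hT₂, Option.bind_eq_bind, Option.bind_some, Option.some.injEq] at hT
      subst hA hT
      have ih₁ := agree_encQ Q₁ hD h₁ hF₁ hw₁ hA₁ hT₁
      have ih₂ := agree_encQ Q₂ hD h₂ hF₂ hw₂ hA₂ hT₂
      have hθ : ∀ t, I.del t = false →
          ((encP N S Γ (2 :: p) (present [t]) φ).eval I = .bool true ↔
            decide (evalP N S D [I.row (A₁ ++ A₂) t] φ = .bool true) = true) := by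
        intro t ht
        have h1 := eval_encP (T := present [t]) φ hD h₃ hF₃ hw₃ hφ
          (Or.inl (by simp [Interp.condRel_present_singleton ht]))
        rw [Interp.condRel_present_singleton ht] at h1
        rw [h1, decide_eq_true_iff]
      simp only [evalQ, Query.OuterJoinFree, hA₂, Option.getD_some]
      -- Concretely a padded row stands among the matching rows, symbolically it follows them all.
      -- Only the bags are compared: the claim about lists is void, as the query is not
      -- outer-join-free.
      refine ⟨?_, fun hb => hb.2.elim⟩
      rw [Interp.rel_append, rel_joinF (θ := fun x => decide (evalP N S D [x] φ = .bool true)) hF₄.1 hθ,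
        rel_leftPadF (θ := fun x => decide (evalP N S D [x] φ = .bool true))
          (fun i j hi hj => slot_joinF hF₄.1 hθ hi hj) hF₄.2]
      exact (leftOuter_perm _ _ _ _).trans
        (((crossProd_perm ih₁.1 ih₂.1).filter _).append (leftPads_perm _ _ ih₁.1 ih₂.1))
  | .rightJoin φ Q₁ Q₂, S, Γ, D, b, p, A, T, F, hD, h, hF, hw, hA, hT => by
      simp only [encQ, Option.bind_eq_bind, Option.bind_eq_some_iff, Option.some.injEq] at h
      obtain ⟨A₁, hA₁, A₂, hA₂, F₁, h₁, T₁, hT₁, F₂, h₂, T₂, hT₂, F₃, h₃, rfl⟩ := h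
      simp only [eval_and] at hF
      obtain ⟨hF₁, hF₂, hF₃, hF₄⟩ := hF
      simp only [Query.WellFormed, hA₁, hA₂, Option.some.injEq, exists_and_left,
        exists_eq_left'] at hw
      obtain ⟨hw₁, hw₂, hw₃, hφ⟩ := hw
      simp only [attrsQ, hA₁, hA₂, Option.bind_eq_bind, Option.bind_some, Option.some.injEq] at hA
      simp only [tuplesQ, hT₁, hT₂, Option.bind_eq_bind, Option.bind_some, Option.some.injEq] at hT
      subst hA hT
      have ih₁ := agree_encQ Q₁ hD h₁ hF₁ hw₁ hA₁ hT₁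
      have ih₂ := agree_encQ Q₂ hD h₂ hF₂ hw₂ hA₂ hT₂
      have hθ : ∀ t, I.del t = false →
          ((encP N S Γ (2 :: p) (present [t]) φ).eval I = .bool true ↔
            decide (evalP N S D [I.row (A₁ ++ A₂) t] φ = .bool true) = true) := by
        intro t ht
        have h1 := eval_encP (T := present [t]) φ hD h₃ hF₃ hw₃ hφ
          (Or.inl (by simp [Interp.condRel_present_singleton ht]))
        rw [Interp.condRel_present_singleton ht] at h1
        rw [h1, decide_eq_true_iff]
      simp only [evalQ, Query.OuterJoinFree, hA₁, Option.getD_some]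
      refine ⟨?_, fun hb => hb.2.elim⟩
      rw [Interp.rel_append, rel_joinF (θ := fun x => decide (evalP N S D [x] φ = .bool true)) hF₄.1 hθ,
        rel_rightPadF (θ := fun x => decide (evalP N S D [x] φ = .bool true))
          (fun i j hi hj => slot_joinF hF₄.1 hθ hi hj) hF₄.2]
      exact (rightOuter_perm _ _ _ _).trans
        (((crossProd_perm ih₁.1 ih₂.1).filter _).append (rightPads_perm _ _ ih₁.1 ih₂.1))
  | .fullJoin φ Q₁ Q₂, S, Γ, D, b, p, A, T, F, hD, h, hF, hw, hA, hT => by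
      simp only [encQ, Option.bind_eq_bind, Option.bind_eq_some_iff, Option.some.injEq] at h
      obtain ⟨A₁, hA₁, A₂, hA₂, F₁, h₁, T₁, hT₁, F₂, h₂, T₂, hT₂, F₃, h₃, rfl⟩ := h
      simp only [eval_and] at hF
      obtain ⟨hF₁, hF₂, hF₃, hF₄⟩ := hF
      simp only [Query.WellFormed, hA₁, hA₂, Option.some.injEq, exists_and_left,
        exists_eq_left'] at hw
      obtain ⟨hw₁, hw₂, hw₃, hφ⟩ := hw
      simp only [attrsQ, hA₁, hA₂, Option.bind_eq_bind, Option.bind_some, Option.some.injEq] at hA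
      simp only [tuplesQ, hT₁, hT₂, Option.bind_eq_bind, Option.bind_some, Option.some.injEq] at hT
      subst hA hT
      have ih₁ := agree_encQ Q₁ hD h₁ hF₁ hw₁ hA₁ hT₁
      have ih₂ := agree_encQ Q₂ hD h₂ hF₂ hw₂ hA₂ hT₂
      have hθ : ∀ t, I.del t = false →
          ((encP N S Γ (2 :: p) (present [t]) φ).eval I = .bool true ↔
            decide (evalP N S D [I.row (A₁ ++ A₂) t] φ = .bool true) = true) := by
        intro t ht
        have h1 := eval_encP (T := present [t]) φ hD h₃ hF₃ hw₃ hφ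
          (Or.inl (by simp [Interp.condRel_present_singleton ht]))
        rw [Interp.condRel_present_singleton ht] at h1
        rw [h1, decide_eq_true_iff]
      simp only [evalQ, Query.OuterJoinFree, hA₁, hA₂, Option.getD_some]
      refine ⟨?_, fun hb => hb.2.elim⟩
      rw [Interp.rel_append, Interp.rel_append,
        rel_joinF (θ := fun x => decide (evalP N S D [x] φ = .bool true)) hF₄.1 hθ,
        rel_rightPadF (θ := fun x => decide (evalP N S D [x] φ = .bool true))
          (fun i j hi hj => slot_joinF hF₄.1 hθ hi hj) hF₄.2.2,
        rel_leftPadF (θ := fun x => decide (evalP N S D [x] φ = .bool true))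
          (fun i j hi hj => slot_joinF hF₄.1 hθ hi hj) hF₄.2.1]
      exact (fullOuter_perm _ _ _ _ _).trans
        ((((crossProd_perm ih₁.1 ih₂.1).filter _).append (rightPads_perm _ _ ih₁.1 ih₂.1)).append
          (leftPads_perm _ _ ih₁.1 ih₂.1))
  | .groupBy Q Es L φ, S, Γ, D, b, p, A, T, F, hD, h, hF, hw, hA, hT => by
      simp only [encQ, Option.bind_eq_bind, Option.bind_eq_some_iff, Option.some.injEq] at h
      obtain ⟨F₁, h₁, T₁, hT₁, F₂, h₂, F₃, h₃, F₄, h₄, rfl⟩ := h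
      simp only [eval_and] at hF
      obtain ⟨hF₁, hF₂, hF₃, hF₄, hF₅, hF₆⟩ := hF
      simp only [Query.WellFormed] at hw
      obtain ⟨hw₁, hw₂, hw₃, hw₄, ⟨B, hB, hEB, hLB, hφB⟩, hagg, hGL, hGφ⟩ := hw
      simp only [attrsQ, hB, Option.bind_eq_bind, Option.bind_some, if_pos hLB,
        Option.some.injEq] at hA
      simp only [tuplesQ, hT₁, Option.bind_eq_bind, Option.bind_some, Option.some.injEq] at hT
      subst hA hT
      have ih := agree_encQ Q hD h₁ hF₁ hw₁ hB hT₁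
      simp only [evalQ, Query.OuterJoinFree]
      rw [rel_groupBy (A := B) (key := fun x => evalEs N S D [x] Es)
        (θ := fun xs => decide (evalP N S D xs φ = .bool true))
        (val := fun xs => evalL N S D xs L) (length_sigma _ _ _)
        (fun _ _ => by rw [length_encEs, length_encEs]) (fun t ht => ?_)
        (fun _ => length_encL _ _) (fun g hg => ?_) (fun g hg => ?_) hF₅ hF₆]
      · exact ih.congr (fun xs => ((groups (fun x => evalEs N S D [x] Es) xs).filter
          (fun xs => decide (evalP N S D xs φ = .bool true))).map (fun xs => evalL N S D xs L))
          (groupBy_perm hagg hGL hGφ)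
      · have h5 := eval_encEs (T := present [t]) Es hD h₂ hF₂ hw₂ hEB
          (Or.inl (by simp [Interp.condRel_present_singleton ht]))
        rw [Interp.condRel_present_singleton ht] at h5
        exact h5.symm
      · rw [eval_encP φ hD h₄ hF₄ hw₄ hφB (Or.inl hg), decide_eq_true_iff]
      · exact eval_encL L hD h₃ hF₃ hw₃ hLB (Or.inl hg)
  | .withQ bs Q, S, Γ, D, b, p, A, T, F, hD, h, hF, hw, hA, hT => by
      simp only [encQ, Option.bind_eq_bind, Option.bind_eq_some_iff, Option.some.injEq] at h
      obtain ⟨F₁, h₁, S', hS', Γ', hΓ', F₂, h₂, rfl⟩ := h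
      obtain ⟨hF₁, hF₂⟩ := eval_and.1 hF
      simp only [Query.WellFormed, hS', Option.some.injEq, exists_eq_left'] at hw
      simp only [attrsQ, hS', Option.bind_eq_bind, Option.bind_some] at hA
      simp only [tuplesQ, hΓ', Option.bind_eq_bind, Option.bind_some] at hT
      -- The new relations agree as lists only if the bindings contain no outer join, so the
      -- condition for list agreement is strengthened for the whole extended database.
      have hD' := models_encB bs (c := b ∧ bs.OuterJoinFree) hD h₁ hF₁ hw.1 hS' hΓ' id
        (fun R A T hA hT => (hD R A T hA hT).mono And.left)
      have ih := agree_encQ Q hD' h₂ hF₂ hw.2 hA hT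
      simp only [evalQ, Query.OuterJoinFree, hS', Option.getD_some]
      exact ih.mono (by tauto)
/-- The bindings of a `With` preserve agreement. -/
theorem models_encB {N : Naming} {I : Interp} : (bs : Bindings) → ∀ {S : Schema} {Γ : SymDB}
    {D : Database} {b c : Prop} {p : Label} {F : Formula} {S₀ : Schema} {Γ₀ : SymDB}
    {D₀ : Database} {S' : Schema} {Γ' : SymDB},
    I.Models b S Γ D → encB N S Γ p bs = some F → F.eval I = true → bs.WellFormed N S →
    attrsB N S bs S₀ = some S' → tuplesB Γ p bs Γ₀ = some Γ' → (c → b ∧ bs.OuterJoinFree) →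
    I.Models c S₀ Γ₀ D₀ → I.Models c S' Γ' (evalB N S D bs D₀)
  | .nil, S, Γ, D, b, c, p, F, S₀, Γ₀, D₀, S', Γ', hD, h, hF, hw, hS, hΓ, hc, hD₀ => by
      simp only [attrsB, Option.some.injEq] at hS
      simp only [tuplesB, Option.some.injEq] at hΓ
      subst hS hΓ
      simpa only [evalB] using hD₀
  | .cons R Q bs, S, Γ, D, b, c, p, F, S₀, Γ₀, D₀, S', Γ', hD, h, hF, hw, hS, hΓ, hc, hD₀ => by
      simp only [encB, Option.bind_eq_bind, Option.bind_eq_some_iff, Option.some.injEq] at h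
      obtain ⟨F₁, h₁, F₂, h₂, rfl⟩ := h
      obtain ⟨hF₁, hF₂⟩ := eval_and.1 hF
      simp only [Bindings.WellFormed] at hw
      simp only [attrsB, Option.bind_eq_bind, Option.bind_eq_some_iff] at hS
      obtain ⟨A, hA, hS⟩ := hS
      simp only [tuplesB, Option.bind_eq_bind, Option.bind_eq_some_iff] at hΓ
      obtain ⟨T, hT, hΓ⟩ := hΓ
      simp only [Bindings.OuterJoinFree] at hc
      -- Every binding is evaluated in the original `D`, and only the accumulated `D₀` is updated:
      -- the bindings do not see each other.
      have ih := agree_encQ Q hD h₁ hF₁ hw.1 hA hT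
      rw [evalB]
      exact models_encB bs hD h₂ hF₂ hw.2 hS hΓ (fun h => ⟨(hc h).1, (hc h).2.2⟩)
        (hD₀.update (ih.mono (fun h => ⟨(hc h).1, (hc h).2.1⟩)))
end

/-! # The order of sort keys -/

theorem keyLe_cons (v w : Value) (vs ws : List Value) :
    keyLe (v :: vs) (w :: ws) =
      if v.lt w then true else if w.lt v then false else keyLe vs ws := rfl

theorem keyLe_total (vs ws : List Value) : keyLe vs ws = true ∨ keyLe ws vs = true := by
  induction vs generalizing ws with
  | nil => simp [keyLe]
  | cons v vs ih =>
    cases ws with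
    | nil => simp [keyLe]
    | cons w ws =>
      rw [keyLe_cons, keyLe_cons]
      cases h : v.lt w <;> cases h' : w.lt v <;> simp [ih]

/-- `zip` ignores the surplus of the longer list, so keys of different lengths could be `≤` in both
directions without being equal. -/
theorem keyLe_antisymm {vs ws : List Value} (hlen : vs.length = ws.length)
    (h : keyLe vs ws = true) (h' : keyLe ws vs = true) : vs = ws := by
  induction vs generalizing ws with
  | nil => exact (List.length_eq_zero_iff.1 hlen.symm).symm
  | cons v vs ih =>
    cases ws with
    | nil => simp at hlen
    | cons w ws =>
      rw [keyLe_cons] at h h'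
      cases h1 : v.lt w <;> cases h2 : w.lt v <;> simp [h1, h2] at h h'
      · rw [Value.eq_of_not_lt h1 h2, ih (by simpa using hlen) h h']
      · simp [Value.lt_asymm h1] at h2

theorem keyLe_trans {us vs ws : List Value} (hlen : us.length = vs.length)
    (hlen' : vs.length = ws.length) (h : keyLe us vs = true) (h' : keyLe vs ws = true) :
    keyLe us ws = true := by
  induction us generalizing vs ws with
  | nil => simp [keyLe]
  | cons u us ih =>
    cases vs with
    | nil => simp at hlen
    | cons v vs =>
      cases ws with
      | nil => simp at hlen'
      | cons w ws =>
        rw [keyLe_cons] at h h' ⊢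
        cases h1 : u.lt v
        · cases h2 : v.lt u
          · obtain rfl := Value.eq_of_not_lt h1 h2
            cases h3 : u.lt w
            · cases h4 : w.lt u
              · simp only [h1, h3, h4, Bool.false_eq_true, if_false] at h h' ⊢
                exact ih (by simpa using hlen) (by simpa using hlen') h h'
              · simp [h3, h4] at h'
            · simp
          · simp [h1, h2] at h
        · cases h3 : v.lt w
          · cases h4 : w.lt v
            · obtain rfl := Value.eq_of_not_lt h3 h4
              simp [h1]
            · simp [h3, h4] at h'
          · simp [Value.lt_trans h1 h3]

/-- The order in which keys are sorted. -/
def SortLe (asc : Bool) (vs ws : List Value) : Prop :=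
  if asc then keyLe vs ws = true else keyLe ws vs = true

-- Ascending and descending comparison treated alike

section SortLe
variable {asc : Bool} {us vs ws : List Value}

theorem SortLe.trans (hlen : us.length = vs.length) (hlen' : vs.length = ws.length)
    (h : SortLe asc us vs) (h' : SortLe asc vs ws) : SortLe asc us ws := by
  cases asc
  · exact keyLe_trans hlen'.symm hlen.symm h' h
  · exact keyLe_trans hlen hlen' h h'

theorem SortLe.antisymm (hlen : vs.length = ws.length)
    (h : SortLe asc vs ws) (h' : SortLe asc ws vs) : vs = ws := by
  cases asc
  · exact keyLe_antisymm hlen h' h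
  · exact keyLe_antisymm hlen h h'

theorem sortLe_of_sortCmp (h : sortCmp asc vs ws = true) : SortLe asc ws vs := by
  cases asc
  · simpa [SortLe, sortCmp] using h
  · have h : keyLe vs ws = false := by simpa [sortCmp] using h
    have := keyLe_total vs ws
    simpa [SortLe, h] using this

theorem sortLe_of_not_sortCmp (h : ¬ sortCmp asc vs ws = true) : SortLe asc vs ws := by
  cases asc
  · have h : keyLe vs ws = false := by simpa [sortCmp] using h
    have := keyLe_total vs ws
    simpa [SortLe, h] using this
  · simpa [SortLe, sortCmp] using h

/-- `sortCmp asc u v` decides whether `v` replaces the current candidate `u`: in ascending order if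
it is strictly smaller, in descending order if it is at least as large. The strict and the
non-strict relation are both transitive. -/
theorem sortCmp_trans (hlen : us.length = vs.length) (hlen' : vs.length = ws.length)
    (h : sortCmp asc us vs = true) (h' : sortCmp asc vs ws = true) :
    sortCmp asc us ws = true := by
  cases asc
  · simp only [sortCmp, Bool.false_bne] at h h' ⊢
    exact keyLe_trans hlen hlen' h h'
  · simp only [sortCmp, Bool.true_bne, Bool.not_eq_true'] at h h' ⊢
    by_contra hc
    have hc : keyLe us ws = true := by simpa using hc
    have h1 := (keyLe_total vs ws).resolve_left (by simp [h'])
    have := keyLe_trans (hlen.trans hlen') hlen'.symm hc h1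
    simp [h] at this

/-- If `w` replaces a candidate `u` that `v` does not replace, then `w` also replaces `v`. With
transitivity, this is all that locating the next tuple requires, so ties need no separate treatment.
-/
theorem sortCmp_of_not_sortCmp (hlen : us.length = vs.length) (hlen' : vs.length = ws.length)
    (h : ¬ sortCmp asc us vs = true) (h' : sortCmp asc us ws = true) :
    sortCmp asc vs ws = true := by
  cases asc
  · simp only [sortCmp, Bool.false_bne] at h h' ⊢
    have h1 := (keyLe_total us vs).resolve_left h
    exact keyLe_trans hlen.symm (hlen.trans hlen') h1 h'
  · simp only [sortCmp, Bool.true_bne, Bool.not_eq_true', Bool.not_eq_false] at h h' ⊢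
    by_contra hc
    have hc : keyLe vs ws = true := by simpa using hc
    have := keyLe_trans hlen hlen' h hc
    simp [h'] at this

end SortLe

/-! # Selection sort -/

/-- Presents an ordinary list as a partial one, possibly followed by undefined positions, so that
the results about `collect` apply to it. -/
theorem collect_getElem? {α : Type*} (xs : List α) {n : ℕ} (h : xs.length ≤ n) :
    collect (fun i => xs[i]?) n = xs := by
  obtain ⟨d, rfl⟩ := Nat.exists_eq_add_of_le h
  have hd : collect (fun i => xs[xs.length + i]?) d = [] := by simp [collect]
  rw [collect_add, hd, List.append_nil]
  clear h hd
  induction xs using List.reverseRecOn with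
  | nil => rfl
  | append_singleton xs x ih =>
    rw [List.length_append, List.length_singleton, collect_succ,
      collect_congr (fun i hi => List.getElem?_append_left hi), ih]
    simp

section BagDiff
variable {α : Type*} [DecidableEq α]

theorem bagDiff_append (xs ys zs : List α) :
    bagDiff xs (ys ++ zs) = bagDiff (bagDiff xs ys) zs := by
  simp [bagDiff_eq_diff, List.diff_append]

theorem bagDiff_singleton (xs : List α) (y : α) : bagDiff xs [y] = xs.erase y := by
  simp [bagDiff_eq_diff]

theorem perm_cons_bagDiff {xs : List α} {y : α} (h : y ∈ xs) :
    xs.Perm (y :: bagDiff xs [y]) := by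
  rw [bagDiff_singleton]
  exact List.perm_cons_erase h

theorem mem_of_mem_bagDiff {xs ys : List α} {x : α} (h : x ∈ bagDiff xs ys) : x ∈ xs := by
  rw [bagDiff_eq_diff] at h
  exact List.diff_subset _ _ h

theorem bagDiff_singleton_collect (s : ℕ → Option α) (n : ℕ) (y : α) :
    bagDiff (collect s n) [y] =
      collect (fun i => if s i = some y ∧ ∀ k < i, s k ≠ some y then none else s i) n := by
  rw [bagDiff_singleton, erase_collect]

end BagDiff

-- The concrete selection sort

section Sorting
variable {key : Tuple → List Value} {asc : Bool}

/-- The fold starts at the head of the list, with a meaningless default for the empty list, which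
therefore needs its own case. -/
theorem minTuple_append_singleton (xs : Relation) (y : Tuple) :
    minTuple key asc (xs ++ [y]) = if xs = [] then y else
      if sortCmp asc (key (minTuple key asc xs)) (key y) then y else minTuple key asc xs := by
  cases xs with
  | nil => simp [minTuple]
  | cons x xs => simp [minTuple, List.foldl_append]

/-- The position of the tuple that selection sort takes next. -/
theorem exists_minTuple {m : ℕ} (hkey : ∀ x, (key x).length = m) (s : ℕ → Option Tuple) (n : ℕ)
    (hne : collect s n ≠ []) :
    ∃ k < n, s k = some (minTuple key asc (collect s n)) ∧
      (∀ k' < k, ∀ x, s k' = some x →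
        sortCmp asc (key x) (key (minTuple key asc (collect s n))) = true) ∧
      ∀ k' < n, k < k' → ∀ x, s k' = some x →
        ¬ sortCmp asc (key (minTuple key asc (collect s n))) (key x) = true := by
  have hlen : ∀ x y, (key x).length = (key y).length := fun x y => by rw [hkey, hkey]
  induction n with
  | zero => exact (hne rfl).elim
  | succ n ih =>
    rw [collect_succ] at hne ⊢
    cases hs : s n with
    | none =>
      rw [hs, Option.toList_none, List.append_nil] at hne
      obtain ⟨k, hk, h1, h2, h3⟩ := ih hne
      rw [Option.toList_none, List.append_nil]
      refine ⟨k, by omega, h1, h2, fun k' hk' hlt x hx => ?_⟩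
      refine h3 k' ?_ hlt x hx
      by_contra hc
      obtain rfl : k' = n := by omega
      simp [hs] at hx
    | some y =>
      rw [Option.toList_some, minTuple_append_singleton]
      by_cases hnil : collect s n = []
      · rw [if_pos hnil]
        refine ⟨n, by omega, hs, fun k' hk' x hx => ?_, fun k' _ _ => by omega⟩
        have : x ∈ collect s n := mem_collect.2 ⟨k', hk', hx⟩
        simp [hnil] at this
      · rw [if_neg hnil]
        obtain ⟨k, hk, h1, h2, h3⟩ := ih hnil
        split_ifs with hc
        · refine ⟨n, by omega, hs, fun k' hk' x hx => ?_, fun k' _ _ => by omega⟩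
          -- `y` replaces the old candidate at `k`. It would replace the earlier tuples by
          -- transitivity, and the later ones because they did not replace the candidate.
          rcases Nat.lt_trichotomy k' k with hlt | rfl | hlt
          · exact sortCmp_trans (hlen _ _) (hlen _ _) (h2 k' hlt x hx) hc
          · rw [h1] at hx
            obtain rfl := Option.some.inj hx
            exact hc
          · exact sortCmp_of_not_sortCmp (hlen _ _) (hlen _ _) (h3 k' hk' hlt x hx) hc
        · refine ⟨k, by omega, h1, h2, fun k' hk' hlt x hx => ?_⟩
          by_cases hk'n : k' = n
          · subst hk'n
            rw [hs] at hx
            obtain rfl := Option.some.inj hx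
            exact hc
          · exact h3 k' (by omega) hlt x hx

theorem minTuple_mem {m : ℕ} (hkey : ∀ x, (key x).length = m) {xs : Relation} (hne : xs ≠ []) :
    minTuple key asc xs ∈ xs := by
  rw [← collect_getElem? xs le_rfl] at hne
  obtain ⟨k, -, h, -⟩ := exists_minTuple (asc := asc) hkey _ _ hne
  rw [collect_getElem? xs le_rfl] at h
  exact List.mem_of_getElem? h

theorem minTuple_le {m : ℕ} (hkey : ∀ x, (key x).length = m) {xs : Relation} {y : Tuple}
    (hy : y ∈ xs) : SortLe asc (key (minTuple key asc xs)) (key y) := by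
  have hne : collect (fun i => xs[i]?) xs.length ≠ [] := by
    rw [collect_getElem? xs le_rfl]; exact List.ne_nil_of_mem hy
  obtain ⟨k, -, h1, h2, h3⟩ := exists_minTuple (asc := asc) hkey _ _ hne
  rw [collect_getElem? xs le_rfl] at h1 h2 h3
  obtain ⟨k', hk', rfl⟩ := List.mem_iff_getElem.1 hy
  have hx : xs[k']? = some xs[k'] := List.getElem?_eq_getElem hk'
  rcases Nat.lt_trichotomy k' k with hlt | rfl | hlt
  · exact sortLe_of_sortCmp (h2 k' hlt _ hx)
  · rw [hx] at h1
    rw [← Option.some.inj h1]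
    cases asc <;> simpa [SortLe] using keyLe_total (key xs[k']) (key xs[k'])
  · exact sortLe_of_not_sortCmp (h3 k' hk' hlt _ hx)

/-- The first `i` tuples of the sorted relation. -/
def picks (key : Tuple → List Value) (asc : Bool) (r : Relation) : ℕ → Relation
  | 0 => []
  | i + 1 => picks key asc r i ++ [minTuple key asc (bagDiff r (picks key asc r i))]

/-- The list folded over serves only to count the steps. -/
theorem orderRel_eq_picks (r : Relation) : orderRel key asc r = picks key asc r r.length := by
  have h : ∀ i, (fun xs => xs ++ [minTuple key asc (bagDiff r xs)])^[i] [] = picks key asc r i := by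
    intro i
    induction i with
    | zero => rfl
    | succ i ih => rw [Function.iterate_succ_apply', ih, picks]
  rw [orderRel, List.foldl_const, h]

theorem length_picks (r : Relation) (i : ℕ) : (picks key asc r i).length = i := by
  induction i with
  | zero => rfl
  | succ i ih => simp [picks, ih]

theorem bagDiff_picks_succ (r : Relation) (i : ℕ) :
    bagDiff r (picks key asc r (i + 1)) =
      bagDiff (bagDiff r (picks key asc r i))
        [minTuple key asc (bagDiff r (picks key asc r i))] := by
  rw [picks, bagDiff_append]

/-- Every step moves one tuple from the remainder to the output. Before step `r.length` the
remainder is nonempty by counting, so the tuple taken does occur in it. -/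
theorem picks_perm {m : ℕ} (hkey : ∀ x, (key x).length = m) (r : Relation) (i : ℕ)
    (hi : i ≤ r.length) : (picks key asc r i ++ bagDiff r (picks key asc r i)).Perm r := by
  induction i with
  | zero => simp [picks, bagDiff]
  | succ i ih =>
    have ih := ih (by omega)
    have hne : bagDiff r (picks key asc r i) ≠ [] := by
      intro h
      have := ih.length_eq
      rw [h, List.append_nil, length_picks] at this
      omega
    rw [bagDiff_picks_succ, picks, List.append_assoc]
    exact ((perm_cons_bagDiff (minTuple_mem hkey hne)).symm.append_left _).trans ih

theorem bagDiff_picks_eq_nil_iff {m : ℕ} (hkey : ∀ x, (key x).length = m) (r : Relation) (i : ℕ)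
    (hi : i ≤ r.length) : bagDiff r (picks key asc r i) = [] ↔ i = r.length := by
  have := (picks_perm (asc := asc) hkey r i hi).length_eq
  rw [List.length_append, length_picks] at this
  rw [← List.length_eq_zero_iff]
  omega

theorem orderRel_perm {m : ℕ} (hkey : ∀ x, (key x).length = m) (r : Relation) :
    (orderRel key asc r).Perm r := by
  have := picks_perm (asc := asc) hkey r r.length le_rfl
  rwa [(bagDiff_picks_eq_nil_iff hkey r _ le_rfl).2 rfl, List.append_nil,
    ← orderRel_eq_picks] at this

/-- The second half is the invariant that carries the induction: whatever has been taken precedes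
whatever is left, and the remainder only shrinks. -/
theorem picks_sorted {m : ℕ} (hkey : ∀ x, (key x).length = m) (r : Relation) (i : ℕ)
    (hi : i ≤ r.length) :
    ((picks key asc r i).map key).Pairwise (SortLe asc) ∧
      ∀ x ∈ picks key asc r i, ∀ y ∈ bagDiff r (picks key asc r i),
        SortLe asc (key x) (key y) := by
  induction i with
  | zero => simp [picks]
  | succ i ih =>
    obtain ⟨h1, h2⟩ := ih (by omega)
    have hne : bagDiff r (picks key asc r i) ≠ [] := by
      rw [Ne, bagDiff_picks_eq_nil_iff hkey r i (by omega)]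
      omega
    rw [bagDiff_picks_succ, picks]
    constructor
    · rw [List.map_append, List.pairwise_append]
      refine ⟨h1, by simp, ?_⟩
      simp only [List.map_cons, List.map_nil, List.mem_map, List.mem_singleton]
      rintro _ ⟨x, hx, rfl⟩ _ rfl
      exact h2 x hx _ (minTuple_mem hkey hne)
    · intro x hx y hy
      have hy := mem_of_mem_bagDiff hy
      rcases List.mem_append.1 hx with hx | hx
      · exact h2 x hx y hy
      · rw [List.mem_singleton.1 hx]
        exact minTuple_le hkey hy

/-- The sorted lists of keys of permuted relations coincide. -/
theorem map_key_orderRel {m : ℕ} (hkey : ∀ x, (key x).length = m) {r r' : Relation}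
    (h : r.Perm r') : (orderRel key asc r).map key = (orderRel key asc r').map key := by
  have hp : ((orderRel key asc r).map key).Perm ((orderRel key asc r').map key) :=
    (((orderRel_perm hkey r).trans h).trans (orderRel_perm hkey r').symm).map key
  -- A list sorted by an antisymmetric relation is determined by its bag. Antisymmetry holds for
  -- keys, not for the tuples themselves, so only the lists of keys are equal.
  refine hp.eq_of_pairwise (le := SortLe asc) (fun a b ha hb hab hba => ?_) ?_ ?_
  · obtain ⟨x, -, rfl⟩ := List.mem_map.1 ha
    obtain ⟨y, -, rfl⟩ := List.mem_map.1 hb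
    exact hab.antisymm (by rw [hkey, hkey]) hba
  · rw [orderRel_eq_picks]; exact (picks_sorted hkey r _ le_rfl).1
  · rw [orderRel_eq_picks]; exact (picks_sorted hkey r' _ le_rfl).1

end Sorting

/-! # Correctness of the encoding of sorting -/

section SortEncoding
variable {I : Interp} {A : List AttrName} {T T' T'' : List SymTuple}

theorem eval_countT (T : List SymTuple) : (countT T).eval I = .int (I.rel A T).length := by
  unfold countT
  rw [eval_foldl_arith, List.map_map]
  induction T using List.reverseRecOn with
  | nil => rfl
  | append_singleton T t ih =>
    rw [List.map_append, List.foldl_append, ih, Interp.rel_append]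
    cases h : I.del t <;> simp [Term.eval, Formula.eval, h, Interp.rel, ArithOp.apply]

theorem Interp.exists_of_getElem?_rel (T : List SymTuple) {c : ℕ} {x : Tuple}
    (h : (I.rel A T)[c]? = some x) :
    ∃ d, ∃ hd : d < T.length, I.del T[d] = false ∧ (I.rel A (T.take d)).length = c ∧
      I.row A T[d] = x := by
  induction T using List.reverseRecOn with
  | nil => simp [Interp.rel] at h
  | append_singleton T t ih =>
    rw [Interp.rel_append] at h
    by_cases hc : c < (I.rel A T).length
    · rw [List.getElem?_append_left hc] at h
      obtain ⟨d, hd, h1, h2, h3⟩ := ih h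
      refine ⟨d, by simp; omega, ?_, ?_, ?_⟩
      · rwa [List.getElem_append_left hd]
      · rwa [List.take_append_of_le_length hd.le]
      · rwa [List.getElem_append_left hd]
    · rw [List.getElem?_append_right (by omega)] at h
      cases hd : I.del t
      · have h1 : I.rel A [t] = [I.row A t] := by simp [Interp.rel, hd, Interp.row]
        rw [h1] at h
        have hc0 : c - (I.rel A T).length = 0 := by
          by_contra hne
          rw [List.getElem?_eq_none (by simp; omega)] at h
          simp at h
        rw [hc0] at h
        refine ⟨T.length, by simp, by simpa using hd, ?_, by simpa using h⟩
        rw [List.take_left]; omega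
      · simp [Interp.rel, hd] at h

theorem Interp.length_rel_le (I : Interp) (A : List AttrName) (T : List SymTuple) :
    (I.rel A T).length ≤ T.length := by
  unfold Interp.rel
  rw [List.length_map]
  exact List.length_filter_le _ _

/-- The present row with index `c` belongs to the position with exactly `c` present tuples before
it, which is the guard in `moveDelF`. From the number of present tuples on, all positions are
deleted. -/
theorem rel_moveDelF (hlen : T''.length = T.length) (h : (moveDelF A T T'').eval I = true) :
    I.rel A T'' = I.rel A T := by
  rw [← collect_getElem? (I.rel A T) (I.length_rel_le A T)]
  refine Interp.rel_eq_of_slots hlen (fun c hc => ?_)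
  have h := eval_conjL_zipIdx.1 h c hc
  rw [eval_and, eval_conjL_zipIdx, eval_imp, eval_del] at h
  obtain ⟨h1, h2⟩ := h
  cases hx : (I.rel A T)[c]? with
  | none =>
    refine Interp.slot_of_del (h2 ?_)
    rw [List.getElem?_eq_none_iff] at hx
    simp only [Formula.eval, eval_countT (A := A), Term.eval, CmpOp.holds, Value.lt]
    simpa using hx
  | some x =>
    obtain ⟨d, hd, hdel, hcount, rfl⟩ := Interp.exists_of_getElem?_rel T hx
    have h3 := h1 d hd
    rw [eval_imp, eval_and, eval_notDel, eval_eq, eval_countT (A := A)] at h3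
    rw [Interp.slot_congr (h3 ⟨hdel, by simp [hcount, Term.eval]⟩), Interp.slot_of_not_del hdel]

theorem eval_keyLeF (ks ks' : List Term) :
    (keyLeF ks ks').eval I = keyLe (ks.map (Term.eval I)) (ks'.map (Term.eval I)) := by
  induction ks generalizing ks' with
  | nil => simp [keyLeF, keyLe, Formula.eval]
  | cons k ks ih =>
    cases ks' with
    | nil => simp [keyLeF, keyLe, Formula.eval]
    | cons k' ks' =>
      rw [List.map_cons, List.map_cons, keyLe_cons, ← ih]
      simp only [keyLeF, List.zip_cons_cons, List.foldr_cons, Formula.eval]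
      cases (k.eval I).lt (k'.eval I) <;> cases (k'.eval I).lt (k.eval I) <;> simp

theorem eval_sortCmpF (asc : Bool) (ks ks' : List Term) :
    (sortCmpF asc ks ks').eval I =
      sortCmp asc (ks.map (Term.eval I)) (ks'.map (Term.eval I)) := by
  cases asc <;> simp [sortCmpF, sortCmp, Formula.eval, eval_keyLeF]

-- Simulating the steps of selection sort

section Selection
variable {asc : Bool} {keyT : SymTuple → List Term} {key : Tuple → List Value} {m : ℕ}
  {g : SymTuple × ℕ → Formula} {s : ℕ → Option Tuple}

theorem eval_selF {k : ℕ} (hk : k < T.length) :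
    (selF asc keyT T g (T[k], k)).eval I = true ↔ (g (T[k], k)).eval I = true ∧
      ∀ k' (hk' : k' < T.length), (g (T[k'], k')).eval I = true →
        (k' < k → sortCmp asc ((keyT T[k']).map (Term.eval I))
          ((keyT T[k]).map (Term.eval I)) = true) ∧
        (k < k' → ¬ sortCmp asc ((keyT T[k]).map (Term.eval I))
          ((keyT T[k']).map (Term.eval I)) = true) := by
  rw [selF, eval_and, eval_conjL_zipIdx]
  refine and_congr_right (fun _ => forall_congr' (fun k' => forall_congr' (fun hk' => ?_)))
  simp only
  rcases Nat.lt_trichotomy k' k with hlt | rfl | hlt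
  · rw [if_pos hlt, eval_imp, eval_sortCmpF]
    simp [hlt, Nat.lt_asymm hlt]
  · simp [Formula.eval]
  · rw [if_neg (Nat.lt_asymm hlt), if_pos hlt, eval_imp, eval_not, eval_sortCmpF]
    simp [hlt, Nat.lt_asymm hlt]

/-- `s` lists the rows of the tuples of `T` that satisfy `g`. -/
def Lists (I : Interp) (A : List AttrName) (T : List SymTuple) (g : SymTuple × ℕ → Formula)
    (s : ℕ → Option Tuple) : Prop :=
  ∀ k (hk : k < T.length),
    ((g (T[k], k)).eval I = true → I.del T[k] = false ∧ s k = some (I.row A T[k])) ∧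
    (¬ (g (T[k], k)).eval I = true → s k = none)

theorem Lists.eval {hs : Lists I A T g s} {k : ℕ} (hk : k < T.length) {x : Tuple}
    (hx : s k = some x) : (g (T[k], k)).eval I = true ∧ I.del T[k] = false ∧ I.row A T[k] = x := by
  by_cases hg : (g (T[k], k)).eval I = true
  · obtain ⟨h1, h2⟩ := (hs k hk).1 hg
    rw [h2] at hx
    exact ⟨hg, h1, Option.some.inj hx⟩
  · rw [(hs k hk).2 hg] at hx
    simp at hx

variable (hkey : ∀ x, (key x).length = m)
  (hkeyT : ∀ t, I.del t = false → (keyT t).map (Term.eval I) = key (I.row A t))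
include hkey hkeyT

/-- `selF` states precisely the comparisons with earlier and later candidates that `exists_minTuple`
provides for the position of the next tuple. -/
theorem Lists.exists_sel (hs : Lists I A T g s) (hne : collect s T.length ≠ []) :
    ∃ k, ∃ hk : k < T.length, (selF asc keyT T g (T[k], k)).eval I = true ∧
      I.row A T[k] = minTuple key asc (collect s T.length) ∧ I.del T[k] = false := by
  obtain ⟨k, hk, h1, h2, h3⟩ := exists_minTuple (asc := asc) hkey s T.length hne
  obtain ⟨hg, hd, hrow⟩ := Lists.eval (hs := hs) hk h1
  refine ⟨k, hk, (eval_selF hk).2 ⟨hg, fun k' hk' hg' => ?_⟩, hrow, hd⟩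
  obtain ⟨hd', hs'⟩ := (hs k' hk').1 hg'
  rw [hkeyT _ hd, hkeyT _ hd', hrow]
  exact ⟨fun hlt => h2 k' hlt _ hs', fun hlt => h3 k' hk' hlt _ hs'⟩

omit hkey hkeyT in
-- Of two selected positions, the later one would both replace and not replace the earlier one.
theorem sel_unique {k k' : ℕ} (hk : k < T.length) (hk' : k' < T.length)
    (h : (selF asc keyT T g (T[k], k)).eval I = true)
    (h' : (selF asc keyT T g (T[k'], k')).eval I = true) : k = k' := by
  rw [eval_selF] at h h'
  rcases Nat.lt_trichotomy k k' with hlt | rfl | hlt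
  · exact absurd ((h'.2 k hk h.1).1 hlt) ((h.2 k' hk' h'.1).2 hlt)
  · rfl
  · exact absurd ((h.2 k' hk' h'.1).1 hlt) ((h'.2 k hk h.1).2 hlt)

/-- Concretely, the tuple taken is erased by value at its first occurrence, which need not be the
position selected. `matchF` therefore marks all candidates with the same row. -/
theorem Lists.eval_matchF (hs : Lists I A T g s) {k : ℕ} (hk : k < T.length) :
    (matchF A asc keyT T g (T[k], k)).eval I = true ↔
      s k = some (minTuple key asc (collect s T.length)) := by
  rw [matchF, eval_and, eval_disjL_zipIdx]
  simp only [eval_and, eval_attrsAre (I := I) (A := A) (vs := attrsOf A _)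
    (List.length_map _), map_eval_attrsOf]
  constructor
  · rintro ⟨hg, k', hk', hsel, heq⟩
    have h1 := ((hs k hk).1 hg).2
    have hne : collect s T.length ≠ [] :=
      List.ne_nil_of_mem (mem_collect.2 ⟨k, hk, h1⟩)
    obtain ⟨k₀, hk₀, hsel₀, hrow₀, -⟩ := hs.exists_sel (asc := asc) hkey hkeyT hne
    obtain rfl := sel_unique hk' hk₀ hsel hsel₀
    rw [h1, ← hrow₀, Interp.row_eq_row_iff.2 heq]
  · intro h
    obtain ⟨hg, -, hrow⟩ := Lists.eval (hs := hs) hk h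
    have hne : collect s T.length ≠ [] :=
      List.ne_nil_of_mem (mem_collect.2 ⟨k, hk, h⟩)
    obtain ⟨k₀, hk₀, hsel₀, hrow₀, -⟩ := hs.exists_sel (asc := asc) hkey hkeyT hne
    exact ⟨hg, k₀, hk₀, hsel₀, Interp.row_eq_row_iff.1 (hrow.trans hrow₀.symm)⟩

/-- The tuples that are left after `i` steps are those of the concrete selection sort. -/
theorem exists_lists_leftF (i : ℕ) :
    ∃ s, Lists I A T (leftF A asc keyT T i) s ∧
      collect s T.length = bagDiff (I.rel A T) (picks key asc (I.rel A T) i) := by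
  induction i with
  | zero =>
    refine ⟨I.slots A T, fun k hk => ?_, ?_⟩
    · rw [leftF, eval_notDel, Interp.slots_eq hk]
      exact ⟨fun h => ⟨h, Interp.slot_of_not_del h⟩,
        fun h => Interp.slot_of_del (by simpa using h)⟩
    · rw [← Interp.rel_eq_collect]; rfl
  | succ i ih =>
    obtain ⟨s, hs, hc⟩ := ih
    rw [bagDiff_picks_succ, ← hc, bagDiff_singleton_collect]
    refine ⟨_, fun k hk => ?_, rfl⟩
    -- The tuple dropped is the first match, and this is the position that `erase` clears in a
    -- partial list.
    have hleft : (leftF A asc keyT T (i + 1) (T[k], k)).eval I = true ↔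
        (leftF A asc keyT T i (T[k], k)).eval I = true ∧
        ¬ (s k = some (minTuple key asc (collect s T.length)) ∧
          ∀ k' < k, s k' ≠ some (minTuple key asc (collect s T.length))) := by
      rw [leftF, eval_and, eval_not, eval_and, hs.eval_matchF hkey hkeyT hk, eval_conjL_zipIdx]
      refine and_congr_right (fun _ => not_congr (and_congr_right (fun _ => ?_)))
      constructor
      · intro h k' hk'
        have := h k' (by simp; omega)
        rw [eval_not, List.getElem_take, hs.eval_matchF hkey hkeyT (by omega)] at this
        exact this
      · intro h k' hk'
        have hk'' : k' < k := by
          rw [List.length_take] at hk'; omega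
        rw [eval_not, List.getElem_take, hs.eval_matchF hkey hkeyT (by omega)]
        exact h k' hk''
    rw [hleft]
    constructor
    · rintro ⟨h1, h2⟩
      rw [if_neg h2]
      exact (hs k hk).1 h1
    · intro h
      split_ifs with hif
      · rfl
      · exact (hs k hk).2 (fun hg => h ⟨hg, hif⟩)

/-- Each result tuple copies the tuple that the concrete sort takes at the same step. As some tuples
of `T''` may be deleted, the remainder can be exhausted early, and the surplus result tuples are
then deleted. -/
theorem rel_sortF (hlen : T'.length = T''.length)
    (h : (sortF A asc keyT T'' T').eval I = true) :
    I.rel A T' = orderRel key asc (I.rel A T'') := by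
  have hslot : ∀ i (hi : i < T'.length), I.slot A T'[i] =
      if bagDiff (I.rel A T'') (picks key asc (I.rel A T'') i) = [] then none
      else some (minTuple key asc (bagDiff (I.rel A T'') (picks key asc (I.rel A T'') i))) := by
    intro i hi
    have h := eval_conjL_zipIdx.1 h i hi
    rw [eval_and, eval_conjL_zipIdx, eval_imp, eval_conjL_zipIdx, eval_del] at h
    obtain ⟨h1, h2⟩ := h
    obtain ⟨s, hs, hc⟩ := exists_lists_leftF (asc := asc) (T := T'') hkey hkeyT i
    rw [← hc]
    split_ifs with hnil
    · refine Interp.slot_of_del (h2 (fun k hk => ?_))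
      rw [eval_not]
      intro hg
      have := mem_collect.2 ⟨k, hk, ((hs k hk).1 hg).2⟩
      simp [hnil] at this
    · obtain ⟨k, hk, hsel, hrow, hd⟩ := hs.exists_sel (asc := asc) hkey hkeyT hnil
      have h3 := h1 k hk
      rw [eval_imp] at h3
      rw [Interp.slot_congr (h3 hsel), Interp.slot_of_not_del hd, hrow]
  rw [Interp.rel_eq_of_slots rfl hslot, orderRel_eq_picks]
  have hle : (I.rel A T'').length ≤ T'.length := hlen ▸ I.length_rel_le A T''
  have hpicks : ∀ i ≤ (I.rel A T'').length, collect (fun i =>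
      if bagDiff (I.rel A T'') (picks key asc (I.rel A T'') i) = [] then none
      else some (minTuple key asc (bagDiff (I.rel A T'') (picks key asc (I.rel A T'') i)))) i =
      picks key asc (I.rel A T'') i := by
    intro i
    induction i with
    | zero => intro _; rfl
    | succ i ih =>
      intro hi
      rw [collect_succ, ih (by omega), if_neg, picks]
      · rfl
      · rw [bagDiff_picks_eq_nil_iff hkey _ _ (by omega)]; omega
  -- `picks` goes on with default tuples after the remainder is exhausted, but removing them from an
  -- empty remainder leaves it empty.
  have hnil : ∀ i, bagDiff (I.rel A T'')
      (picks key asc (I.rel A T'') ((I.rel A T'').length + i)) = [] := by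
    intro i
    induction i with
    | zero => exact (bagDiff_picks_eq_nil_iff hkey _ _ le_rfl).2 rfl
    | succ i ih => rw [← Nat.add_assoc, bagDiff_picks_succ, ih]; rfl
  obtain ⟨d, hd⟩ := Nat.exists_eq_add_of_le hle
  rw [hd, collect_add, hpicks _ le_rfl]
  simp [hnil, collect]

end Selection

end SortEncoding

end Sql

-- The main theorem

theorem Sql.length_evalEs {N : Sql.Naming} {S : Sql.Schema} {D : Sql.Database}
    {xs : Sql.Relation} : (Es : Sql.ExprList) → (Sql.evalEs N S D xs Es).length = Es.length
  | .nil => by simp [Sql.evalEs, Sql.ExprList.length]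
  | .cons E Es => by simp [Sql.evalEs, Sql.ExprList.length, Sql.length_evalEs Es]

theorem mainTheorem3 (N : Sql.Naming) (S : Sql.Schema) (Γ : Sql.SymDB) (Q : Sql.TopQuery)
    (A : List Sql.AttrName) (R : List Sql.SymTuple) (Φ : Sql.Formula) (I : Sql.Interp)
    (hwf : Q.WellFormed N S) (hA : Q.HasAttrs N S A)
    (hR : Q.YieldsTuples Γ R) (hΦ : Q.EncodesTo N S Γ Φ) (hI : I.Satisfies Φ) :
    -- the two relations are equal as bags
    (Q.eval N S (I.db S Γ)).Perm (I.rel A R) ∧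
    -- the results of sorting are equal as lists, up to the order of tuples with equal sort keys
    (∀ Q' Es asc, Q = Sql.TopQuery.orderBy Q' Es asc →
      Sql.sortKeys N S (I.db S Γ) Es (Q.eval N S (I.db S Γ)) =
        Sql.sortKeys N S (I.db S Γ) Es (I.rel A R)) ∧
    -- without outer joins, they are equal as lists
    (Q.OuterJoinFree → Q.eval N S (I.db S Γ) = I.rel A R) := by
  open Sql in
  -- The input relations agree literally, so the condition for list agreement starts as `True`.
  have hD := I.models_db S Γ
  cases Q with
  | plain Q =>
    have h := agree_encQ Q hD hΦ hI hwf hA hR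
    exact ⟨h.1, fun _ _ _ hQ => TopQuery.noConfusion hQ, fun hQ => h.2 ⟨trivial, hQ⟩⟩
  | orderBy Q Es asc =>
    obtain ⟨hw₁, hw₂, B, hB, hEB⟩ := hwf
    obtain rfl : A = B := Option.some.inj (hA.symm.trans hB)
    simp only [TopQuery.EncodesTo, TopQuery.encode, hB, Option.bind_eq_bind, Option.bind_some,
      Option.bind_eq_some_iff, Option.some.injEq] at hΦ
    obtain ⟨F₁, h₁, T, hT, F₂, h₂, rfl⟩ := hΦ
    simp only [Interp.Satisfies, eval_and] at hI
    obtain ⟨hF₁, hF₂, hF₃, hF₄⟩ := hI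
    simp only [TopQuery.YieldsTuples, TopQuery.tuples, hT, Option.bind_eq_bind, Option.bind_some,
      Option.some.injEq] at hR
    subst hR
    have ih := agree_encQ Q hD h₁ hF₁ hw₁ hB hT
    -- All keys have a common length, as transitivity and antisymmetry of the order on keys require.
    have hkey : ∀ x : Tuple, (evalEs N S (I.db S Γ) [x] Es).length = Es.length :=
      fun x => length_evalEs Es
    -- As a list, the symbolic output is the concrete sort of `I.rel A T`. It remains to compare the
    -- sorts of two relations that agree.
    have hsort : I.rel A (sigma [] 0 T.length) =
        orderRel (fun x => evalEs N S (I.db S Γ) [x] Es) asc (I.rel A T) := by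
      rw [rel_sortF (key := fun x => evalEs N S (I.db S Γ) [x] Es) hkey (fun t ht => ?_)
        (by simp [length_sigma]) hF₄, rel_moveDelF (length_sigma _ _ _) hF₃]
      have h5 := eval_encEs (T := present [t]) Es hD h₂ hF₂ hw₂ hEB
        (Or.inl (by simp [Interp.condRel_present_singleton ht]))
      rw [Interp.condRel_present_singleton ht] at h5
      exact h5.symm
    rw [hsort]
    refine ⟨?_, ?_, fun hQ => ?_⟩
    · exact ((orderRel_perm hkey _).trans ih.1).trans (orderRel_perm hkey _).symm
    · rintro Q' Es' asc' hQ
      cases hQ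
      exact map_key_orderRel hkey ih.1
    · rw [TopQuery.eval, ih.2 ⟨trivial, hQ⟩]
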